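/- Let $(X,\mathcal X)$ and $(Y,\mathcal Y)$ be measurable spaces in which singletons are measurable. Let $\mathfrak C(X)$ be the space of countable subsets of $X$ (countable sums of distinct Dirac masses), with the $\sigma$-field generated by the maps $\omega\mapsto \mathrm{card}(\omega\cap A)$, $A\in\mathcal X$; define $\mathfrak C(X\times Y)$ similarly. Let $\mathbb Q$ be any probability measure on $\mathfrak C(X)$ and $\mu$ a probability measure on $Y$. Let $\mathbb P$ be the law on $\mathfrak C(X\times Y)$ of the random measure $N$ obtained by giving i.i.d. marks of law $\mu$ to the points of a random configuration $m$ of law $\mathbb Q$. Thus, given $m$, $N$ is the set $\{(x,u_x):x\in m\}$ with $u=(u_x)_{x\in m}$ of law $\mu^{m}$. Let $(Y,\mathcal Y,\mu,\mathbf d,\gamma)$ be a local Dirichlet structure with carré du champ: $\mathbf d\subset L^2(\mu)$ is a dense subspace, $\gamma:\mathbf d\times\mathbf d\to L^1(\mu)$ is symmetric, bilinear and positive, and $e=\frac12\int\gamma\,d\mu$ is a closed local form, on which normal contractions operate, with carré du champ operator $\gamma$. Let $\mathbb D$ be the set of $F\in L^2(\mathbb P)$ such that, for $\mathbb Q$-a.e.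 $m$, for every $x\in m$ and almost every value of the other marks, $F$ belongs to $\mathbf d$ as a function of the mark of $x$, and such that $\mathbb E_{\mathbb P}\big[\sum_x\gamma_x[F]\big]<\infty$, where $\gamma_x[F]$ is the result of letting $\gamma$ act on the mark of $x$. For $F,G\in\mathbb D$ let $\Gamma[F,G]=\sum_x\gamma_x[F,G]$ and $\Gamma[F]=\Gamma[F,F]$. The finite products $(Y,\mathcal Y,\mu,\mathbf d,\gamma)^n$ are defined in the same way on $Y^n$ with the measure $\mu^n$. A structure $(\Omega,\nu,\mathbf D,\Gamma)$ satisfies (EID) if for every $k$ and every $U\in\mathbf D^k$ the image by $U$ of $\det(\Gamma[U_i,U_j])_{i,j}\cdot\nu$ is absolutely continuous with respect to Lebesgue measure on $\mathbb R^k$. Theorem 2. (a) $\mathbb P$ is a probability measure, $\mathbb D$ is a vector space, and $\Gamma$ is the carré du champ operator of the closed local form $\mathcal E=\frac12\mathbb E_{\mathbb P}\Gamma$ with domain $\mathbb D$, on which normal contractions operate. If $1\in\mathbf d$, or if $m$ is finite for $\mathbb Q$-a.e. $m$, then $\mathbb D$ is dense in $L^2(\mathbb P)$, so that $(\mathfrak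 C(X\times Y),\mathbb P,\mathbb D,\Gamma)$ is a local Dirichlet structure with carré du champ. (b) (Lent particle formula) For every $F\in\mathbb D$, $$\Gamma[F]=\int\varepsilon^-\gamma[\varepsilon^+F]\,dN,$$ where $(\varepsilon^+F)(\varpi,(x,v))=F(\varpi\cup\{(x,v)\})$, $\gamma$ acts on the variable $v$, and $(\varepsilon^-K)(\varpi,z)=K(\varpi\setminus\{z\},z)$. Precisely, versions $K$ of $\gamma[\varepsilon^+F]$ exist, measurable in the marks. For every version, the integral exists and the formula holds for $\mathbb Q$-a.e. $m$ and $\mu^m$-a.e. value of the marks. For a suitable version it holds $\mathbb P$-a.e. (c) If every finite product $(Y,\mathcal Y,\mu,\mathbf d,\gamma)^n$, $n\in\mathbb N$, satisfies (EID), then $(\mathfrak C(X\times Y),\mathbb P,\mathbb D,\Gamma)$ satisfies (EID). -/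

import Mathlib

open MeasureTheory Filter Topology
open scoped ENNReal ContDiff

noncomputable section

/-! ### Local Dirichlet structures with carré du champ -/

section Dirichlet

variable {Ω : Type*} [MeasurableSpace Ω] {ν : Measure Ω}

/-- The bilinear form `e(f, g) = ½ ∫ γ[f, g] dν` attached to an operator `γ`. -/
def energy (γ : Lp ℝ 2 ν → Lp ℝ 2 ν → Lp ℝ 1 ν) (f g : Lp ℝ 2 ν) : ℝ :=
  (1 / 2) * ∫ ϖ, γ f g ϖ ∂ν

/-- `f` is essentially bounded. -/
def EssBounded (f : Lp ℝ 2 ν) : Prop := ∃ C : ℝ, ∀ᵐ ϖ ∂ν, |f ϖ| ≤ C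

/-- All the requirements on a local Dirichlet form `e = ½ ∫ γ dν` with domain `d ⊆ L²(ν)` and
carré du champ operator `γ : d × d → L¹(ν)`, except that the domain is not required to be dense.
(The values of `γ` outside `d` are irrelevant.) -/
structure IsLocalForm (ν : Measure Ω) (d : Set (Lp ℝ 2 ν))
    (γ : Lp ℝ 2 ν → Lp ℝ 2 ν → Lp ℝ 1 ν) : Prop where
  zero_mem : (0 : Lp ℝ 2 ν) ∈ d
  add_mem : ∀ f ∈ d, ∀ g ∈ d, f + g ∈ d
  smul_mem : ∀ (c : ℝ), ∀ f ∈ d, c • f ∈ d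
  cdc_symm : ∀ f ∈ d, ∀ g ∈ d, γ f g = γ g f
  cdc_add : ∀ f ∈ d, ∀ g ∈ d, ∀ h ∈ d, γ (f + g) h = γ f h + γ g h
  cdc_smul : ∀ (c : ℝ), ∀ f ∈ d, ∀ g ∈ d, γ (c • f) g = c • γ f g
  cdc_nonneg : ∀ f ∈ d, 0 ≤ γ f f
  /-- The form is closed. -/
  closed : ∀ s : ℕ → Lp ℝ 2 ν, (∀ n, s n ∈ d) → CauchySeq s →
    (∀ ε > 0, ∃ n₀, ∀ p ≥ n₀, ∀ q ≥ n₀, energy γ (s p - s q) (s p - s q) < ε) →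
    ∃ f ∈ d, Tendsto s atTop (𝓝 f) ∧
      Tendsto (fun n => energy γ (s n - f) (s n - f)) atTop (𝓝 0)
  /-- Normal contractions operate. -/
  contraction : ∀ (φ : ℝ → ℝ) (hφ : LipschitzWith 1 φ) (h0 : φ 0 = 0), ∀ f ∈ d,
    hφ.compLp h0 f ∈ d ∧ energy γ (hφ.compLp h0 f) (hφ.compLp h0 f) ≤ energy γ f f
  /-- `γ` is the carré du champ operator of the form:
  `e(fh, g) + e(gh, f) - e(h, fg) = ∫ h γ[f, g] dν` for bounded `f, g, h` in the domain. -/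
  carre_du_champ : ∀ f ∈ d, ∀ g ∈ d, ∀ h ∈ d, EssBounded f → EssBounded g → EssBounded h →
    ∀ fh ∈ d, ∀ gh ∈ d, ∀ fg ∈ d, (fh =ᵐ[ν] fun ϖ => f ϖ * h ϖ) →
      (gh =ᵐ[ν] fun ϖ => g ϖ * h ϖ) → (fg =ᵐ[ν] fun ϖ => f ϖ * g ϖ) →
      energy γ fh g + energy γ gh f - energy γ h fg = ∫ ϖ, h ϖ * γ f g ϖ ∂ν
  /-- The form is local. -/
  local_form : ∀ f ∈ d, ∀ φ ψ : ℝ → ℝ, ContDiff ℝ ∞ φ → ContDiff ℝ ∞ ψ →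
    HasCompactSupport φ → HasCompactSupport ψ → Disjoint (tsupport φ) (tsupport ψ) →
    ∀ a ∈ d, ∀ b ∈ d, (a =ᵐ[ν] fun ϖ => φ (f ϖ) - φ 0) → (b =ᵐ[ν] fun ϖ => ψ (f ϖ) - ψ 0) →
      energy γ a b = 0

/-- `(Ω, ν, d, γ)` is a local Dirichlet structure with carré du champ. -/
structure IsLocalDirichletStructure (ν : Measure Ω) (d : Set (Lp ℝ 2 ν))
    (γ : Lp ℝ 2 ν → Lp ℝ 2 ν → Lp ℝ 1 ν) : Prop extends IsLocalForm ν d γ where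
  dense : Dense d

/-- The energy image density property (EID). -/
def EID (ν : Measure Ω) (d : Set (Lp ℝ 2 ν)) (γ : Lp ℝ 2 ν → Lp ℝ 2 ν → Lp ℝ 1 ν) : Prop :=
  ∀ (k : ℕ) (U : Fin k → Lp ℝ 2 ν), (∀ i, U i ∈ d) →
    (ν.withDensity fun ϖ =>
      ENNReal.ofReal (Matrix.det (Matrix.of fun i j => γ (U i) (U j) ϖ))).map
        (fun ϖ i => U i ϖ) ≪ (volume : Measure (Fin k → ℝ))

/-- At the level of functions: the classes of `f` and `g` belong to `d`, and `h` is a version of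
`γ[f, g]`. -/
def HasCdc (d : Set (Lp ℝ 2 ν)) (γ : Lp ℝ 2 ν → Lp ℝ 2 ν → Lp ℝ 1 ν) (f g h : Ω → ℝ) : Prop :=
  ∃ a ∈ d, ∃ b ∈ d, a =ᵐ[ν] f ∧ b =ᵐ[ν] g ∧ γ a b =ᵐ[ν] h

end Dirichlet

/-! ### Products of copies of `(Y, μ, d, γ)` -/

section Product

variable {Y : Type*} [MeasurableSpace Y] (μ : Measure Y) [IsProbabilityMeasure μ]

/-- The law of independent marks indexed by `ι`, each of law `μ`; for `ι = Fin n` this is the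
finite product `μⁿ`. -/
abbrev marksLaw (ι : Type*) : Measure (ι → Y) := Measure.infinitePi fun _ : ι => μ

variable (d : Set (Lp ℝ 2 μ)) (γ : Lp ℝ 2 μ → Lp ℝ 2 μ → Lp ℝ 1 μ)

open Classical in
/-- For almost every value of the other coordinates, `F` and `G` are in `d` as functions of the
`i`-th coordinate; and `h` is the (jointly measurable) result `γᵢ[F, G]` of letting `γ` act on
this coordinate. -/
def IsPartialCdc {ι : Type*} (i : ι) (F G h : (ι → Y) → ℝ) : Prop :=
  AEStronglyMeasurable h (marksLaw μ ι) ∧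
    ∀ᵐ u ∂(marksLaw μ ι), HasCdc d γ (fun v => F (Function.update u i v))
      (fun v => G (Function.update u i v)) (fun v => h (Function.update u i v))

/-- `H = ∑ᵢ γᵢ[F, G]` almost everywhere. -/
def IsSumCdc {ι : Type*} (F G H : (ι → Y) → ℝ) : Prop :=
  ∃ h : ι → (ι → Y) → ℝ, (∀ i, IsPartialCdc μ d γ i F G (h i)) ∧
    ∀ᵐ u ∂(marksLaw μ ι), HasSum (fun i => h i u) (H u)

/-- `H` is the value at `(F, G)` of the carré du champ of the product structure. -/
def IsProdCdc (ι : Type*) (F G H : (ι → Y) → ℝ) : Prop :=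
  Integrable H (marksLaw μ ι) ∧ IsSumCdc μ d γ F G H

/-- Domain of the product structure. -/
def prodDom (ι : Type*) : Set (Lp ℝ 2 (marksLaw μ ι)) :=
  {F | ∃ H : (ι → Y) → ℝ, IsProdCdc μ d γ ι F F H}

open Classical in
/-- Carré du champ operator of the product structure. -/
def prodCdc (ι : Type*) (F G : Lp ℝ 2 (marksLaw μ ι)) : Lp ℝ 1 (marksLaw μ ι) :=
  if h : ∃ H : (ι → Y) → ℝ, IsProdCdc μ d γ ι F G H then h.choose_spec.1.toL1 h.choose else 0

end Product

/-! ### Configurations -/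

/-- The configuration space: countable subsets, i.e. countable sums of distinct Dirac masses. -/
def Config (X : Type*) : Type _ := {s : Set X // s.Countable}

namespace Config

/-- The σ-field generated by the counting maps `ϖ ↦ card (ϖ ∩ A)`, `A` measurable. -/
instance instMeasurableSpace {X : Type*} [MeasurableSpace X] : MeasurableSpace (Config X) :=
  ⨆ (A : Set X) (_ : MeasurableSet A),
    MeasurableSpace.comap (fun ϖ : Config X => (ϖ.1 ∩ A).encard) ⊤

/-- `ϖ ∪ {z}`. -/
def add {X : Type*} (ϖ : Config X) (z : X) : Config X := ⟨insert z ϖ.1, ϖ.2.insert z⟩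

/-- `ϖ ∩ {z}ᶜ`. -/
def remove {X : Type*} (ϖ : Config X) (z : X) : Config X :=
  ⟨ϖ.1 \ {z}, ϖ.2.mono Set.sdiff_subset⟩

/-- The point measure `∑_{z ∈ ϖ} δ_z`. -/
def toMeasure {X : Type*} [MeasurableSpace X] (ϖ : Config X) : Measure X :=
  Measure.sum fun z : ϖ.1 => Measure.dirac z.1

/-- The configuration `{(x, u x) : x ∈ m}` on `X × Y`. -/
def mark {X Y : Type*} (m : Config X) (u : m.1 → Y) : Config (X × Y) :=
  ⟨Set.range fun x : m.1 => (x.1, u x), haveI := m.2.to_subtype; Set.countable_range _⟩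

end Config

/-- `(ε⁺F)(ϖ, z) = F(ϖ ∪ {z})`. -/
def epsPlus {Z : Type*} (F : Config Z → ℝ) : Config Z → Z → ℝ := fun ϖ z => F (ϖ.add z)

/-- `(ε⁻K)(ϖ, z) = K(ϖ ∩ {z}ᶜ, z)`. -/
def epsMinus {Z : Type*} (K : Config Z → Z → ℝ) : Config Z → Z → ℝ := fun ϖ z => K (ϖ.remove z) z

/-! ### The upper Dirichlet structure -/

section Upper

variable {X Y : Type*} [MeasurableSpace X] [MeasurableSpace Y]
  (Q : Measure (Config X)) (μ : Measure Y) [IsProbabilityMeasure μ]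

/-- The law `P` of the random measure of law `Q` marked by `μ`: given the configuration `m`, the
marks of its points are independent with law `μ`. -/
def markedLaw : Measure (Config (X × Y)) :=
  Q.bind fun m => (marksLaw μ m.1).map m.mark

variable (d : Set (Lp ℝ 2 μ)) (γ : Lp ℝ 2 μ → Lp ℝ 2 μ → Lp ℝ 1 μ)

/-- `H` is `P`-integrable and, for `Q`-almost every `m`, equal to the sum over the points of `m` of
the results of letting `γ` act on the corresponding mark in `F`, `G`. -/
def IsUpperCdc (F G H : Config (X × Y) → ℝ) : Prop :=
  Integrable H (markedLaw Q μ) ∧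
    ∀ᵐ m ∂Q, IsSumCdc μ d γ (fun u => F (m.mark u)) (fun u => G (m.mark u))
      (fun u => H (m.mark u))

/-- Domain `𝔻` of the upper structure. -/
def upperDom : Set (Lp ℝ 2 (markedLaw Q μ)) :=
  {F | ∃ H : Config (X × Y) → ℝ, IsUpperCdc Q μ d γ F F H}

open Classical in
/-- Carré du champ operator `Γ` of the upper structure. -/
def upperCdc (F G : Lp ℝ 2 (markedLaw Q μ)) : Lp ℝ 1 (markedLaw Q μ) :=
  if h : ∃ H : Config (X × Y) → ℝ, IsUpperCdc Q μ d γ F G H then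
    h.choose_spec.1.toL1 h.choose else 0

/-- `K` is a version of `γ[ε⁺F]`, where `γ` acts on the mark `v` of the added point `(x, v)`.
It is determined at the pairs `(ϖ ∩ {z}ᶜ, z)` with `z = (x, v)` a point of `ϖ`, up to negligible
sets of marks. -/
def IsCdcEpsPlus (F : Config (X × Y) → ℝ) (K : Config (X × Y) → X × Y → ℝ) : Prop :=
  ∀ᵐ m ∂Q, ∀ x : m.1,
    AEStronglyMeasurable (fun u => epsMinus K (m.mark u) (x.1, u x)) (marksLaw μ m.1) ∧
    ∀ᵐ u ∂(marksLaw μ m.1), HasCdc d γ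
      (fun v => epsPlus F ((m.mark u).remove (x.1, u x)) (x.1, v))
      (fun v => epsPlus F ((m.mark u).remove (x.1, u x)) (x.1, v))
      (fun v => K ((m.mark u).remove (x.1, u x)) (x.1, v))

/-- The lent particle formula `Γ[F] = ∫ ε⁻γ[ε⁺F] dN` at the configuration `ϖ`, where `G` stands
for `Γ[F]` and `K` for `γ[ε⁺F]`; the integral exists. -/
def LentParticleAt (G : Config (X × Y) → ℝ) (K : Config (X × Y) → X × Y → ℝ)
    (ϖ : Config (X × Y)) : Prop :=
  Integrable (epsMinus K ϖ) ϖ.toMeasure ∧ G ϖ = ∫ z, epsMinus K ϖ z ∂ϖ.toMeasure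

end Upper

end

set_option linter.unusedSectionVars false

noncomputable section

/-! ### Resampling marks -/

section Marks

variable {Y : Type*} [MeasurableSpace Y] {μ : Measure Y} [IsProbabilityMeasure μ]

/-! Given the configuration m, the marks live on a product space and every object in the theorem is
computed one mark at a time. Each assertion is therefore a statement about `(Y, μ, d, γ)` in the
fibre over one mark, integrated over the other marks, summed over the countably many points of m and
integrated over m. This rests on two facts. The law of the marks is unchanged when some marks are
replaced by independent copies (`measurePreserving_update`, `measurePreserving_extend`). The marked
law is a measurable mixture over m (`measurable_condLaw`), so an almost sure statement may be
checked for almost every m and almost all marks (`ae_markedLaw_of_ae_ae`), provided that the set in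
question is measurable.

Measurability of Γ[F] in the configuration is the real difficulty: Q is arbitrary, so no family of
sets with finitely many points exhausts the space, and the point measures need not form an s-finite
kernel. Three devices settle it. (1) The domain `d` with the graph norm is a Hilbert space on which
γ is continuous, and there are bounded operators from L² to `d` that converge to the identity on
`d`. Hence γ applied to a function depending measurably on a parameter has a jointly measurable
version (`IsLocalForm.exists_measurable_cdc`). (2) A measurable F depends on countably many
countings only, so ε⁺F(ϖ, (x, v)) is a measurable function of the countings of ϖ, of x and of v
(`Config.exists_eq_comp_countMap`). (3) Points lying in a suitable set with finitely many points are
summed with finite kernels. For any other point x, Borel–Cantelli shows that each counting to which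
the mark of x contributes with positive probability is already infinite. Then F does not depend on
that mark, and by locality its carré du champ vanishes (`IsLocalForm.exists_cdc_version`).

The rest follows fibre by fibre. For closedness, a fast subsequence is Cauchy for the graph norm in
almost every fibre (`upperDom_of_fast`). Locality and the carré du champ identity say that a sum
over the points has integral zero, and each term has mean zero in its own mark. Removing a point and
putting it back with mark v amounts to changing its mark, so ε⁻γ[ε⁺F] at a point is γ acting on its
mark, which is the lent particle formula. For (EID), all marks outside a finite set of points are
frozen, the finite product is applied, and the determinants pass to the limit
(`IsLocalForm.eid_upper`). For density, Laplace functionals generate the σ-field, and they are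
limits of functionals involving finitely many points, whose factors can be taken in `d`
(`upper_dense`). -/

theorem marksLaw_pi {ι : Type*} (s : Finset ι) {t : ι → Set Y} (ht : ∀ i ∈ s, MeasurableSet (t i)) :
    marksLaw μ ι ((s : Set ι).pi t) = ∏ i ∈ s, μ (t i) :=
  Measure.infinitePi_pi _ ht

theorem measurable_extend_marks {κ ι : Type*} {e : κ → ι} (he : Function.Injective e) :
    Measurable fun p : (ι → Y) × (κ → Y) => Function.extend e p.2 p.1 := by
  refine measurable_pi_iff.2 fun i => ?_
  by_cases hi : ∃ k, e k = i
  · obtain ⟨k, rfl⟩ := hi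
    simp only [he.extend_apply]
    fun_prop
  · simp only [Function.extend_apply' _ _ _ hi]
    fun_prop

/-- The preimage of a cylinder is the product of a cylinder over the coordinates outside the range
of `e` and a cylinder over `κ`; their masses multiply to that of the original one. This is what
allows the marks outside a chosen family to be frozen. -/
theorem measurePreserving_extend {κ ι : Type*} {e : κ → ι} (he : Function.Injective e) :
    MeasurePreserving (fun p : (ι → Y) × (κ → Y) => Function.extend e p.2 p.1)
      ((marksLaw μ ι).prod (marksLaw μ κ)) (marksLaw μ ι) := by
  classical
  refine ⟨measurable_extend_marks he, Measure.eq_infinitePi _ fun s t ht => ?_⟩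
  rw [Measure.map_apply (measurable_extend_marks he)
    (MeasurableSet.pi s.countable_toSet fun i _ => ht i)]
  have : (fun p : (ι → Y) × (κ → Y) => Function.extend e p.2 p.1) ⁻¹' ((s : Set ι).pi t) =
      (((s.filter fun i => i ∉ Set.range e : Finset ι) : Set ι).pi t) ×ˢ
        (((s.preimage e he.injOn : Finset κ) : Set κ).pi fun k => t (e k)) := by
    ext ⟨u, w⟩
    simp only [Set.mem_preimage, Set.mem_pi, Set.mem_prod, Finset.coe_filter, Finset.mem_coe,
      Finset.coe_preimage, Set.mem_ofPred_eq]
    constructor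
    · intro h
      refine ⟨fun i hi => ?_, fun k hk => ?_⟩
      · have := h i hi.1
        rwa [Function.extend_apply' _ _ _ hi.2] at this
      · have := h (e k) hk
        rwa [he.extend_apply] at this
    · rintro ⟨h1, h2⟩ i hi
      by_cases hr : i ∈ Set.range e
      · obtain ⟨k, rfl⟩ := hr
        rw [he.extend_apply]
        exact h2 k hi
      · rw [Function.extend_apply' _ _ _ hr]
        exact h1 i ⟨hi, hr⟩
  rw [this, Measure.prod_prod, marksLaw_pi _ fun i _ => ht i, marksLaw_pi _ fun i _ => ht _,
    Finset.prod_preimage' e s he.injOn fun i => μ (t i), mul_comm]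
  exact Finset.prod_filter_mul_prod_filter_not s _ _

theorem measurable_update_marks {ι : Type*} [DecidableEq ι] (i : ι) :
    Measurable fun p : (ι → Y) × Y => Function.update p.1 i p.2 := by
  refine measurable_pi_iff.2 fun j => ?_
  by_cases hj : j = i
  · subst hj
    simp only [Function.update_self]
    fun_prop
  · simp only [Function.update_of_ne hj]
    fun_prop

theorem measurePreserving_update {ι : Type*} [DecidableEq ι] (i : ι) :
    MeasurePreserving (fun p : (ι → Y) × Y => Function.update p.1 i p.2)
      ((marksLaw μ ι).prod μ) (marksLaw μ ι) := by
  refine ⟨measurable_update_marks i, Measure.eq_infinitePi _ fun s t ht => ?_⟩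
  rw [Measure.map_apply (measurable_update_marks i)
    (MeasurableSet.pi s.countable_toSet fun i _ => ht i)]
  have : (fun p : (ι → Y) × Y => Function.update p.1 i p.2) ⁻¹' ((s : Set ι).pi t) =
      (((s.erase i : Finset ι) : Set ι).pi t) ×ˢ (if i ∈ s then t i else Set.univ) := by
    ext ⟨u, v⟩
    simp only [Set.mem_preimage, Set.mem_pi, Set.mem_prod, Finset.mem_coe, Finset.mem_erase]
    constructor
    · intro h
      refine ⟨fun j hj => ?_, ?_⟩
      · have := h j hj.2
        rwa [Function.update_of_ne hj.1] at this
      · split_ifs with hi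
        · have := h i hi
          rwa [Function.update_self] at this
        · trivial
    · rintro ⟨h1, h2⟩ j hj
      by_cases hji : j = i
      · subst hji
        rw [Function.update_self]
        rwa [if_pos hj] at h2
      · rw [Function.update_of_ne hji]
        exact h1 j ⟨hji, hj⟩
  rw [this, Measure.prod_prod, marksLaw_pi _ fun i _ => ht i]
  split_ifs with hi
  · rw [mul_comm]
    exact Finset.mul_prod_erase s (fun i => μ (t i)) hi
  · rw [measure_univ, mul_one, Finset.erase_eq_of_notMem hi]

theorem ae_ae_update {ι : Type*} [DecidableEq ι] (i : ι) {p : (ι → Y) → Prop}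
    (h : ∀ᵐ u ∂marksLaw μ ι, p u) :
    ∀ᵐ u ∂marksLaw μ ι, ∀ᵐ v ∂μ, p (Function.update u i v) :=
  Measure.ae_ae_of_ae_prod ((measurePreserving_update i).quasiMeasurePreserving.ae h)

theorem ae_ae_extend {κ ι : Type*} {e : κ → ι} (he : Function.Injective e) {p : (ι → Y) → Prop}
    (h : ∀ᵐ u ∂marksLaw μ ι, p u) :
    ∀ᵐ u ∂marksLaw μ ι, ∀ᵐ w ∂marksLaw μ κ, p (Function.extend e w u) :=
  Measure.ae_ae_of_ae_prod ((measurePreserving_extend he).quasiMeasurePreserving.ae h)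

/-- Converse direction of Fubini. Null-measurability of `s` is needed: almost sure slices alone do
not make a set of full product measure. -/
theorem MeasureTheory.MeasurePreserving.ae_of_ae_ae {α β γ : Type*} [MeasurableSpace α]
    [MeasurableSpace β] [MeasurableSpace γ] {a : Measure α} {b : Measure β} [SFinite b]
    {c : Measure γ} {f : α × β → γ} (hf : MeasurePreserving f (a.prod b) c) {s : Set γ}
    (hs : NullMeasurableSet s c) (h : ∀ᵐ x ∂a, ∀ᵐ y ∂b, f (x, y) ∈ s) : ∀ᵐ z ∂c, z ∈ s := by
  obtain ⟨t, ht, hst⟩ := hs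
  have h1 : ∀ᵐ z ∂c, z ∈ s ↔ z ∈ t := hst.mem_iff
  have h2 := Measure.ae_ae_of_ae_prod (hf.quasiMeasurePreserving.ae h1)
  have h3 : ∀ᵐ x ∂a, ∀ᵐ y ∂b, f (x, y) ∈ t := by
    filter_upwards [h, h2] with x hx hx'
    filter_upwards [hx, hx'] with y hy hy'
    exact hy'.1 hy
  have h4 : ∀ᵐ p ∂a.prod b, f p ∈ t :=
    (Measure.ae_prod_iff_ae_ae (hf.measurable ht)).2 h3
  have h5 : ∀ᵐ z ∂c, z ∈ t := by
    rw [← hf.map_eq]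
    exact (ae_map_iff hf.measurable.aemeasurable ht).2 h4
  filter_upwards [h1, h5] with z hz hz' using hz.2 hz'

theorem ae_of_ae_update {ι : Type*} [DecidableEq ι] (i : ι) {s : Set (ι → Y)}
    (hs : NullMeasurableSet s (marksLaw μ ι))
    (h : ∀ᵐ u ∂marksLaw μ ι, ∀ᵐ v ∂μ, Function.update u i v ∈ s) :
    ∀ᵐ u ∂marksLaw μ ι, u ∈ s :=
  (measurePreserving_update i).ae_of_ae_ae hs h

theorem ae_of_ae_extend {κ ι : Type*} {e : κ → ι} (he : Function.Injective e) {s : Set (ι → Y)}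
    (hs : NullMeasurableSet s (marksLaw μ ι))
    (h : ∀ᵐ u ∂marksLaw μ ι, ∀ᵐ w ∂marksLaw μ κ, Function.extend e w u ∈ s) :
    ∀ᵐ u ∂marksLaw μ ι, u ∈ s :=
  (measurePreserving_extend he).ae_of_ae_ae hs h

theorem lintegral_update {ι : Type*} [DecidableEq ι] (i : ι) {f : (ι → Y) → ℝ≥0∞}
    (hf : AEMeasurable f (marksLaw μ ι)) :
    ∫⁻ u, ∫⁻ v, f (Function.update u i v) ∂μ ∂marksLaw μ ι = ∫⁻ u, f u ∂marksLaw μ ι := by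
  have h := measurePreserving_update (μ := μ) i
  rw [← h.map_eq] at hf
  conv_rhs => rw [← h.map_eq, lintegral_map' hf h.measurable.aemeasurable]
  exact (lintegral_prod _ (hf.comp_measurable h.measurable)).symm

theorem integrable_update {ι : Type*} [DecidableEq ι] (i : ι) {f : (ι → Y) → ℝ}
    (hf : Integrable f (marksLaw μ ι)) :
    Integrable (fun p : (ι → Y) × Y => f (Function.update p.1 i p.2)) ((marksLaw μ ι).prod μ) :=
  (measurePreserving_update i).integrable_comp_of_integrable hf

theorem integral_update {ι : Type*} [DecidableEq ι] (i : ι) {f : (ι → Y) → ℝ}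
    (hf : Integrable f (marksLaw μ ι)) :
    ∫ u, ∫ v, f (Function.update u i v) ∂μ ∂marksLaw μ ι = ∫ u, f u ∂marksLaw μ ι := by
  have h := measurePreserving_update (μ := μ) i
  rw [← integral_prod _ (integrable_update i hf)]
  conv_rhs => rw [← h.map_eq]
  rw [integral_map h.measurable.aemeasurable]
  rw [h.map_eq]
  exact hf.1

/-- Independence of the marks in multiplicative form. -/
theorem lintegral_prod_marks {ι : Type*} (s : Finset ι) {f : ι → Y → ℝ≥0∞}
    (hf : ∀ i, Measurable (f i)) :
    ∫⁻ u, ∏ i ∈ s, f i (u i) ∂marksLaw μ ι = ∏ i ∈ s, ∫⁻ v, f i v ∂μ := by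
  classical
  have h := (ProbabilityTheory.iIndepFun_infinitePi (P := fun _ : ι => μ)
    (X := fun i v => f i v) hf)
  have h3 := ProbabilityTheory.lintegral_prod_eq_prod_lintegral_of_indepFun
    s _ h (fun i => (hf i).comp (measurable_pi_apply i))
  rw [h3]
  refine Finset.prod_congr rfl fun i _ => ?_
  exact (measurePreserving_eval_infinitePi (fun _ : ι => μ) i).lintegral_comp (hf i)

end Marks

/-! ### Hilbert space approximation -/

section Hilbert

variable {H K : Type*} [NormedAddCommGroup H] [InnerProductSpace ℝ H]
  [NormedAddCommGroup K] [InnerProductSpace ℝ K]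

/-- The Cesàro means `n⁻¹ ∑_{k<n} ∑_{j<k} T^j`, approximate inverses of `1 - T`. -/
def cesaroInverse (T : H →L[ℝ] H) (n : ℕ) : H →L[ℝ] H :=
  (n : ℝ)⁻¹ • ∑ k ∈ Finset.range n, ∑ j ∈ Finset.range k, T ^ j

/-- Each inner geometric sum times `1 - T` telescopes to `1 - T ^ k`; averaging over `k` leaves the
Birkhoff average. -/
theorem cesaroInverse_mul (T : H →L[ℝ] H) {n : ℕ} (hn : n ≠ 0) (x : H) :
    cesaroInverse T n (x - T x) = x - birkhoffAverage ℝ T _root_.id n x := by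
  have h1 : cesaroInverse T n * (1 - T) = 1 - (n : ℝ)⁻¹ • ∑ k ∈ Finset.range n, T ^ k := by
    rw [cesaroInverse, smul_mul_assoc, Finset.sum_mul]
    simp_rw [geom_sum_mul_neg]
    rw [Finset.sum_sub_distrib, smul_sub]
    congr 1
    rw [Finset.sum_const, Finset.card_range, ← Nat.cast_smul_eq_nsmul ℝ, smul_smul,
      inv_mul_cancel₀ (by exact_mod_cast hn), one_smul]
  have h2 : (cesaroInverse T n * (1 - T)) x = _ := congrArg (fun S : H →L[ℝ] H => S x) h1
  have h3 : (cesaroInverse T n * (1 - T)) x = cesaroInverse T n (x - T x) := rfl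
  rw [← h3, h2, birkhoffAverage, birkhoffSum]
  simp

variable [CompleteSpace H] [CompleteSpace K]

/-- With `S = A* A`, the operator `1 - S` is a contraction, so by von Neumann's mean ergodic theorem
its Birkhoff averages converge to the projection onto its fixed vectors. These form the kernel of
`S`, which is that of `A`, hence zero. -/
theorem tendsto_cesaroInverse (A : H →L[ℝ] K) (hA : ‖A‖ ≤ 1) (hinj : Function.Injective A)
    (x : H) :
    Tendsto (fun n => cesaroInverse (1 - (ContinuousLinearMap.adjoint A).comp A) n
      (ContinuousLinearMap.adjoint A (A x))) atTop (𝓝 x) := by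
  set S : H →L[ℝ] H := (ContinuousLinearMap.adjoint A).comp A with hS
  have hS' : ∀ y, S y = ContinuousLinearMap.adjoint A (A y) := fun y => rfl
  have hinner : ∀ y, inner ℝ y (S y) = ‖A y‖ ^ 2 := fun y => by
    rw [hS', ContinuousLinearMap.adjoint_inner_right, real_inner_self_eq_norm_sq]
  have hnorm : ∀ y, ‖S y‖ ≤ ‖A y‖ := fun y => by
    have := (ContinuousLinearMap.adjoint A).le_opNorm (A y)
    rw [LinearIsometryEquiv.norm_map] at this
    exact this.trans (mul_le_of_le_one_left (norm_nonneg _) hA)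
  have hB : ‖(1 - S : H →L[ℝ] H)‖ ≤ 1 := by
    refine ContinuousLinearMap.opNorm_le_bound _ zero_le_one fun y => ?_
    rw [one_mul]
    refine abs_le_of_sq_le_sq' ?_ (norm_nonneg _) |>.2
    rw [sub_apply, one_apply_eq_self, norm_sub_sq_real, hinner]
    have := pow_le_pow_left₀ (norm_nonneg _) (hnorm y) 2
    -- Here ‖y - S y‖² = ‖y‖² - 2‖A y‖² + ‖S y‖², and ‖S y‖ ≤ ‖A y‖.
    nlinarith [sq_nonneg ‖A y‖]
  have h0 := ContinuousLinearMap.tendsto_birkhoffAverage_orthogonalProjection (1 - S) hB x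
  have hfix : ∀ y : (1 - S : H →L[ℝ] H).eqLocus (1 : H →L[ℝ] H), (y : H) = 0 := by
    rintro ⟨y, hm⟩
    have hy : S y = 0 := by
      have : (1 - S : H →L[ℝ] H) y = (1 : H →L[ℝ] H) y := hm
      simpa using this
    have : A y = 0 := by
      have := hinner y
      rw [hy, inner_zero_right] at this
      exact norm_eq_zero.1 (pow_eq_zero_iff two_ne_zero |>.1 this.symm)
    exact hinj (by simpa using this)
  rw [hfix] at h0
  have h1 : Tendsto (fun n => x - birkhoffAverage ℝ (1 - S : H →L[ℝ] H) _root_.id n x) atTop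
      (𝓝 (x - 0)) := tendsto_const_nhds.sub h0
  rw [sub_zero] at h1
  refine h1.congr' ?_
  filter_upwards [eventually_ne_atTop 0] with n hn
  rw [← cesaroInverse_mul _ hn]
  simp [hS']

/-- A contractive embedding of Hilbert spaces has approximate left inverses. -/
theorem exists_approx_leftInverse (A : H →L[ℝ] K) (hA : ‖A‖ ≤ 1) (hinj : Function.Injective A) :
    ∃ R : ℕ → K →L[ℝ] H, (∀ x, Tendsto (fun n => R n (A x)) atTop (𝓝 x)) ∧
      (DenseRange A → ∀ y, Tendsto (fun n => A (R n y)) atTop (𝓝 y)) := by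
  refine ⟨fun n => (cesaroInverse (1 - (ContinuousLinearMap.adjoint A).comp A) n).comp
    (ContinuousLinearMap.adjoint A), fun x => tendsto_cesaroInverse A hA hinj x, ?_⟩
  intro hdense y
  have hinj' : Function.Injective (ContinuousLinearMap.adjoint A) := by
    refine (injective_iff_map_eq_zero _).2 fun z hz => ?_
    have hcl : ∀ w : K, inner ℝ w z = 0 := by
      intro w
      refine hdense.induction_on (p := fun w => inner ℝ w z = 0) w ?_ ?_
      · exact isClosed_eq (by fun_prop) continuous_const
      · intro x
        rw [← ContinuousLinearMap.adjoint_inner_right, hz, inner_zero_right]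
    exact inner_self_eq_zero.1 (hcl z)
  have h := tendsto_cesaroInverse (ContinuousLinearMap.adjoint A)
    (by rwa [LinearIsometryEquiv.norm_map]) hinj' y
  rw [ContinuousLinearMap.adjoint_adjoint] at h
  refine h.congr fun n => ?_
  -- `A` intertwines `A* A` and `A A*`, so the claim is the previous convergence for the adjoint,
  -- which is injective because `A` has dense range.
  have hpow : ∀ (j : ℕ) (x : H), A (((1 - (ContinuousLinearMap.adjoint A).comp A) ^ j) x) =
      ((1 - A.comp (ContinuousLinearMap.adjoint A)) ^ j) (A x) := by
    intro j
    induction j with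
    | zero => intro x; simp
    | succ j ih =>
      intro x
      rw [pow_succ, pow_succ]
      refine (ih _).trans (congrArg _ ?_)
      simp
  simp only [ContinuousLinearMap.comp_apply, cesaroInverse, smul_apply,
    sum_apply, map_smul, map_sum, hpow]

end Hilbert

/-! ### The Hilbert space attached to a closed form -/

section FormSpace

variable {Ω : Type*} [MeasurableSpace Ω] {ν : Measure Ω} {d : Set (Lp ℝ 2 ν)}
  {γ : Lp ℝ 2 ν → Lp ℝ 2 ν → Lp ℝ 1 ν}

namespace IsLocalForm

theorem neg_mem (hd : IsLocalForm ν d γ) {f : Lp ℝ 2 ν} (hf : f ∈ d) : -f ∈ d := by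
  simpa using hd.smul_mem (-1) f hf

theorem sub_mem (hd : IsLocalForm ν d γ) {f g : Lp ℝ 2 ν} (hf : f ∈ d) (hg : g ∈ d) :
    f - g ∈ d := by
  rw [sub_eq_add_neg]
  exact hd.add_mem _ hf _ (hd.neg_mem hg)

theorem cdc_neg (hd : IsLocalForm ν d γ) {f g : Lp ℝ 2 ν} (hf : f ∈ d) (hg : g ∈ d) :
    γ (-f) g = -γ f g := by
  simpa using hd.cdc_smul (-1) f hf g hg

theorem cdc_sub (hd : IsLocalForm ν d γ) {f g h : Lp ℝ 2 ν} (hf : f ∈ d) (hg : g ∈ d)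
    (hh : h ∈ d) : γ (f - g) h = γ f h - γ g h := by
  rw [sub_eq_add_neg, hd.cdc_add f hf _ (hd.neg_mem hg) h hh, hd.cdc_neg hg hh, sub_eq_add_neg]

theorem cdc_add_right (hd : IsLocalForm ν d γ) {f g h : Lp ℝ 2 ν} (hf : f ∈ d) (hg : g ∈ d)
    (hh : h ∈ d) : γ h (f + g) = γ h f + γ h g := by
  rw [hd.cdc_symm h hh _ (hd.add_mem f hf g hg), hd.cdc_add f hf g hg h hh,
    hd.cdc_symm f hf h hh, hd.cdc_symm g hg h hh]

theorem cdc_sub_right (hd : IsLocalForm ν d γ) {f g h : Lp ℝ 2 ν} (hf : f ∈ d) (hg : g ∈ d)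
    (hh : h ∈ d) : γ h (f - g) = γ h f - γ h g := by
  rw [hd.cdc_symm h hh _ (hd.sub_mem hf hg), hd.cdc_sub hf hg hh,
    hd.cdc_symm f hf h hh, hd.cdc_symm g hg h hh]

theorem cdc_smul_right (hd : IsLocalForm ν d γ) (c : ℝ) {f g : Lp ℝ 2 ν} (hf : f ∈ d)
    (hg : g ∈ d) : γ f (c • g) = c • γ f g := by
  rw [hd.cdc_symm f hf _ (hd.smul_mem c g hg), hd.cdc_smul c g hg f hf, hd.cdc_symm f hf g hg]

theorem cdc_zero_left (hd : IsLocalForm ν d γ) {f : Lp ℝ 2 ν} (hf : f ∈ d) : γ 0 f = 0 := by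
  simpa using hd.cdc_smul 0 0 hd.zero_mem f hf

theorem energy_eq (hd : IsLocalForm ν d γ) {f : Lp ℝ 2 ν} (hf : f ∈ d) :
    energy γ f f = (1 / 2) * ‖γ f f‖ := by
  rw [energy, L1.norm_eq_integral_norm]
  congr 1
  refine integral_congr_ae ?_
  filter_upwards [(Lp.coeFn_nonneg _).2 (hd.cdc_nonneg f hf)] with ϖ h
  exact (Real.norm_of_nonneg h).symm

theorem energy_nonneg (hd : IsLocalForm ν d γ) {f : Lp ℝ 2 ν} (hf : f ∈ d) :
    0 ≤ energy γ f f := by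
  rw [hd.energy_eq hf]
  positivity

theorem energy_symm (hd : IsLocalForm ν d γ) {f g : Lp ℝ 2 ν} (hf : f ∈ d) (hg : g ∈ d) :
    energy γ f g = energy γ g f := by
  rw [energy, hd.cdc_symm f hf g hg, energy]

theorem energy_add (hd : IsLocalForm ν d γ) {f g h : Lp ℝ 2 ν} (hf : f ∈ d) (hg : g ∈ d)
    (hh : h ∈ d) : energy γ (f + g) h = energy γ f h + energy γ g h := by
  rw [energy, hd.cdc_add f hf g hg h hh, energy, energy, ← mul_add,
    ← integral_add (L1.integrable_coeFn _) (L1.integrable_coeFn _)]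
  congr 1
  exact integral_congr_ae (Lp.coeFn_add _ _)

theorem energy_smul (hd : IsLocalForm ν d γ) (c : ℝ) {f g : Lp ℝ 2 ν} (hf : f ∈ d) (hg : g ∈ d) :
    energy γ (c • f) g = c * energy γ f g := by
  rw [energy, hd.cdc_smul c f hf g hg, energy, mul_left_comm, ← integral_const_mul c]
  congr 1
  exact integral_congr_ae (Lp.coeFn_smul c (γ f g))

/-- The Cauchy–Schwarz inequality for the carré du champ, in additive form. -/
theorem abs_cdc_le (hd : IsLocalForm ν d γ) {f g : Lp ℝ 2 ν} (hf : f ∈ d) (hg : g ∈ d) :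
    ∀ᵐ ϖ ∂ν, 2 * |γ f g ϖ| ≤ γ f f ϖ + γ g g ϖ := by
  have hs := hd.sub_mem hf hg
  have ha := hd.add_mem f hf g hg
  have e1 : γ (f + g) (f + g) = γ f f + γ g g + (γ f g + γ f g) := by
    rw [hd.cdc_add f hf g hg _ ha, hd.cdc_add_right hf hg hf, hd.cdc_add_right hf hg hg,
      hd.cdc_symm g hg f hf]
    abel
  have e2 : γ (f - g) (f - g) = γ f f + γ g g - (γ f g + γ f g) := by
    rw [hd.cdc_sub hf hg hs, hd.cdc_sub_right hf hg hf, hd.cdc_sub_right hf hg hg,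
      hd.cdc_symm g hg f hf]
    abel
  have h1 := (Lp.coeFn_nonneg _).2 (hd.cdc_nonneg _ ha)
  have h2 := (Lp.coeFn_nonneg _).2 (hd.cdc_nonneg _ hs)
  rw [e1] at h1
  rw [e2] at h2
  filter_upwards [h1, h2, Lp.coeFn_add (γ f f + γ g g) (γ f g + γ f g),
    Lp.coeFn_sub (γ f f + γ g g) (γ f g + γ f g), Lp.coeFn_add (γ f f) (γ g g),
    Lp.coeFn_add (γ f g) (γ f g)] with ϖ h1 h2 h3 h4 h5 h6
  simp only [h3, h4, h5, h6, Pi.add_apply, Pi.sub_apply, Pi.zero_apply] at h1 h2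
  rcases abs_cases (γ f g ϖ) with h | h <;> linarith

theorem norm_cdc_le (hd : IsLocalForm ν d γ) {f g : Lp ℝ 2 ν} (hf : f ∈ d) (hg : g ∈ d) :
    2 * ‖γ f g‖ ≤ ‖γ f f‖ + ‖γ g g‖ := by
  rw [L1.norm_eq_integral_norm, L1.norm_eq_integral_norm, L1.norm_eq_integral_norm,
    ← integral_const_mul,
    ← integral_add (L1.integrable_coeFn _).norm (L1.integrable_coeFn _).norm]
  refine integral_mono_ae ((L1.integrable_coeFn _).norm.const_mul _)
    ((L1.integrable_coeFn _).norm.add (L1.integrable_coeFn _).norm) ?_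
  filter_upwards [hd.abs_cdc_le hf hg] with ϖ h
  exact h.trans (add_le_add (Real.le_norm_self _) (Real.le_norm_self _))

/-- The domain as a subspace. -/
def toSubmodule (hd : IsLocalForm ν d γ) : Submodule ℝ (Lp ℝ 2 ν) where
  carrier := d
  add_mem' := fun {f g} hf hg => hd.add_mem f hf g hg
  zero_mem' := hd.zero_mem
  smul_mem' := fun c f hf => hd.smul_mem c f hf

end IsLocalForm

/-- The domain of a closed form, to be equipped with the graph norm. -/
def FormSpace (hd : IsLocalForm ν d γ) : Type _ := hd.toSubmodule

/-- An element of the domain, seen in the Hilbert space. -/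
def IsLocalForm.toFormSpace (hd : IsLocalForm ν d γ) {f : Lp ℝ 2 ν} (hf : f ∈ d) : FormSpace hd :=
  ⟨f, hf⟩

namespace FormSpace

variable (hd : IsLocalForm ν d γ)

instance : AddCommGroup (FormSpace hd) := inferInstanceAs (AddCommGroup hd.toSubmodule)

instance : Module ℝ (FormSpace hd) := inferInstanceAs (Module ℝ hd.toSubmodule)

/-- The inner product of the graph norm. -/
@[reducible]
def core : InnerProductSpace.Core ℝ (FormSpace hd) where
  inner f g := inner ℝ f.1 g.1 + energy γ f.1 g.1
  conj_inner_symm f g := by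
    simp only [conj_trivial]
    rw [real_inner_comm, hd.energy_symm g.2 f.2]
  re_inner_nonneg f := by
    simp only [RCLike.re_to_real]
    exact add_nonneg real_inner_self_nonneg (hd.energy_nonneg f.2)
  add_left f g h := by
    change inner ℝ (f.1 + g.1) h.1 + energy γ (f.1 + g.1) h.1 = _
    rw [inner_add_left, hd.energy_add f.2 g.2 h.2]
    ring
  smul_left f g c := by
    change inner ℝ (c • f.1) g.1 + energy γ (c • f.1) g.1 = _
    rw [real_inner_smul_left, hd.energy_smul c f.2 g.2, conj_trivial]
    ring
  definite f hf := by
    have h1 : 0 ≤ inner ℝ f.1 f.1 := real_inner_self_nonneg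
    have h2 := hd.energy_nonneg f.2
    have h3 : inner ℝ f.1 f.1 = 0 := le_antisymm (by change _ + _ = (0 : ℝ) at hf; linarith) h1
    exact Subtype.ext (inner_self_eq_zero.1 h3)

instance : NormedAddCommGroup (FormSpace hd) := (core hd).toNormedAddCommGroup

instance : InnerProductSpace ℝ (FormSpace hd) := InnerProductSpace.ofCore (core hd).toCore

variable {hd}

theorem norm_sq (f : FormSpace hd) : ‖f‖ ^ 2 = ‖f.1‖ ^ 2 + energy γ f.1 f.1 := by
  rw [← real_inner_self_eq_norm_sq, ← real_inner_self_eq_norm_sq]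
  rfl

theorem norm_val_le (f : FormSpace hd) : ‖f.1‖ ≤ ‖f‖ := by
  refine abs_le_of_sq_le_sq' ?_ (norm_nonneg _) |>.2
  rw [norm_sq]
  linarith [hd.energy_nonneg f.2]

theorem energy_le (f : FormSpace hd) : energy γ f.1 f.1 ≤ ‖f‖ ^ 2 := by
  rw [norm_sq]
  linarith [sq_nonneg ‖f.1‖]

variable (hd) in
/-- The embedding of the domain into `L²`. -/
def incl : FormSpace hd →L[ℝ] Lp ℝ 2 ν :=
  LinearMap.mkContinuous (hd.toSubmodule.subtype : FormSpace hd →ₗ[ℝ] Lp ℝ 2 ν) 1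
    fun f => by rw [one_mul]; exact norm_val_le f

theorem norm_incl_le : ‖incl hd‖ ≤ 1 :=
  LinearMap.mkContinuous_norm_le _ zero_le_one _

theorem incl_injective : Function.Injective (incl hd) := fun _ _ h => Subtype.ext h

/-- Completeness for the graph norm is exactly closedness of the form. -/
instance : CompleteSpace (FormSpace hd) := by
  refine Metric.complete_of_cauchySeq_tendsto fun s hs => ?_
  have h1 : CauchySeq fun n => (s n).1 := by
    have := hs.map (incl hd).uniformContinuous
    exact this
  obtain ⟨f, hf, hf1, hf2⟩ := hd.closed (fun n => (s n).1) (fun n => (s n).2) h1 <| by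
    intro ε hε
    obtain ⟨n₀, h⟩ := Metric.cauchySeq_iff.1 hs (Real.sqrt ε) (Real.sqrt_pos.2 hε)
    refine ⟨n₀, fun p hp q hq => ?_⟩
    have h2 := h p hp q hq
    rw [dist_eq_norm] at h2
    refine (energy_le (s p - s q)).trans_lt ?_
    calc ‖s p - s q‖ ^ 2 < Real.sqrt ε ^ 2 := by
          exact pow_lt_pow_left₀ h2 (norm_nonneg _) two_ne_zero
      _ = ε := Real.sq_sqrt hε.le
  refine ⟨hd.toFormSpace hf, ?_⟩
  rw [tendsto_iff_norm_sub_tendsto_zero] at hf1 ⊢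
  have h3 : Tendsto (fun n => ‖s n - hd.toFormSpace hf‖ ^ 2) atTop (𝓝 0) := by
    have := (hf1.pow 2).add hf2
    simp only [ne_eq, OfNat.ofNat_ne_zero, not_false_eq_true, zero_pow, add_zero] at this
    exact this.congr fun n => (norm_sq _).symm
  have h4 := (Real.continuous_sqrt.tendsto 0).comp h3
  rw [Real.sqrt_zero] at h4
  exact h4.congr fun n => Real.sqrt_sq (norm_nonneg _)

theorem norm_cdc_le (f : FormSpace hd) : ‖γ f.1 f.1‖ ≤ 2 * ‖f‖ ^ 2 := by
  have h1 := hd.energy_eq f.2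
  have h2 := energy_le f
  linarith

theorem norm_cdc_le_mul (f g : FormSpace hd) : ‖γ f.1 g.1‖ ≤ 2 * (‖f‖ * ‖g‖) := by
  rcases eq_or_ne f 0 with rfl | hf
  · have : γ (0 : FormSpace hd).1 g.1 = 0 := hd.cdc_zero_left g.2
    rw [this, norm_zero]; positivity
  rcases eq_or_ne g 0 with rfl | hg
  · have : γ f.1 (0 : FormSpace hd).1 = 0 := by
      rw [hd.cdc_symm _ f.2 _ (0 : FormSpace hd).2]; exact hd.cdc_zero_left f.2
    rw [this, norm_zero]; positivity
  have hf' := norm_pos_iff.2 hf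
  have hg' := norm_pos_iff.2 hg
  -- The additive inequality is made homogeneous by scaling `f` with ‖g‖ and `g` with ‖f‖, then
  -- dividing by the product of the norms.
  have h1 := hd.norm_cdc_le (hd.smul_mem ‖g‖ _ f.2) (hd.smul_mem ‖f‖ _ g.2)
  rw [hd.cdc_smul _ _ f.2 _ (hd.smul_mem _ _ g.2), hd.cdc_smul_right _ f.2 g.2,
    hd.cdc_smul _ _ f.2 _ (hd.smul_mem _ _ f.2), hd.cdc_smul_right _ f.2 f.2,
    hd.cdc_smul _ _ g.2 _ (hd.smul_mem _ _ g.2), hd.cdc_smul_right _ g.2 g.2] at h1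
  simp only [norm_smul, norm_norm] at h1
  have h2 := mul_le_mul_of_nonneg_left (norm_cdc_le f) (sq_nonneg ‖g‖)
  have h3 := mul_le_mul_of_nonneg_left (norm_cdc_le g) (sq_nonneg ‖f‖)
  have hp : 0 < ‖g‖ * ‖f‖ := mul_pos hg' hf'
  refine le_of_mul_le_mul_left ?_ hp
  nlinarith

/-- γ[g] - γ[f] = γ[g - f, g + f] by symmetry and bilinearity, and this is bounded by the product of
the graph norms. -/
theorem continuous_cdc : Continuous fun f : FormSpace hd => γ f.1 f.1 := by
  refine continuous_iff_continuousAt.2 fun f => ?_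
  refine tendsto_iff_norm_sub_tendsto_zero.2 ?_
  have hb : ∀ g : FormSpace hd, ‖γ g.1 g.1 - γ f.1 f.1‖ ≤ 2 * (‖g - f‖ * ‖g + f‖) := by
    intro g
    have h := norm_cdc_le_mul (g - f) (g + f)
    have e : γ (g - f).1 (g + f).1 = γ g.1 g.1 - γ f.1 f.1 := by
      change γ (g.1 - f.1) (g.1 + f.1) = _
      rw [hd.cdc_sub g.2 f.2 (hd.add_mem _ g.2 _ f.2), hd.cdc_add_right g.2 f.2 g.2,
        hd.cdc_add_right g.2 f.2 f.2, hd.cdc_symm _ f.2 _ g.2]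
      abel
    rwa [e] at h
  refine squeeze_zero (fun _ => norm_nonneg _) hb ?_
  have hc : Continuous fun g : FormSpace hd => 2 * (‖g - f‖ * ‖g + f‖) := by fun_prop
  simpa using hc.tendsto f

end FormSpace

/-- The carré du champ of a constant vanishes. -/
theorem IsLocalForm.cdc_const (hd : IsLocalForm ν d γ) {a : Lp ℝ 2 ν} (ha : a ∈ d) {c : ℝ}
    (hac : a =ᵐ[ν] fun _ => c) : γ a a = 0 := by
  rcases eq_or_ne c 0 with rfl | hc
  · have : a = 0 := by
      refine Lp.ext (hac.trans ?_)
      exact (Lp.coeFn_zero ℝ 2 ν).symm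
    rw [this]
    exact hd.cdc_zero_left hd.zero_mem
  obtain ⟨φ⟩ : Nonempty (ContDiffBump (c : ℝ)) :=
    ⟨⟨|c| / 8, |c| / 4, by positivity, by have := abs_pos.2 hc; linarith⟩⟩
  -- Bumps at c and at 0 with disjoint supports: φ(a) - φ(0) = 1 = a/c and ψ(a) - ψ(0) = -1 = -a/c.
  -- Locality then gives e(a/c, -a/c) = 0, so a has zero energy.
  let φ : ContDiffBump (c : ℝ) :=
    ⟨|c| / 8, |c| / 4, by positivity, by have := abs_pos.2 hc; linarith⟩
  let ψ : ContDiffBump (0 : ℝ) :=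
    ⟨|c| / 8, |c| / 4, by positivity, by have := abs_pos.2 hc; linarith⟩
  have hcpos := abs_pos.2 hc
  have hφc : φ c = 1 := φ.one_of_mem_closedBall (Metric.mem_closedBall_self φ.rIn_pos.le)
  have hψ0 : ψ 0 = 1 := ψ.one_of_mem_closedBall (Metric.mem_closedBall_self ψ.rIn_pos.le)
  have hφ0 : φ 0 = 0 := φ.zero_of_le_dist (by
    change |c| / 4 ≤ dist 0 c
    rw [dist_comm, Real.dist_eq, sub_zero]; linarith)
  have hψc : ψ c = 0 := ψ.zero_of_le_dist (by
    change |c| / 4 ≤ dist c 0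
    rw [Real.dist_eq, sub_zero]; linarith)
  have hdisj : Disjoint (tsupport φ) (tsupport ψ) := by
    rw [φ.tsupport_eq, ψ.tsupport_eq]
    refine Metric.closedBall_disjoint_closedBall ?_
    change |c| / 4 + |c| / 4 < dist c 0
    rw [Real.dist_eq, sub_zero]; linarith
  have hm := hd.smul_mem c⁻¹ a ha
  have hm' := hd.neg_mem hm
  have h1 : (c⁻¹ • a : Lp ℝ 2 ν) =ᵐ[ν] fun _ => (1 : ℝ) := by
    filter_upwards [Lp.coeFn_smul c⁻¹ a, hac] with ϖ h h'
    rw [h, Pi.smul_apply, h', smul_eq_mul, inv_mul_cancel₀ hc]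
  have he := hd.local_form a ha φ ψ φ.contDiff ψ.contDiff φ.hasCompactSupport ψ.hasCompactSupport
    hdisj _ hm _ hm'
    (by
      filter_upwards [h1, hac] with ϖ h h'
      rw [h, h', hφc, hφ0, sub_zero])
    (by
      filter_upwards [h1, hac, Lp.coeFn_neg (c⁻¹ • a : Lp ℝ 2 ν)] with ϖ h h' h''
      rw [h'', Pi.neg_apply, h, h', hψc, hψ0, zero_sub])
  rw [hd.energy_symm hm hm', ← neg_one_smul ℝ, hd.energy_smul _ hm hm, hd.energy_smul _ ha hm,
    hd.energy_symm ha hm, hd.energy_smul _ ha ha, hd.energy_eq ha] at he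
  have : ‖γ a a‖ = 0 := by
    have hci := inv_ne_zero hc
    by_contra hne
    apply absurd he
    positivity
  exact norm_eq_zero.1 this

end FormSpace

/-! ### Measurable curves in `Lᵖ` -/

section Curves

theorem tendsto_eLpNorm_sub_of_dominated {α : Type*} [MeasurableSpace α] {ν : Measure α}
    {p : ℝ≥0∞} (hp0 : p ≠ 0) (hpt : p ≠ ⊤) {F : ℕ → α → ℝ} {f g : α → ℝ}
    (hF : ∀ n, AEStronglyMeasurable (F n) ν) (hf : AEStronglyMeasurable f ν) (hg : MemLp g p ν)
    (hb : ∀ n, ∀ᵐ a ∂ν, |F n a| ≤ g a) (hl : ∀ᵐ a ∂ν, Tendsto (fun n => F n a) atTop (𝓝 (f a))) :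
    Tendsto (fun n => eLpNorm (F n - f) p ν) atTop (𝓝 0) := by
  have hp : 0 < p.toReal := ENNReal.toReal_pos hp0 hpt
  simp_rw [eLpNorm_eq_lintegral_rpow_enorm_toReal hp0 hpt]
  have hfg : ∀ᵐ a ∂ν, |f a| ≤ g a := by
    filter_upwards [hl, ae_all_iff.2 hb] with a h1 h2
    exact le_of_tendsto' h1.abs h2
  have h2g : MemLp (fun a => 2 * g a) p ν := hg.const_mul 2
  have key : Tendsto (fun n => ∫⁻ a, ‖(F n - f) a‖ₑ ^ p.toReal ∂ν) atTop
      (𝓝 (∫⁻ _, 0 ∂ν)) := by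
    refine tendsto_lintegral_of_dominated_convergence' (fun a => ‖2 * g a‖ₑ ^ p.toReal)
      (fun n => ((hF n).sub hf).enorm.pow_const _) (fun n => ?_) ?_ ?_
    · filter_upwards [hb n, hfg] with a h1 h2
      refine ENNReal.rpow_le_rpow ?_ hp.le
      refine enorm_le_iff_norm_le.2 ?_
      rw [Pi.sub_apply, Real.norm_eq_abs, Real.norm_eq_abs]
      have h3 := abs_sub (F n a) (f a)
      have h4 := le_abs_self (2 * g a)
      linarith
    · exact (lintegral_rpow_enorm_lt_top_of_eLpNorm_lt_top hp0 hpt h2g.2).ne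
    · filter_upwards [hl] with a h
      have h1 : Tendsto (fun n => (F n - f) a) atTop (𝓝 0) := by
        simpa using h.sub_const (f a)
      have h2 := (h1.enorm).ennrpow_const p.toReal
      rwa [enorm_zero, ENNReal.zero_rpow_of_pos hp] at h2
  rw [lintegral_zero] at key
  have := key.ennrpow_const (1 / p.toReal)
  rwa [ENNReal.zero_rpow_of_pos (by positivity)] at this

variable {S Y : Type*} [MeasurableSpace S] [MeasurableSpace Y] {μ : Measure Y}
  [IsProbabilityMeasure μ] {p : ℝ≥0∞} [hp1 : Fact (1 ≤ p)]

/-- Strong measurability is carried by π–λ induction from rectangles, so separability of Lᵖ(μ) is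
not required. -/
theorem exists_stronglyMeasurable_curve_indicator (hp : p ≠ ⊤) {A : Set (S × Y)}
    (hA : MeasurableSet A) :
    ∃ c : S → Lp ℝ p μ, StronglyMeasurable c ∧
      ∀ s, c s =ᵐ[μ] fun v => A.indicator (fun _ => (1 : ℝ)) (s, v) := by
  have hp0 : p ≠ 0 := (zero_lt_one.trans_le hp1.out).ne'
  have hone : MemLp (fun _ : Y => (1 : ℝ)) p μ := memLp_const 1
  induction A, hA using MeasurableSpace.induction_on_inter generateFrom_prod.symm
    isPiSystem_prod with
  | empty =>
    refine ⟨fun _ => 0, stronglyMeasurable_const, fun s => ?_⟩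
    filter_upwards [Lp.coeFn_zero ℝ p μ] with v hv
    simp
  | basic A hA =>
    obtain ⟨B, hB, C, hC, rfl⟩ := hA
    refine ⟨B.indicator fun _ => (hone.indicator hC).toLp _,
      stronglyMeasurable_const.indicator hB, fun s => ?_⟩
    by_cases hs : s ∈ B
    · rw [Set.indicator_of_mem hs]
      filter_upwards [(hone.indicator hC).coeFn_toLp] with v hv
      rw [hv]
      by_cases hvC : v ∈ C <;> simp [hs, hvC]
    · rw [Set.indicator_of_notMem hs]
      filter_upwards [Lp.coeFn_zero ℝ p μ] with v hv
      simp [hs]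
  | compl A hA ih =>
    obtain ⟨c, hc, hcA⟩ := ih
    refine ⟨fun s => hone.toLp _ - c s, stronglyMeasurable_const.sub hc, fun s => ?_⟩
    filter_upwards [hcA s, hone.coeFn_toLp, Lp.coeFn_sub (hone.toLp _) (c s)] with v h1 h2 h3
    rw [h3, Pi.sub_apply, h1, h2]
    by_cases h : (s, v) ∈ A <;> simp [h]
  | iUnion A hdisj hA ih =>
    choose c hc hcA using ih
    have hmeas : ∀ s, MeasurableSet {v | (s, v) ∈ ⋃ i, A i} := fun s =>
      measurable_prodMk_left (MeasurableSet.iUnion hA)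
    have hmem : ∀ s, MemLp ({v | (s, v) ∈ ⋃ i, A i}.indicator fun _ => (1 : ℝ)) p μ :=
      fun s => hone.indicator (hmeas s)
    refine ⟨fun s => (hmem s).toLp _, ?_, fun s => ?_⟩
    · refine stronglyMeasurable_of_tendsto atTop (f := fun n s => ∑ i ∈ Finset.range n, c i s)
        (fun n => Finset.stronglyMeasurable_fun_sum _ fun i _ => hc i) ?_
      rw [tendsto_pi_nhds]
      intro s
      refine Lp.tendsto_Lp_of_tendsto_eLpNorm (f := fun n => ∑ i ∈ Finset.range n, c i s)
        _ (hmem s) ?_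
      have hsum : ∀ n, (∑ i ∈ Finset.range n, c i s : Lp ℝ p μ) =ᵐ[μ]
          fun v => ∑ i ∈ Finset.range n, (A i).indicator (fun _ => (1 : ℝ)) (s, v) := by
        intro n
        induction n with
        | zero =>
          filter_upwards [Lp.coeFn_zero ℝ p μ] with v hv
          simp
        | succ n ihn =>
          rw [Finset.sum_range_succ]
          filter_upwards [ihn, hcA n s, Lp.coeFn_add (∑ i ∈ Finset.range n, c i s) (c n s)]
            with v h1 h2 h3
          rw [h3, Pi.add_apply, h1, h2, Finset.sum_range_succ]
      have hpart : ∀ n v, ∑ i ∈ Finset.range n, (A i).indicator (fun _ => (1 : ℝ)) (s, v) =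
          (⋃ i ∈ Finset.range n, A i).indicator (fun _ => (1 : ℝ)) (s, v) := by
        intro n v
        rw [Finset.indicator_biUnion_apply _ _ fun i _ j _ hij => hdisj hij]
      refine (tendsto_eLpNorm_sub_of_dominated hp0 hp (g := fun _ => 1)
        (fun n => Lp.aestronglyMeasurable _) (hmem s).1 hone (fun n => ?_) ?_)
      · filter_upwards [hsum n] with v hv
        rw [hv, hpart]
        by_cases h : (s, v) ∈ ⋃ i ∈ Finset.range n, A i
        · rw [Set.indicator_of_mem h, abs_one]
        · rw [Set.indicator_of_notMem h, abs_zero]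
          exact zero_le_one
      · filter_upwards [ae_all_iff.2 hsum] with v hv
        simp_rw [hv]
        by_cases h : ∃ i, (s, v) ∈ A i
        · obtain ⟨i, hi⟩ := h
          have hm : v ∈ {v | (s, v) ∈ ⋃ i, A i} := Set.mem_iUnion.2 ⟨i, hi⟩
          rw [Set.indicator_of_mem hm]
          refine tendsto_const_nhds.congr' ?_
          filter_upwards [eventually_gt_atTop i] with n hn
          rw [hpart, Set.indicator_of_mem]
          exact Set.mem_biUnion (Finset.mem_coe.2 (Finset.mem_range.2 hn)) hi
        · have hm : v ∉ {v | (s, v) ∈ ⋃ i, A i} := fun h' => h (Set.mem_iUnion.1 h')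
          rw [Set.indicator_of_notMem hm]
          refine tendsto_const_nhds.congr fun n => ?_
          rw [hpart, Set.indicator_of_notMem]
          simp only [Set.mem_iUnion, not_exists]
          exact fun i _ hi => h ⟨i, hi⟩
    · filter_upwards [(hmem s).coeFn_toLp] with v hv
      rw [hv]
      by_cases h : (s, v) ∈ ⋃ i, A i
      · have hm : v ∈ {v | (s, v) ∈ ⋃ i, A i} := h
        rw [Set.indicator_of_mem hm, Set.indicator_of_mem h]
      · have hm : v ∉ {v | (s, v) ∈ ⋃ i, A i} := h
        rw [Set.indicator_of_notMem hm, Set.indicator_of_notMem h]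

theorem exists_stronglyMeasurable_curve_simpleFunc (hp : p ≠ ⊤) (φ : SimpleFunc (S × Y) ℝ) :
    ∃ c : S → Lp ℝ p μ, StronglyMeasurable c ∧ ∀ s, c s =ᵐ[μ] fun v => φ (s, v) := by
  induction φ using SimpleFunc.induction with
  | const x hA =>
    obtain ⟨c, hc, hcA⟩ := exists_stronglyMeasurable_curve_indicator (μ := μ) hp hA
    refine ⟨fun s => x • c s, hc.const_smul x, fun s => ?_⟩
    filter_upwards [hcA s, Lp.coeFn_smul x (c s)] with v h1 h2
    rw [h2, Pi.smul_apply, h1]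
    simp [Set.indicator, Set.piecewise]
  | add hdisj h1 h2 =>
    obtain ⟨c, hc, hcA⟩ := h1
    obtain ⟨c', hc', hcA'⟩ := h2
    refine ⟨fun s => c s + c' s, hc.add hc', fun s => ?_⟩
    filter_upwards [hcA s, hcA' s, Lp.coeFn_add (c s) (c' s)] with v h1 h2 h3
    rw [h3, Pi.add_apply, h1, h2]
    rfl

/-- A jointly measurable function defines a measurable curve in `Lᵖ`. -/
theorem exists_stronglyMeasurable_curve (hp : p ≠ ⊤) {f : S → Y → ℝ}
    (hf : Measurable (Function.uncurry f)) :
    ∃ c : S → Lp ℝ p μ, StronglyMeasurable c ∧ ∀ s, MemLp (f s) p μ → c s =ᵐ[μ] f s := by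
  classical
  have hp0 : p ≠ 0 := (zero_lt_one.trans_le hp1.out).ne'
  set φ : ℕ → SimpleFunc (S × Y) ℝ := SimpleFunc.approxOn _ hf Set.univ 0 (Set.mem_univ _) with hφ
  choose c hc hcφ using fun n => exists_stronglyMeasurable_curve_simpleFunc (μ := μ) hp (φ n)
  have hfs : ∀ s, Measurable (f s) := fun s => hf.comp measurable_prodMk_left
  have hG : MeasurableSet {s | MemLp (f s) p μ} := by
    have : {s | MemLp (f s) p μ} = {s | ∫⁻ v, ‖f s v‖ₑ ^ p.toReal ∂μ < ⊤} := by
      ext s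
      change MemLp (f s) p μ ↔ ∫⁻ v, ‖f s v‖ₑ ^ p.toReal ∂μ < ⊤
      rw [← eLpNorm_lt_top_iff_lintegral_rpow_enorm_lt_top hp0 hp]
      exact ⟨fun h => h.2, fun h => ⟨(hfs s).aestronglyMeasurable, h⟩⟩
    rw [this]
    refine measurableSet_lt ?_ measurable_const
    exact Measurable.lintegral_prod_right' (f := fun z : S × Y => ‖f z.1 z.2‖ₑ ^ p.toReal)
      ((hf.enorm).pow_const _)
  refine ⟨fun s => if h : MemLp (f s) p μ then h.toLp _ else 0, ?_, fun s hs => ?_⟩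
  · refine stronglyMeasurable_of_tendsto atTop
      (f := fun n => {s | MemLp (f s) p μ}.indicator (c n)) (fun n => (hc n).indicator hG) ?_
    rw [tendsto_pi_nhds]
    intro s
    by_cases hs : MemLp (f s) p μ
    · have hs' : s ∈ {s | MemLp (f s) p μ} := hs
      simp only [Set.indicator_of_mem hs', dif_pos hs]
      refine Lp.tendsto_Lp_of_tendsto_eLpNorm (f := fun n => c n s) _ hs ?_
      refine tendsto_eLpNorm_sub_of_dominated hp0 hp (g := fun v => ‖f s v‖ + ‖f s v‖)
        (fun n => Lp.aestronglyMeasurable _) hs.1 (hs.norm.add hs.norm) (fun n => ?_) ?_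
      · filter_upwards [hcφ n s] with v hv
        rw [hv, ← Real.norm_eq_abs]
        exact SimpleFunc.norm_approxOn_zero_le hf (Set.mem_univ _) (s, v) n
      · filter_upwards [ae_all_iff.2 fun n => hcφ n s] with v hv
        simp_rw [hv]
        exact SimpleFunc.tendsto_approxOn hf (Set.mem_univ _) (by simp)
    · have hs' : s ∉ {s | MemLp (f s) p μ} := hs
      simp only [Set.indicator_of_notMem hs', dif_neg hs]
      exact tendsto_const_nhds
  · simp only [dif_pos hs]
    exact hs.coeFn_toLp

/-- A measurable curve in `Lᵖ` has a jointly measurable version. -/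
theorem exists_measurable_version {c : S → Lp ℝ p μ} (hc : StronglyMeasurable c) :
    ∃ h : S → Y → ℝ, Measurable (Function.uncurry h) ∧ ∀ s, c s =ᵐ[μ] h s := by
  classical
  have hp0 : p ≠ 0 := (zero_lt_one.trans_le hp1.out).ne'
  have hlim : ∀ (k : ℕ) (z : S × Y), ∃ n, ‖hc.approx n z.1 - c z.1‖ < (1 / 2 : ℝ) ^ k := by
    intro k z
    have := tendsto_iff_norm_sub_tendsto_zero.1 (hc.tendsto_approx z.1)
    exact (this.eventually_lt_const (by positivity : (0 : ℝ) < (1 / 2) ^ k)).exists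
  have hmeas : ∀ n, Measurable fun z : S × Y => (hc.approx n z.1 : Lp ℝ p μ) z.2 := by
    intro n
    exact SimpleFunc.measurable_bind ((hc.approx n).comp Prod.fst measurable_fst)
      (fun r z => r z.2) fun r => (Lp.stronglyMeasurable r).measurable.comp measurable_snd
  -- For each parameter, the first simple approximation within 2⁻ᵏ is selected. There are countably
  -- many indices and each approximation takes finitely many values in Lᵖ, so this is jointly
  -- measurable; the geometric rate then forces convergence almost everywhere in the second
  -- variable.
  set h : ℕ → S × Y → ℝ := fun k z => (hc.approx (Nat.find (hlim k z)) z.1 : Lp ℝ p μ) z.2 with hh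
  have hhm : ∀ k, Measurable (h k) := fun k =>
    Measurable.find (p := fun n (z : S × Y) => ‖hc.approx n z.1 - c z.1‖ < (1 / 2 : ℝ) ^ k)
      hmeas (fun n => measurableSet_lt
      ((((hc.approx n).stronglyMeasurable.sub hc).norm.measurable).comp measurable_fst)
      measurable_const) (hlim k)
  refine ⟨fun s v => limUnder atTop fun k => h k (s, v), ?_, fun s => ?_⟩
  · exact (StronglyMeasurable.limUnder fun k => (hhm k).stronglyMeasurable).measurable
  -- The selected index depends on `s` only; `v₀` merely serves to name it.
  · obtain ⟨v₀⟩ : Nonempty Y := Measure.nonempty_of_neZero μ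
    set N : ℕ → ℕ := fun k => Nat.find (hlim k (s, v₀))
    set g : ℕ → Lp ℝ p μ := fun k => hc.approx (N k) s with hg
    have hgN : ∀ k, ‖g k - c s‖ < (1 / 2 : ℝ) ^ k := fun k => Nat.find_spec (hlim k (s, v₀))
    have hgt : Tendsto g atTop (𝓝 (c s)) := by
      refine tendsto_iff_norm_sub_tendsto_zero.2 ?_
      exact squeeze_zero (fun _ => norm_nonneg _) (fun k => (hgN k).le)
        (tendsto_pow_atTop_nhds_zero_of_lt_one (by norm_num) (by norm_num))
    obtain ⟨ns, hns, hns'⟩ := (tendstoInMeasure_of_tendsto_Lp hgt).exists_seq_tendsto_ae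
    have hcau := Lp.ae_tendsto_of_cauchy_eLpNorm (μ := μ) (p := p)
      (f := fun k => (g k : Y → ℝ))
      (B := fun k => ENNReal.ofReal (2 * (1 / 2 : ℝ) ^ k))
      (fun k => Lp.aestronglyMeasurable _) hp1.out (by
        rw [← ENNReal.ofReal_tsum_of_nonneg (fun n => by positivity)
          ((summable_geometric_of_lt_one (by norm_num) (by norm_num)).mul_left 2)]
        exact ENNReal.ofReal_ne_top) (by
        intro k n m hn hm
        have e : eLpNorm ((g n : Y → ℝ) - (g m : Y → ℝ)) p μ = ‖g n - g m‖ₑ := by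
          rw [Lp.enorm_def]
          exact eLpNorm_congr_ae (Lp.coeFn_sub _ _).symm
        rw [e, ← ofReal_norm]
        refine (ENNReal.ofReal_lt_ofReal_iff (by positivity)).2 ?_
        have hle : ∀ j, k ≤ j → ‖g j - c s‖ < (1 / 2 : ℝ) ^ k := fun j hj =>
          (hgN j).trans_le (pow_le_pow_of_le_one (by norm_num) (by norm_num) hj)
        calc ‖g n - g m‖ = ‖(g n - c s) - (g m - c s)‖ := by congr 1; abel
          _ ≤ ‖g n - c s‖ + ‖g m - c s‖ := norm_sub_le _ _
          _ < 2 * (1 / 2 : ℝ) ^ k := by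
            have := hle n hn
            have := hle m hm
            linarith)
    filter_upwards [hns', hcau] with v h1 h2
    obtain ⟨l, hl⟩ := h2
    have hl' : c s v = l := tendsto_nhds_unique h1 (hl.comp hns.tendsto_atTop)
    rw [hl']
    exact hl.limUnder_eq.symm

/-- Measurable dependence of the carré du champ on parameters. -/
theorem IsLocalForm.exists_measurable_cdc {d : Set (Lp ℝ 2 μ)}
    {γ : Lp ℝ 2 μ → Lp ℝ 2 μ → Lp ℝ 1 μ} (hd : IsLocalForm μ d γ) {f : S → Y → ℝ}
    (hf : Measurable (Function.uncurry f)) :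
    ∃ h : S → Y → ℝ, Measurable (Function.uncurry h) ∧ (∀ s v, 0 ≤ h s v) ∧
      ∀ s, (∃ a ∈ d, a =ᵐ[μ] f s) → HasCdc d γ (f s) (f s) (h s) := by
  obtain ⟨c, hc, hcf⟩ := exists_stronglyMeasurable_curve (μ := μ) (p := 2) (by simp) hf
  obtain ⟨R, hR, -⟩ := exists_approx_leftInverse (FormSpace.incl hd) FormSpace.norm_incl_le
    FormSpace.incl_injective
  -- If `c s` lies in `d`, these converge in L¹ to its carré du champ, because `R n (c s)` converges
  -- to it in the graph norm. For other `s` the default value of the limit is harmless.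
  have hg : ∀ n, StronglyMeasurable fun s => γ (R n (c s)).1 (R n (c s)).1 := fun n =>
    (FormSpace.continuous_cdc.comp (R n).continuous).comp_stronglyMeasurable hc
  obtain ⟨h, hh, hgh⟩ := exists_measurable_version (StronglyMeasurable.limUnder (l := atTop) hg)
  refine ⟨fun s v => max 0 (h s v), measurable_const.max hh, fun s v => le_max_left _ _,
    fun s => ?_⟩
  rintro ⟨a, ha, haf⟩
  have hcs : c s = a := Lp.ext ((hcf s ((memLp_congr_ae haf).1 (Lp.memLp a))).trans haf.symm)
  refine ⟨a, ha, a, ha, haf, haf, ?_⟩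
  have hl := (FormSpace.continuous_cdc.tendsto (hd.toFormSpace ha)).comp (hR (hd.toFormSpace ha))
  have hl' : limUnder atTop (fun n => γ (R n (c s)).1 (R n (c s)).1) = γ a a := by
    rw [hcs]
    exact hl.limUnder_eq
  have h1 := hgh s
  rw [hl'] at h1
  filter_upwards [h1, (Lp.coeFn_nonneg _).2 (hd.cdc_nonneg a ha)] with v h1 h2
  rw [← h1, max_eq_right (by simpa using h2)]

end Curves

/-! ### Configurations and their Laplace functionals -/

section ExpNeg

/-- `exp (-a)` for `a ∈ [0, ∞]`. -/
def expNeg (a : ℝ≥0∞) : ℝ≥0∞ := (EReal.exp (a : EReal))⁻¹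

/-- `-log b`, truncated below at `0`. -/
def logNeg (b : ℝ≥0∞) : ℝ≥0∞ := (ENNReal.log b⁻¹).toENNReal

theorem one_le_exp_coe (a : ℝ≥0∞) : 1 ≤ EReal.exp (a : EReal) :=
  EReal.one_le_exp_iff.2 (EReal.coe_ennreal_nonneg a)

theorem expNeg_le_one (a : ℝ≥0∞) : expNeg a ≤ 1 := ENNReal.inv_le_one.2 (one_le_exp_coe a)

theorem expNeg_zero : expNeg 0 = 1 := by simp [expNeg]

theorem expNeg_top : expNeg ⊤ = 0 := by simp [expNeg]

theorem expNeg_add (a b : ℝ≥0∞) : expNeg (a + b) = expNeg a * expNeg b := by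
  rw [expNeg, EReal.coe_ennreal_add, EReal.exp_add, ENNReal.mul_inv]
  · rfl
  · exact Or.inl (zero_lt_one.trans_le (one_le_exp_coe a)).ne'
  · exact Or.inr (zero_lt_one.trans_le (one_le_exp_coe b)).ne'

theorem continuous_expNeg : Continuous expNeg :=
  (ENNReal.continuous_exp.comp continuous_coe_ennreal_ereal).inv

theorem measurable_expNeg : Measurable expNeg := continuous_expNeg.measurable

theorem expNeg_injective : Function.Injective expNeg := fun _ _ h =>
  EReal.coe_ennreal_injective (EReal.exp_strictMono.injective (inv_injective h))

theorem measurable_logNeg : Measurable logNeg :=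
  (ENNReal.measurable_log.comp measurable_inv).ereal_toENNReal

theorem expNeg_logNeg {b : ℝ≥0∞} (hb : b ≤ 1) : expNeg (logNeg b) = b := by
  rw [expNeg, logNeg, EReal.coe_toENNReal, ENNReal.exp_log, inv_inv]
  exact ENNReal.zero_le_log_iff.2 (ENNReal.one_le_inv.2 hb)

theorem expNeg_sum {ι : Type*} (s : Finset ι) (a : ι → ℝ≥0∞) :
    expNeg (∑ i ∈ s, a i) = ∏ i ∈ s, expNeg (a i) := by
  classical
  induction s using Finset.induction_on with
  | empty => simp [expNeg_zero]
  | insert i s hi ih => rw [Finset.sum_insert hi, Finset.prod_insert hi, expNeg_add, ih]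

theorem tendsto_prod_expNeg {ι : Type*} (a : ι → ℝ≥0∞) :
    Tendsto (fun s : Finset ι => ∏ i ∈ s, expNeg (a i)) atTop (𝓝 (expNeg (∑' i, a i))) := by
  have := (continuous_expNeg.tendsto _).comp (ENNReal.summable (f := a)).hasSum
  exact this.congr fun s => expNeg_sum s a

end ExpNeg

namespace Config

section Basic

variable {Z : Type*} [MeasurableSpace Z]

theorem measurable_encard {A : Set Z} (hA : MeasurableSet A) :
    Measurable fun ϖ : Config Z => (ϖ.1 ∩ A).encard := by
  refine measurable_iff_comap_le.2 ?_
  exact le_iSup₂_of_le (f := fun (A : Set Z) (_ : MeasurableSet A) =>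
    MeasurableSpace.comap (fun ϖ : Config Z => (ϖ.1 ∩ A).encard) ⊤) A hA le_rfl

theorem lintegral_toMeasure' {ϖ : Config Z} {f : Z → ℝ≥0∞} (hf : Measurable f) :
    ∫⁻ z, f z ∂ϖ.toMeasure = ∑' z : ϖ.1, f z := by
  rw [toMeasure, lintegral_sum_measure]
  exact tsum_congr fun z => lintegral_dirac' _ hf

theorem toMeasure_apply {ϖ : Config Z} {A : Set Z} (hA : MeasurableSet A) :
    ϖ.toMeasure A = ((ϖ.1 ∩ A).encard : ℝ≥0∞) := by
  rw [← lintegral_indicator_one hA, lintegral_toMeasure' (measurable_one.indicator hA),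
    ← ENNReal.tsum_set_one, tsum_subtype ϖ.1 (A.indicator 1), tsum_subtype (ϖ.1 ∩ A) fun _ => 1,
    Set.inter_comm, ← Set.indicator_indicator, Set.indicator_indicator, Set.indicator_indicator,
    Set.inter_comm]
  rfl

theorem measurable_toMeasure_apply {A : Set Z} (hA : MeasurableSet A) :
    Measurable fun ϖ : Config Z => ϖ.toMeasure A := by
  simp_rw [toMeasure_apply hA]
  exact measurable_from_top.comp (measurable_encard hA)

theorem measurable_toMeasure : Measurable (toMeasure : Config Z → Measure Z) :=
  Measure.measurable_of_measurable_coe _ fun _ hA => measurable_toMeasure_apply hA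

theorem measurable_lintegral {f : Z → ℝ≥0∞} (hf : Measurable f) :
    Measurable fun ϖ : Config Z => ∫⁻ z, f z ∂ϖ.toMeasure :=
  (Measure.measurable_lintegral hf).comp measurable_toMeasure

theorem measurable_of_toMeasure {Ω : Type*} [MeasurableSpace Ω] {f : Ω → Config Z}
    (h : ∀ A, MeasurableSet A → Measurable fun t => (f t).toMeasure A) : Measurable f := by
  refine Measurable.of_comap_le ?_
  simp only [instMeasurableSpace, MeasurableSpace.comap_iSup, MeasurableSpace.comap_comp]
  refine iSup₂_le fun A hA => ?_
  rw [← measurable_iff_comap_le]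
  have h1 := h A hA
  simp_rw [toMeasure_apply hA] at h1
  refine measurable_to_countable' fun k => ?_
  have : (fun t => ((f t).1 ∩ A).encard) ⁻¹' {k} =
      (fun t => (((f t).1 ∩ A).encard : ℝ≥0∞)) ⁻¹' {(k : ℝ≥0∞)} := by
    ext t
    simp
  exact this ▸ h1 (measurableSet_singleton _)

variable {p : (Config Z → ℝ) → Prop}

/-- The functional `exp (-∫ s dϖ)`. -/
def laplace (s : Z → ℝ≥0∞) (ϖ : Config Z) : ℝ := (expNeg (∫⁻ z, s z ∂ϖ.toMeasure)).toReal

theorem laplace_nonneg (s : Z → ℝ≥0∞) (ϖ : Config Z) : 0 ≤ laplace s ϖ := ENNReal.toReal_nonneg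

theorem laplace_le_one (s : Z → ℝ≥0∞) (ϖ : Config Z) : laplace s ϖ ≤ 1 :=
  ENNReal.toReal_le_of_le_ofReal zero_le_one (by simpa using expNeg_le_one _)

theorem measurable_laplace {s : Z → ℝ≥0∞} (hs : Measurable s) :
    Measurable (laplace s : Config Z → ℝ) :=
  (measurable_expNeg.comp (measurable_lintegral hs)).ennreal_toReal

theorem laplace_mul {s t : Z → ℝ≥0∞} (hs : Measurable s) (ϖ : Config Z) :
    laplace (s + t) ϖ = laplace s ϖ * laplace t ϖ := by
  rw [laplace, laplace, laplace, ← ENNReal.toReal_mul, ← expNeg_add]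
  congr 2
  exact lintegral_add_left hs t

/-- The events generating the σ-field of the configuration space. -/
def countEvents (Z : Type*) [MeasurableSpace Z] : Set (Set (Config Z)) :=
  {S | ∃ J : Finset (Set Z × ℕ∞), (∀ c ∈ J, MeasurableSet c.1) ∧
    S = {ϖ | ∀ c ∈ J, (ϖ.1 ∩ c.1).encard = c.2}}

theorem isPiSystem_countEvents : IsPiSystem (countEvents Z) := by
  classical
  rintro _ ⟨J, hJ, rfl⟩ _ ⟨J', hJ', rfl⟩ -
  refine ⟨J ∪ J', fun c hc => ?_, ?_⟩
  · rcases Finset.mem_union.1 hc with h | h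
    exacts [hJ c h, hJ' c h]
  · ext ϖ
    constructor
    · rintro ⟨h1, h2⟩ c hc
      rcases Finset.mem_union.1 hc with h | h
      exacts [h1 c h, h2 c h]
    · exact fun h => ⟨fun c hc => h c (Finset.mem_union_left _ hc),
        fun c hc => h c (Finset.mem_union_right _ hc)⟩

theorem generateFrom_countEvents :
    (instMeasurableSpace : MeasurableSpace (Config Z)) =
      MeasurableSpace.generateFrom (countEvents Z) := by
  refine le_antisymm ?_ (MeasurableSpace.generateFrom_le ?_)
  · refine iSup₂_le fun A hA => ?_
    rw [← measurable_iff_comap_le]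
    refine @measurable_to_countable' _ _ _ _ (MeasurableSpace.generateFrom (countEvents Z)) _
      fun k => ?_
    refine MeasurableSpace.measurableSet_generateFrom ⟨{(A, k)}, ?_, ?_⟩
    · simpa using hA
    · ext ϖ
      simp
  · rintro _ ⟨J, hJ, rfl⟩
    have : {ϖ : Config Z | ∀ c ∈ J, (ϖ.1 ∩ c.1).encard = c.2} =
        ⋂ c ∈ J, (fun ϖ : Config Z => (ϖ.1 ∩ c.1).encard) ⁻¹' {c.2} := by
      ext ϖ
      simp
    rw [this]
    exact Finset.measurableSet_biInter _ fun c hc =>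
      measurable_encard (hJ c hc) (MeasurableSet.of_discrete)

/-- Laplace functionals are stable under products, so their linear span is an algebra. Since exp(-·)
is injective on [0, ∞], the event that prescribed sets have prescribed countings is `z c = a c` for
all `c ∈ J`, where `z c` is a Laplace functional and `a c` a constant in [0, 1]. Its indicator is
the bounded limit of the polynomials ∏ (1 - (z c - a c)²)ⁿ. The π–λ theorem does the rest. -/
theorem induction_laplace (laplace : ∀ s : Z → ℝ≥0∞, Measurable s → p (laplace s))
    (add : ∀ f g, p f → p g → p (f + g)) (smul : ∀ (c : ℝ) f, p f → p (c • f))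
    (lim : ∀ (F : ℕ → Config Z → ℝ) f, (∀ n, p (F n)) → (∃ C, ∀ n ϖ, |F n ϖ| ≤ C) →
      (∀ ϖ, Tendsto (fun n => F n ϖ) atTop (𝓝 (f ϖ))) → p f)
    {S : Set (Config Z)} (hS : MeasurableSet S) : p (S.indicator 1) := by
  have zero : p 0 := by simpa using smul 0 _ (laplace 0 measurable_zero)
  have one : p 1 := by
    have := laplace 0 measurable_zero
    have e : Config.laplace (0 : Z → ℝ≥0∞) = 1 := by
      ext ϖ
      simp [Config.laplace, expNeg_zero]
    rwa [e] at this
  induction S, hS using MeasurableSpace.induction_on_inter generateFrom_countEvents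
    isPiSystem_countEvents with
  | empty => exact (Set.indicator_empty (1 : Config Z → ℝ)).symm ▸ zero
  | basic S hS =>
    obtain ⟨J, hJ, rfl⟩ := hS
    let V : Submodule ℝ (Config Z → ℝ) :=
      { carrier := {f | p f}
        add_mem' := fun {f g} hf hg => add f g hf hg
        zero_mem' := zero
        smul_mem' := fun c f hf => smul c f hf }
    let M : Submonoid (Config Z → ℝ) :=
      { carrier := {f | ∃ s : Z → ℝ≥0∞, Measurable s ∧ f = Config.laplace s}
        one_mem' := ⟨0, measurable_zero, by ext ϖ; simp [Config.laplace, expNeg_zero]⟩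
        mul_mem' := by
          rintro _ _ ⟨s, hs, rfl⟩ ⟨t, ht, rfl⟩
          exact ⟨s + t, hs.add ht, by ext ϖ; exact (laplace_mul hs ϖ).symm⟩ }
    have hMV : ∀ f ∈ Algebra.adjoin ℝ (M : Set (Config Z → ℝ)), p f := by
      intro f hf
      have hf' : f ∈ Submodule.span ℝ (M : Set (Config Z → ℝ)) := by
        rw [← Subalgebra.mem_toSubmodule, Algebra.adjoin_eq_span, Submonoid.closure_eq] at hf
        exact hf
      have : Submodule.span ℝ (M : Set (Config Z → ℝ)) ≤ V := by
        refine Submodule.span_le.2 ?_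
        rintro _ ⟨s, hs, rfl⟩
        exact laplace s hs
      exact this hf'
    let z : Set Z × ℕ∞ → Config Z → ℝ := fun c => Config.laplace (c.1.indicator 1)
    let a : Set Z × ℕ∞ → ℝ := fun c => (expNeg (c.2 : ℝ≥0∞)).toReal
    have hza : ∀ c ∈ J, ∀ ϖ, z c ϖ = a c ↔ (ϖ.1 ∩ c.1).encard = c.2 := by
      intro c hc ϖ
      have h1 : z c ϖ = (expNeg ((ϖ.1 ∩ c.1).encard : ℝ≥0∞)).toReal := by
        change (expNeg _).toReal = _
        rw [lintegral_indicator_one (hJ c hc), toMeasure_apply (hJ c hc)]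
      rw [h1, ENNReal.toReal_eq_toReal_iff' (ne_top_of_le_ne_top ENNReal.one_ne_top
        (expNeg_le_one _)) (ne_top_of_le_ne_top ENNReal.one_ne_top (expNeg_le_one _)),
        expNeg_injective.eq_iff]
      exact ENat.toENNReal_inj
    have ha : ∀ c, 0 ≤ a c ∧ a c ≤ 1 := fun c => ⟨ENNReal.toReal_nonneg,
      ENNReal.toReal_le_of_le_ofReal zero_le_one (by simpa using expNeg_le_one _)⟩
    have hw : ∀ c ϖ, 0 ≤ 1 - (z c ϖ - a c) ^ 2 ∧ 1 - (z c ϖ - a c) ^ 2 ≤ 1 := by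
      intro c ϖ
      have h1 := laplace_nonneg (c.1.indicator 1) ϖ
      have h2 := laplace_le_one (c.1.indicator 1) ϖ
      obtain ⟨h3, h4⟩ := ha c
      change 0 ≤ z c ϖ at h1
      change z c ϖ ≤ 1 at h2
      constructor <;> nlinarith
    refine lim (fun n => ∏ c ∈ J, (1 - (z c - fun _ => a c) ^ 2) ^ n) _ (fun n => hMV _ ?_)
      ⟨1, fun n ϖ => ?_⟩ fun ϖ => ?_
    · refine Subalgebra.prod_mem _ fun c hc => Subalgebra.pow_mem _
        (Subalgebra.sub_mem _ (Subalgebra.one_mem _) (Subalgebra.pow_mem _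
          (Subalgebra.sub_mem _ (Algebra.subset_adjoin (show z c ∈ (M : Set _) from
            ⟨c.1.indicator 1, measurable_one.indicator (hJ c hc), rfl⟩)) ?_) _)) _
      exact Subalgebra.algebraMap_mem _ (a c)
    · rw [Finset.prod_apply]
      change |∏ c ∈ J, (1 - (z c ϖ - a c) ^ 2) ^ n| ≤ 1
      rw [abs_of_nonneg (Finset.prod_nonneg fun c _ => pow_nonneg (hw c ϖ).1 n)]
      exact Finset.prod_le_one (fun c _ => pow_nonneg (hw c ϖ).1 n)
        fun c _ => pow_le_one₀ (hw c ϖ).1 (hw c ϖ).2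
    · by_cases h : ∀ c ∈ J, (ϖ.1 ∩ c.1).encard = c.2
      · rw [Set.indicator_of_mem (by exact h)]
        refine tendsto_const_nhds.congr fun n => ?_
        rw [Finset.prod_apply]
        refine (Finset.prod_eq_one fun c hc => ?_).symm
        have := (hza c hc ϖ).2 (h c hc)
        simp [this]
      · rw [Set.indicator_of_notMem (by exact h)]
        push Not at h
        obtain ⟨c, hc, hne⟩ := h
        have hne' : z c ϖ ≠ a c := fun h' => hne ((hza c hc ϖ).1 h')
        have hlt : 1 - (z c ϖ - a c) ^ 2 < 1 := by
          have : 0 < (z c ϖ - a c) ^ 2 := by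
            have := sub_ne_zero.2 hne'
            positivity
          linarith
        refine squeeze_zero (g := fun n => (1 - (z c ϖ - a c) ^ 2) ^ n) (fun n => ?_)
          (fun n => ?_) (tendsto_pow_atTop_nhds_zero_of_lt_one (hw c ϖ).1 hlt)
        · rw [Finset.prod_apply]
          exact Finset.prod_nonneg fun c _ => pow_nonneg (hw c ϖ).1 n
        · classical
          rw [Finset.prod_apply, ← Finset.mul_prod_erase _ _ hc]
          exact mul_le_of_le_one_right (pow_nonneg (hw c ϖ).1 n)
            (Finset.prod_le_one (fun c _ => pow_nonneg (hw c ϖ).1 n)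
            fun c _ => pow_le_one₀ (hw c ϖ).1 (hw c ϖ).2)
  | compl S hS ih =>
    have := add _ _ one (smul (-1) _ ih)
    convert this using 1
    ext ϖ
    by_cases h : ϖ ∈ S <;> simp [h]
  | iUnion S hdisj hS ih =>
    have hsum : ∀ n, p (∑ i ∈ Finset.range n, (S i).indicator 1) := by
      intro n
      induction n with
      | zero => simpa using zero
      | succ n ihn =>
        rw [Finset.sum_range_succ]
        exact add _ _ ihn (ih n)
    have hpart : ∀ n ϖ, (∑ i ∈ Finset.range n, (S i).indicator (1 : Config Z → ℝ)) ϖ =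
        (⋃ i ∈ Finset.range n, S i).indicator 1 ϖ := by
      intro n ϖ
      rw [Finset.sum_apply, Finset.indicator_biUnion_apply _ _ fun i _ j _ hij => hdisj hij]
    refine lim _ _ hsum ⟨1, fun n ϖ => ?_⟩ fun ϖ => ?_
    · rw [hpart]
      by_cases h : ϖ ∈ ⋃ i ∈ Finset.range n, S i
      · rw [Set.indicator_of_mem h, Pi.one_apply, abs_one]
      · rw [Set.indicator_of_notMem h, abs_zero]
        exact zero_le_one
    · by_cases h : ∃ i, ϖ ∈ S i
      · obtain ⟨i, hi⟩ := h
        rw [Set.indicator_of_mem (Set.mem_iUnion.2 ⟨i, hi⟩)]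
        refine tendsto_const_nhds.congr' ?_
        filter_upwards [eventually_gt_atTop i] with n hn
        rw [hpart, Set.indicator_of_mem]
        exact Set.mem_biUnion (Finset.mem_coe.2 (Finset.mem_range.2 hn)) hi
      · rw [Set.indicator_of_notMem fun h' => h (Set.mem_iUnion.1 h')]
        refine tendsto_const_nhds.congr fun n => ?_
        rw [hpart, Set.indicator_of_notMem]
        simp only [Set.mem_iUnion, not_exists]
        exact fun i _ hi => h ⟨i, hi⟩

end Basic

end Config

/-! ### The marked law -/

section MarkedLaw

variable {X Y : Type*} [MeasurableSpace X] [MeasurableSpace Y]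

namespace Config

theorem lintegral_toMeasure {Z : Type*} [MeasurableSpace Z] [MeasurableSingletonClass Z]
    (ϖ : Config Z) (f : Z → ℝ≥0∞) : ∫⁻ z, f z ∂ϖ.toMeasure = ∑' z : ϖ.1, f z := by
  rw [toMeasure, lintegral_sum_measure]
  exact tsum_congr fun z => lintegral_dirac _ _

theorem mark_injective (m : Config X) (u : m.1 → Y) :
    Function.Injective fun x : m.1 => ((x : X), u x) := fun _ _ h =>
  Subtype.ext (congrArg Prod.fst h)

theorem tsum_mark {E : Type*} [AddCommMonoid E] [TopologicalSpace E] (m : Config X)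
    (u : m.1 → Y) (f : X × Y → E) : ∑' z : (m.mark u).1, f z = ∑' x : m.1, f (x, u x) :=
  tsum_range f (mark_injective m u)

theorem lintegral_mark {m : Config X} {u : m.1 → Y} {f : X × Y → ℝ≥0∞} (hf : Measurable f) :
    ∫⁻ z, f z ∂(m.mark u).toMeasure = ∑' x : m.1, f (x, u x) := by
  rw [lintegral_toMeasure' hf, tsum_mark]

theorem measurable_mark (m : Config X) : Measurable (m.mark : (m.1 → Y) → Config (X × Y)) := by
  have : Countable m.1 := m.2.to_subtype
  refine measurable_of_toMeasure fun A hA => ?_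
  simp_rw [← lintegral_indicator_one hA, lintegral_mark (measurable_one.indicator hA)]
  refine Measurable.tsum fun x => ?_
  exact (measurable_one.indicator hA).comp (measurable_const.prodMk (measurable_pi_apply x))

theorem toMeasure_mark_prod_univ {m : Config X} {u : m.1 → Y} {A : Set X}
    (hA : MeasurableSet A) : (m.mark u).toMeasure (A ×ˢ Set.univ) = m.toMeasure A := by
  rw [← lintegral_indicator_one (hA.prod MeasurableSet.univ), lintegral_mark
    (measurable_one.indicator (hA.prod MeasurableSet.univ)), ← lintegral_indicator_one hA,
    lintegral_toMeasure' (measurable_one.indicator hA)]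
  refine tsum_congr fun x => ?_
  by_cases hx : (x : X) ∈ A <;> simp [hx]

end Config

variable {μ : Measure Y} [IsProbabilityMeasure μ]

/-- Conditional Laplace functional. For finitely many points the integral factors by independence;
the formula passes to the limit along the finite subsets of m, all integrands being at most 1. -/
theorem lintegral_expNeg_marks (m : Config X) {s : X × Y → ℝ≥0∞} (hs : Measurable s) :
    ∫⁻ u, expNeg (∫⁻ z, s z ∂(m.mark u).toMeasure) ∂marksLaw μ m.1 =
      expNeg (∫⁻ x, logNeg (∫⁻ v, expNeg (s (x, v)) ∂μ) ∂m.toMeasure) := by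
  have : Countable m.1 := m.2.to_subtype
  have hsx : ∀ x : m.1, Measurable fun v => expNeg (s (x, v)) := fun x =>
    measurable_expNeg.comp (hs.comp measurable_prodMk_left)
  have hint : Measurable fun x : X => ∫⁻ v, expNeg (s (x, v)) ∂μ :=
    Measurable.lintegral_prod_right' (f := fun z : X × Y => expNeg (s z))
      (measurable_expNeg.comp hs)
  have hle : ∀ x, ∫⁻ v, expNeg (s (x, v)) ∂μ ≤ 1 := fun x => by
    refine (lintegral_mono fun v => expNeg_le_one _).trans ?_
    simp
  rw [Config.lintegral_toMeasure' (f := fun x : X => logNeg (∫⁻ v, expNeg (s (x, v)) ∂μ))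
    (measurable_logNeg.comp hint)]
  simp_rw [Config.lintegral_mark hs]
  refine tendsto_nhds_unique (f := fun t : Finset m.1 =>
    ∫⁻ u, ∏ x ∈ t, expNeg (s (x, u x)) ∂marksLaw μ m.1) (l := atTop) ?_ ?_
  · refine tendsto_lintegral_filter_of_dominated_convergence (fun _ => 1)
      (Eventually.of_forall fun t => ?_)
      (Eventually.of_forall fun t => ae_of_all _ fun u => ?_) (by simp)
      (ae_of_all _ fun u => tendsto_prod_expNeg fun x : m.1 => s (x, u x))
    · exact Finset.measurable_fun_prod _ fun x _ => (hsx x).comp (measurable_pi_apply x)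
    · exact Finset.prod_le_one' fun x _ => expNeg_le_one _
  · have h := tendsto_prod_expNeg fun x : m.1 => logNeg (∫⁻ v, expNeg (s (x, v)) ∂μ)
    refine h.congr fun t => ?_
    rw [lintegral_prod_marks t (f := fun (x : m.1) v => expNeg (s (x, v))) hsx]
    exact Finset.prod_congr rfl fun x _ => expNeg_logNeg (hle x)

variable (μ) in
/-- The law of the marked configuration, given the configuration `m`. -/
def condLaw (m : Config X) : Measure (Config (X × Y)) := (marksLaw μ m.1).map m.mark

instance (m : Config X) : IsProbabilityMeasure (condLaw μ m) :=
  Measure.isProbabilityMeasure_map (Config.measurable_mark m).aemeasurable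

theorem lintegral_condLaw {m : Config X} {f : Config (X × Y) → ℝ≥0∞} (hf : Measurable f) :
    ∫⁻ ϖ, f ϖ ∂condLaw μ m = ∫⁻ u, f (m.mark u) ∂marksLaw μ m.1 :=
  lintegral_map hf (Config.measurable_mark m)

theorem integrable_of_bounded {α : Type*} [MeasurableSpace α] {ν : Measure α} [IsFiniteMeasure ν]
    {f : α → ℝ} (hf : Measurable f) {C : ℝ} (hC : ∀ a, |f a| ≤ C) : Integrable f ν :=
  Integrable.of_bound hf.aestronglyMeasurable C (ae_of_all _ hC)

/-- This is what gives the mixture `markedLaw` its meaning. For a Laplace functional the conditional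
expectation is again a Laplace functional, now of m, hence measurable; the bounded functions with
measurable conditional expectation are stable under linear combinations and bounded limits. -/
theorem measurable_condLaw : Measurable (condLaw μ : Config X → Measure (Config (X × Y))) := by
  refine Measure.measurable_of_measurable_coe _ fun S hS => ?_
  have key := Config.induction_laplace (Z := X × Y) (p := fun f => Measurable f ∧
    (∃ C, ∀ ϖ, |f ϖ| ≤ C) ∧ Measurable fun m : Config X => ∫ ϖ, f ϖ ∂condLaw μ m)
    ?_ ?_ ?_ ?_ hS
  · have h := key.2.2.ennreal_ofReal
    convert h using 2 with m
    rw [integral_indicator_one hS, ofReal_measureReal]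
  · intro s hs
    refine ⟨Config.measurable_laplace hs, ⟨1, fun ϖ => ?_⟩, ?_⟩
    · rw [abs_of_nonneg (Config.laplace_nonneg s ϖ)]
      exact Config.laplace_le_one s ϖ
    · have : ∀ m : Config X, ∫ ϖ, Config.laplace s ϖ ∂condLaw μ m =
          (expNeg (∫⁻ x, logNeg (∫⁻ v, expNeg (s (x, v)) ∂μ) ∂m.toMeasure)).toReal := by
        intro m
        rw [← lintegral_expNeg_marks m hs, ← lintegral_condLaw (f := fun ϖ =>
          expNeg (∫⁻ z, s z ∂ϖ.toMeasure)) (measurable_expNeg.comp (Config.measurable_lintegral hs))]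
        refine integral_toReal
          (measurable_expNeg.comp (Config.measurable_lintegral hs)).aemeasurable ?_
        exact ae_of_all _ fun ϖ => (expNeg_le_one _).trans_lt ENNReal.one_lt_top
      simp_rw [this]
      refine (measurable_expNeg.comp (Config.measurable_lintegral ?_)).ennreal_toReal
      exact measurable_logNeg.comp (Measurable.lintegral_prod_right'
        (f := fun z : X × Y => expNeg (s z)) (measurable_expNeg.comp hs))
  · rintro f g ⟨hf, ⟨C, hC⟩, hf'⟩ ⟨hg, ⟨D, hD⟩, hg'⟩
    refine ⟨hf.add hg, ⟨C + D, fun ϖ => (abs_add_le _ _).trans (add_le_add (hC ϖ) (hD ϖ))⟩, ?_⟩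
    have : ∀ m : Config X, ∫ ϖ, (f + g) ϖ ∂condLaw μ m =
        ∫ ϖ, f ϖ ∂condLaw μ m + ∫ ϖ, g ϖ ∂condLaw μ m := fun m =>
      integral_add (integrable_of_bounded hf hC) (integrable_of_bounded hg hD)
    simp_rw [this]
    exact hf'.add hg'
  · rintro c f ⟨hf, ⟨C, hC⟩, hf'⟩
    refine ⟨hf.const_smul c, ⟨|c| * C, fun ϖ => ?_⟩, ?_⟩
    · rw [Pi.smul_apply, smul_eq_mul, abs_mul]
      exact mul_le_mul_of_nonneg_left (hC ϖ) (abs_nonneg c)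
    · have : ∀ m : Config X, ∫ ϖ, (c • f) ϖ ∂condLaw μ m = c * ∫ ϖ, f ϖ ∂condLaw μ m := fun m =>
        integral_const_mul c f
      simp_rw [this]
      exact hf'.const_mul c
  · rintro F f hF ⟨C, hC⟩ hl
    have hf : Measurable f := measurable_of_tendsto_metrizable (fun n => (hF n).1)
      (tendsto_pi_nhds.2 hl)
    refine ⟨hf, ⟨C, fun ϖ => le_of_tendsto' (hl ϖ).abs fun n => hC n ϖ⟩, ?_⟩
    refine measurable_of_tendsto_metrizable (fun n => (hF n).2.2) (tendsto_pi_nhds.2 fun m => ?_)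
    exact tendsto_integral_of_dominated_convergence (fun _ => C)
      (fun n => (hF n).1.aestronglyMeasurable) (integrable_const C)
      (fun n => ae_of_all _ (hC n)) (ae_of_all _ hl)

variable {Q : Measure (Config X)}

theorem markedLaw_eq : markedLaw Q μ = Q.bind (condLaw μ) := rfl

theorem isProbabilityMeasure_markedLaw [IsProbabilityMeasure Q] :
    IsProbabilityMeasure (markedLaw Q μ) := by
  refine ⟨?_⟩
  rw [markedLaw_eq, Measure.bind_apply MeasurableSet.univ measurable_condLaw.aemeasurable]
  simp

theorem ae_ae_of_ae_markedLaw {p : Config (X × Y) → Prop} (h : ∀ᵐ ϖ ∂markedLaw Q μ, p ϖ) :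
    ∀ᵐ m ∂Q, ∀ᵐ u ∂marksLaw μ m.1, p (m.mark u) := by
  have := Measure.ae_ae_of_ae_bind measurable_condLaw.aemeasurable h
  filter_upwards [this] with m hm
  exact ae_of_ae_map (Config.measurable_mark m).aemeasurable hm

theorem lintegral_markedLaw {f : Config (X × Y) → ℝ≥0∞} (hf : AEMeasurable f (markedLaw Q μ)) :
    ∫⁻ ϖ, f ϖ ∂markedLaw Q μ = ∫⁻ m, ∫⁻ u, f (m.mark u) ∂marksLaw μ m.1 ∂Q := by
  obtain ⟨g, hg, hfg⟩ := hf
  rw [lintegral_congr_ae hfg, markedLaw_eq,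
    Measure.lintegral_bind measurable_condLaw.aemeasurable hg.aemeasurable]
  refine lintegral_congr_ae ?_
  filter_upwards [ae_ae_of_ae_markedLaw hfg] with m hm
  rw [lintegral_condLaw hg]
  exact lintegral_congr_ae (hm.mono fun u hu => hu.symm)

theorem aemeasurable_lintegral_marks {f : Config (X × Y) → ℝ≥0∞}
    (hf : AEMeasurable f (markedLaw Q μ)) :
    AEMeasurable (fun m : Config X => ∫⁻ u, f (m.mark u) ∂marksLaw μ m.1) Q := by
  obtain ⟨g, hg, hfg⟩ := hf
  refine ⟨fun m => ∫⁻ ϖ, g ϖ ∂condLaw μ m,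
    (Measure.measurable_lintegral hg).comp measurable_condLaw, ?_⟩
  filter_upwards [ae_ae_of_ae_markedLaw hfg] with m hm
  rw [lintegral_condLaw hg]
  exact lintegral_congr_ae hm

/-- The converse of `ae_ae_of_ae_markedLaw`. Its measurability requirement is the reason why Γ[F]
must be constructed as a measurable function of the configuration, not merely for each m. -/
theorem ae_markedLaw_of_ae_ae {s : Set (Config (X × Y))}
    (hs : NullMeasurableSet s (markedLaw Q μ))
    (h : ∀ᵐ m ∂Q, ∀ᵐ u ∂marksLaw μ m.1, m.mark u ∈ s) : ∀ᵐ ϖ ∂markedLaw Q μ, ϖ ∈ s := by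
  have h1 : ∫⁻ ϖ, sᶜ.indicator (fun _ => 1) ϖ ∂markedLaw Q μ = 0 := by
    rw [lintegral_markedLaw (aemeasurable_const.indicator₀ hs.compl)]
    refine (lintegral_congr_ae ?_).trans lintegral_zero
    filter_upwards [h] with m hm
    refine (lintegral_congr_ae ?_).trans lintegral_zero
    filter_upwards [hm] with u hu
    exact Set.indicator_of_notMem (Set.notMem_compl_iff.2 hu) _
  rwa [lintegral_indicator_const₀ hs.compl, one_mul] at h1

theorem aestronglyMeasurable_mark {f : Config (X × Y) → ℝ}
    (hf : AEStronglyMeasurable f (markedLaw Q μ)) :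
    ∀ᵐ m ∂Q, AEStronglyMeasurable (fun u => f (m.mark u)) (marksLaw μ m.1) := by
  obtain ⟨g, hg, hfg⟩ := hf
  filter_upwards [ae_ae_of_ae_markedLaw hfg] with m hm
  exact ⟨fun u => g (m.mark u), hg.comp_measurable (Config.measurable_mark m), hm⟩

theorem integrable_mark {f : Config (X × Y) → ℝ} (hf : Integrable f (markedLaw Q μ)) :
    ∀ᵐ m ∂Q, Integrable (fun u => f (m.mark u)) (marksLaw μ m.1) := by
  have h1 := hf.2
  rw [HasFiniteIntegral, lintegral_markedLaw hf.1.enorm] at h1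
  filter_upwards [aestronglyMeasurable_mark hf.1,
    ae_lt_top' (aemeasurable_lintegral_marks hf.1.enorm) h1.ne] with m h2 h3
  exact ⟨h2, h3⟩

/-- Positive and negative parts are disintegrated separately as Lebesgue integrals and compared for
each m. -/
theorem integral_markedLaw_nonneg {f : Config (X × Y) → ℝ} (hf : Integrable f (markedLaw Q μ))
    (h : ∀ᵐ m ∂Q, 0 ≤ ∫ u, f (m.mark u) ∂marksLaw μ m.1) :
    0 ≤ ∫ ϖ, f ϖ ∂markedLaw Q μ := by
  have hp := hf.1.aemeasurable.ennreal_ofReal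
  have hn := hf.1.aemeasurable.neg.ennreal_ofReal
  rw [integral_eq_lintegral_pos_part_sub_lintegral_neg_part hf, sub_nonneg]
  refine ENNReal.toReal_mono (hf.lintegral_lt_top).ne ?_
  have e1 := lintegral_markedLaw hp
  have e2 := lintegral_markedLaw hn
  simp only [Pi.neg_apply] at e2
  rw [e1, e2]
  refine lintegral_mono_ae ?_
  filter_upwards [h, integrable_mark hf] with m hm hi
  rw [integral_eq_lintegral_pos_part_sub_lintegral_neg_part hi, sub_nonneg] at hm
  exact (ENNReal.toReal_le_toReal hi.neg.lintegral_lt_top.ne hi.lintegral_lt_top.ne).1 hm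

end MarkedLaw

/-! ### Measurable functions of a configuration depend on countably many countings -/

namespace Config

section CountMap

variable {Z : Type*} [MeasurableSpace Z]

/-- The countings of a sequence of sets. -/
def countMap (C : ℕ → Set Z) (ϖ : Config Z) : ℕ → ℕ∞ := fun j => (ϖ.1 ∩ C j).encard

theorem measurable_countMap {C : ℕ → Set Z} (hC : ∀ j, MeasurableSet (C j)) :
    Measurable (countMap C) :=
  measurable_pi_iff.2 fun j => measurable_encard (hC j)

/-- The contribution of a point to the countings. -/
def pointCount (C : ℕ → Set Z) (z : Z) : ℕ → ℕ∞ := fun j => (C j).indicator 1 z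

theorem measurable_pointCount {C : ℕ → Set Z} (hC : ∀ j, MeasurableSet (C j)) :
    Measurable (pointCount C) :=
  measurable_pi_iff.2 fun j => measurable_one.indicator (hC j)

theorem countMap_add (C : ℕ → Set Z) {ϖ : Config Z} {z : Z} (hz : z ∉ ϖ.1) :
    countMap C (ϖ.add z) = countMap C ϖ + pointCount C z := by
  ext1 j
  change (insert z ϖ.1 ∩ C j).encard = (ϖ.1 ∩ C j).encard + (C j).indicator 1 z
  by_cases h : z ∈ C j
  · rw [Set.insert_inter_of_mem h, Set.encard_insert_of_notMem fun h' => hz h'.1,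
      Set.indicator_of_mem h]
    rfl
  · rw [Set.insert_inter_of_notMem h, Set.indicator_of_notMem h, add_zero]

theorem add_remove {ϖ : Config Z} {z : Z} (hz : z ∈ ϖ.1) : (ϖ.remove z).add z = ϖ :=
  Subtype.ext (Set.insert_sdiff_self_of_mem hz)

theorem notMem_remove (ϖ : Config Z) (z : Z) : z ∉ (ϖ.remove z).1 := fun h => h.2 rfl

theorem countMap_remove (C : ℕ → Set Z) {ϖ : Config Z} {z : Z} (hz : z ∈ ϖ.1) :
    countMap C (ϖ.remove z) = countMap C ϖ - pointCount C z := by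
  have h := countMap_add C (notMem_remove ϖ z)
  rw [add_remove hz] at h
  rw [h]
  ext1 j
  change (_ : ℕ∞) = _ + (C j).indicator (1 : Z → ℕ∞) z - (C j).indicator (1 : Z → ℕ∞) z
  -- Truncated subtraction is exact even at infinite countings, because the amount removed is 0 or
  -- 1.
  refine (ENat.addLECancellable_of_ne_top ?_).add_tsub_cancel_right.symm
  by_cases hj : z ∈ C j <;> simp [hj]

theorem encard_remove_ne_top {ϖ : Config Z} {z : Z} {B : Set Z} :
    ((ϖ.remove z).1 ∩ B).encard ≠ ⊤ ↔ (ϖ.1 ∩ B).encard ≠ ⊤ := by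
  rw [Set.encard_ne_top_iff, Set.encard_ne_top_iff]
  constructor
  · intro h
    refine (h.insert z).subset fun y hy => ?_
    by_cases hyz : y = z
    · exact Or.inl hyz
    · exact Or.inr ⟨⟨hy.1, hyz⟩, hy.2⟩
  · exact fun h => h.subset fun y hy => ⟨hy.1.1, hy.2⟩

theorem comap_countMap_le {C D : ℕ → Set Z} (e : ℕ → ℕ) (h : ∀ j, C j = D (e j)) :
    MeasurableSpace.comap (countMap C) inferInstance ≤
      MeasurableSpace.comap (countMap D) inferInstance := by
  have : countMap C = (fun (f : ℕ → ℕ∞) j => f (e j)) ∘ countMap D := by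
    funext ϖ j
    simp [countMap, h]
  rw [this, ← MeasurableSpace.comap_comp]
  refine MeasurableSpace.comap_mono (measurable_iff_comap_le.1 ?_)
  exact measurable_pi_iff.2 fun j => measurable_pi_apply (e j)

theorem exists_countMap_family (C : ℕ → ℕ → Set Z) (hC : ∀ i j, MeasurableSet (C i j)) :
    ∃ D : ℕ → Set Z, (∀ j, MeasurableSet (D j)) ∧
      ∀ i, MeasurableSpace.comap (countMap (C i)) inferInstance ≤
        MeasurableSpace.comap (countMap D) inferInstance :=
  ⟨fun n => C n.unpair.1 n.unpair.2, fun n => hC _ _,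
    fun i => comap_countMap_le (fun j => Nat.pair i j) fun j => by simp⟩

/-- The sets determined by some sequence of countings form a σ-field: a sequence of sequences is
merged into one by pairing indices. -/
theorem exists_countMap_measurableSet {S : Set (Config Z)} (hS : MeasurableSet S) :
    ∃ C : ℕ → Set Z, (∀ j, MeasurableSet (C j)) ∧
      MeasurableSet[MeasurableSpace.comap (countMap C) inferInstance] S := by
  let 𝒢 : MeasurableSpace (Config Z) :=
    { MeasurableSet' := fun S => ∃ C : ℕ → Set Z, (∀ j, MeasurableSet (C j)) ∧
        MeasurableSet[MeasurableSpace.comap (countMap C) inferInstance] S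
      measurableSet_empty := ⟨fun _ => ∅, fun _ => MeasurableSet.empty,
        @MeasurableSet.empty _ (MeasurableSpace.comap _ _)⟩
      measurableSet_compl := by
        rintro S ⟨C, hC, h⟩
        exact ⟨C, hC, @MeasurableSet.compl _ _ (MeasurableSpace.comap _ _) h⟩
      measurableSet_iUnion := by
        intro S h
        choose C hC h using h
        obtain ⟨D, hD, hCD⟩ := exists_countMap_family C hC
        exact ⟨D, hD, @MeasurableSet.iUnion _ _ (MeasurableSpace.comap _ _) _ _
          fun i => hCD i _ (h i)⟩ }
  have hle : (instMeasurableSpace : MeasurableSpace (Config Z)) ≤ 𝒢 := by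
    refine iSup₂_le fun A hA => ?_
    rintro _ ⟨T, -, rfl⟩
    refine ⟨fun _ => A, fun _ => hA, ⟨(fun f : ℕ → ℕ∞ => f 0) ⁻¹' T, ?_, rfl⟩⟩
    exact measurable_pi_apply 0 (MeasurableSet.of_discrete)
  exact hle S hS

theorem exists_eq_comp_countMap {F : Config Z → ℝ} (hF : Measurable F) :
    ∃ C : ℕ → Set Z, (∀ j, MeasurableSet (C j)) ∧
      ∃ φ : (ℕ → ℕ∞) → ℝ, Measurable φ ∧ F = φ ∘ countMap C := by
  choose C hC h using fun n => exists_countMap_measurableSet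
    (hF (MeasurableSpace.measurableSet_natGeneratingSequence (α := ℝ) n))
  obtain ⟨D, hD, hCD⟩ := exists_countMap_family C hC
  refine ⟨D, hD, ?_⟩
  refine Measurable.exists_eq_measurable_comp ?_
  have : @Measurable _ _ (MeasurableSpace.comap (countMap D) inferInstance)
      (MeasurableSpace.generateFrom (Set.range (MeasurableSpace.natGeneratingSequence ℝ))) F := by
    refine @measurable_generateFrom _ _ (MeasurableSpace.comap (countMap D) inferInstance) _ _ ?_
    rintro _ ⟨n, rfl⟩
    exact hCD n _ (h n)
  rwa [MeasurableSpace.generateFrom_natGeneratingSequence] at this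

end CountMap

/-! ### Sums over the points lying in sets of finite counting -/

section FiniteSets

variable {Z : Type*} [MeasurableSpace Z]

/-- The point `z` lies in one of the sets `A i` containing finitely many points of `ϖ`. -/
def InFiniteSet (A : ℕ → Set Z) (ϖ : Config Z) (z : Z) : Prop :=
  ∃ i, z ∈ A i ∧ (ϖ.1 ∩ A i).encard ≠ ⊤

/-- The counting kernel. -/
def countKernel (Z : Type*) [MeasurableSpace Z] : ProbabilityTheory.Kernel (Config Z) Z where
  toFun := toMeasure
  measurable' := measurable_toMeasure

/-- Point measures need not form an s-finite kernel, so measurability of parameter integrals is not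
automatic. Restricted to `A`, on the event that `A` contains exactly `n` points, the kernel is
finite. -/
theorem measurable_lintegral_of_finite {A : Set Z} (hA : MeasurableSet A) (n : ℕ)
    {k : Config Z × Z → ℝ≥0∞} (hk : Measurable k)
    (hk0 : ∀ ϖ z, k (ϖ, z) ≠ 0 → z ∈ A ∧ (ϖ.1 ∩ A).encard = n) :
    Measurable fun ϖ : Config Z => ∫⁻ z, k (ϖ, z) ∂ϖ.toMeasure := by
  classical
  have hs : MeasurableSet {ϖ : Config Z | (ϖ.1 ∩ A).encard = n} :=
    measurable_encard hA (measurableSet_singleton (n : ℕ∞))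
  let κ : ProbabilityTheory.Kernel (Config Z) Z :=
    ProbabilityTheory.Kernel.piecewise hs ((countKernel Z).restrict hA) 0
  have hκ : ProbabilityTheory.IsFiniteKernel κ := by
    refine ⟨⟨n, ENNReal.natCast_lt_top n, fun ϖ => ?_⟩⟩
    rw [ProbabilityTheory.Kernel.piecewise_apply']
    split_ifs with h
    · rw [ProbabilityTheory.Kernel.restrict_apply, Measure.restrict_apply_univ]
      change ϖ.toMeasure A ≤ n
      rw [toMeasure_apply hA]
      have : (ϖ.1 ∩ A).encard = n := h
      rw [this]
      simp
    · simp
  have : (fun ϖ : Config Z => ∫⁻ z, k (ϖ, z) ∂ϖ.toMeasure) =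
      fun ϖ => ∫⁻ z, k (ϖ, z) ∂κ ϖ := by
    funext ϖ
    rw [ProbabilityTheory.Kernel.piecewise_apply]
    split_ifs with h
    · rw [ProbabilityTheory.Kernel.restrict_apply]
      change _ = ∫⁻ z in A, k (ϖ, z) ∂ϖ.toMeasure
      rw [← lintegral_indicator hA]
      refine lintegral_congr fun z => ?_
      by_cases hz : z ∈ A
      · rw [Set.indicator_of_mem hz]
      · rw [Set.indicator_of_notMem hz]
        by_contra hne
        exact hz (hk0 ϖ z hne).1
    · have h0 : ∀ z, k (ϖ, z) = 0 := fun z => by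
        by_contra hne
        exact h (hk0 ϖ z hne).2
      simp [h0]
  rw [this]
  exact hk.lintegral_kernel_prod_right'

open Classical in
theorem measurable_lintegral_inFiniteSet {A : ℕ → Set Z} (hA : ∀ i, MeasurableSet (A i))
    {k : Config Z × Z → ℝ≥0∞} (hk : Measurable k) :
    Measurable fun ϖ : Config Z =>
      ∫⁻ z, (if InFiniteSet A ϖ z then k (ϖ, z) else 0) ∂ϖ.toMeasure := by
  let G : ℕ → Set (Config Z × Z) := fun i => {q | q.2 ∈ A i ∧ (q.1.1 ∩ A i).encard ≠ ⊤}
  have henc : ∀ i, Measurable fun q : Config Z × Z => (q.1.1 ∩ A i).encard := fun i =>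
    (measurable_encard (hA i)).comp measurable_fst
  have hG : ∀ i, MeasurableSet (G i) := fun i =>
    (measurable_snd (hA i)).inter (henc i (MeasurableSet.of_discrete (s := {⊤}ᶜ)))
  -- Each point is assigned to the first admissible set, so that it is counted once; `E` further
  -- splits according to the number of points in that set.
  let D : ℕ → Set (Config Z × Z) := disjointed G
  have hD : ∀ i, MeasurableSet (D i) := fun i => MeasurableSet.disjointed hG i
  let E : ℕ × ℕ → Set (Config Z × Z) := fun r => D r.1 ∩ {q | (q.1.1 ∩ A r.1).encard = r.2}
  have hE : ∀ r, MeasurableSet (E r) := fun r =>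
    (hD r.1).inter (henc r.1 (measurableSet_singleton (r.2 : ℕ∞)))
  have hsum : ∀ ϖ z, (if InFiniteSet A ϖ z then k (ϖ, z) else 0) =
      ∑' r, (E r).indicator k (ϖ, z) := by
    intro ϖ z
    split_ifs with h
    · have hU : (ϖ, z) ∈ ⋃ i, D i := by
        rw [iUnion_disjointed]
        exact Set.mem_iUnion.2 h
      obtain ⟨i, hi⟩ := Set.mem_iUnion.1 hU
      have hi' : (ϖ, z) ∈ G i := disjointed_subset G i hi
      obtain ⟨n, hn⟩ := ENat.ne_top_iff_exists.1 hi'.2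
      rw [tsum_eq_single (i, n)]
      · rw [Set.indicator_of_mem (show (ϖ, z) ∈ E (i, n) from ⟨hi, hn.symm⟩)]
      · rintro ⟨i', n'⟩ hne
        refine Set.indicator_of_notMem ?_ _
        rintro ⟨h1, h2⟩
        have hii : i' = i := by
          by_contra hne'
          exact Set.disjoint_left.1 (disjoint_disjointed G hne') h1 hi
        subst hii
        have h3 : (ϖ.1 ∩ A i').encard = n' := h2
        rw [← hn] at h3
        exact hne (by rw [Nat.cast_inj.1 h3])
    · refine (ENNReal.tsum_eq_zero.2 fun r => Set.indicator_of_notMem (fun hr => h ?_) _).symm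
      exact ⟨r.1, disjointed_subset G r.1 hr.1⟩
  simp_rw [hsum]
  have hms : ∀ ϖ : Config Z, ∀ r, Measurable fun z => (E r).indicator k (ϖ, z) := fun ϖ r =>
    (hk.indicator (hE r)).comp measurable_prodMk_left
  simp_rw [lintegral_tsum fun r => (hms _ r).aemeasurable]
  refine Measurable.tsum fun r => ?_
  refine measurable_lintegral_of_finite (hA r.1) r.2 (hk.indicator (hE r)) fun ϖ z hne => ?_
  have hm : (ϖ, z) ∈ E r := by
    by_contra h
    exact hne (Set.indicator_of_notMem h _)
  exact ⟨(disjointed_subset G r.1 hm.1).1, hm.2⟩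

end FiniteSets

/-! ### Marked configurations: changing one mark, and infinitely many marks in a set -/

section Mark

variable {X Y : Type*} [MeasurableSpace X] [MeasurableSpace Y] {μ : Measure Y}
  [IsProbabilityMeasure μ]

theorem mem_mark (m : Config X) (u : m.1 → Y) (x : m.1) : ((x : X), u x) ∈ (m.mark u).1 :=
  ⟨x, rfl⟩

/-- Only one point lies above `x`, so removing it forgets its mark. This is why a function of the
configuration without that point is constant along the fibre. -/
theorem remove_mark_update (m : Config X) [DecidableEq m.1] (u : m.1 → Y) (x : m.1) (v : Y) :
    (m.mark (Function.update u x v)).remove ((x : X), v) = (m.mark u).remove ((x : X), u x) := by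
  refine Subtype.ext (Set.ext fun z => ?_)
  constructor
  · rintro ⟨⟨y, rfl⟩, hy⟩
    have hyx : y ≠ x := by
      rintro rfl
      exact hy (by simp)
    simp only [Function.update_of_ne hyx]
    refine ⟨⟨y, rfl⟩, fun h => hyx (Subtype.ext (congrArg Prod.fst h))⟩
  · rintro ⟨⟨y, rfl⟩, hy⟩
    have hyx : y ≠ x := by
      rintro rfl
      exact hy rfl
    refine ⟨⟨y, by simp [Function.update_of_ne hyx]⟩, fun h => hyx (Subtype.ext (congrArg Prod.fst h))⟩

theorem add_remove_mark (m : Config X) [DecidableEq m.1] (u : m.1 → Y) (x : m.1) (v : Y) :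
    ((m.mark u).remove ((x : X), u x)).add ((x : X), v) = m.mark (Function.update u x v) := by
  rw [← remove_mark_update m u x v]
  refine add_remove ?_
  have := mem_mark m (Function.update u x v) x
  rwa [Function.update_self] at this

theorem notMem_remove_mark (m : Config X) (u : m.1 → Y) (x : m.1) (v : Y) :
    ((x : X), v) ∉ ((m.mark u).remove ((x : X), u x)).1 := by
  rintro ⟨⟨y, hy⟩, hne⟩
  have hyx : y = x := Subtype.ext (congrArg Prod.fst hy)
  subst hyx
  exact hne hy.symm

theorem encard_mark_prod_univ (m : Config X) (u : m.1 → Y) (A : Set X) :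
    ((m.mark u).1 ∩ A ×ˢ Set.univ).encard = (m.1 ∩ A).encard := by
  have hinj : Set.InjOn (Prod.fst : X × Y → X) ((m.mark u).1 ∩ A ×ˢ Set.univ) := by
    rintro _ ⟨⟨x, rfl⟩, -⟩ _ ⟨⟨y, rfl⟩, -⟩ h
    have : x = y := Subtype.ext h
    rw [this]
  rw [← hinj.encard_image]
  congr 1
  ext x
  constructor
  · rintro ⟨_, ⟨⟨y, rfl⟩, hy⟩, rfl⟩
    exact ⟨y.2, hy.1⟩
  · rintro ⟨hx, hxA⟩
    exact ⟨(x, u ⟨x, hx⟩), ⟨⟨⟨x, hx⟩, rfl⟩, ⟨hxA, trivial⟩⟩, rfl⟩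

/-- The second Borel–Cantelli lemma for marks. -/
theorem ae_encard_mark_eq_top {m : Config X} {C : Set (X × Y)} (hC : MeasurableSet C)
    {B : Set X} {ε : ℝ≥0∞} (hε : ε ≠ 0)
    (hB : ∀ x ∈ B, ε ≤ μ {v | (x, v) ∈ C}) (hinf : (m.1 ∩ B).encard = ⊤) :
    ∀ᵐ u ∂marksLaw μ m.1, ((m.mark u).1 ∩ C).encard = ⊤ := by
  classical
  have : Countable m.1 := m.2.to_subtype
  have hCx : ∀ x : X, MeasurableSet {v | (x, v) ∈ C} := fun x => measurable_prodMk_left hC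
  -- It suffices that, for each of the countably many finite sets `T`, some point outside `T` has
  -- its mark in `C`. Failure has probability at most (1 - ε)ⁿ for every n, as infinitely many
  -- points of `B` are left.
  have key : ∀ T : Finset m.1, ∀ᵐ u ∂marksLaw μ m.1, ∃ x ∉ T, ((x : X), u x) ∈ C := by
    intro T
    have hBi : {x : m.1 | (x : X) ∈ B}.Infinite := by
      intro hf
      have hf' := hf.image (Subtype.val : m.1 → X)
      refine (Set.encard_eq_top_iff.1 hinf) (hf'.subset ?_)
      rintro x ⟨hx, hxB⟩
      exact ⟨⟨x, hx⟩, hxB, rfl⟩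
    have hBT : ({x : m.1 | (x : X) ∈ B} \ T).Infinite := hBi.sdiff T.finite_toSet
    have hε1 : 1 - ε < 1 := ENNReal.sub_lt_self ENNReal.one_ne_top one_ne_zero hε
    have hle : ∀ n : ℕ, marksLaw μ m.1 {u | ¬ ∃ x ∉ T, ((x : X), u x) ∈ C} ≤ (1 - ε) ^ n := by
      intro n
      obtain ⟨s, hs, hsn⟩ := hBT.exists_subset_card_eq n
      calc marksLaw μ m.1 {u | ¬ ∃ x ∉ T, ((x : X), u x) ∈ C}
          ≤ marksLaw μ m.1 ((s : Set m.1).pi fun x => {v | ((x : X), v) ∈ C}ᶜ) := by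
            refine measure_mono fun u hu x hx hxC => hu ⟨x, (hs hx).2, hxC⟩
        _ = ∏ x ∈ s, μ {v | ((x : X), v) ∈ C}ᶜ := marksLaw_pi _ fun x _ => (hCx x).compl
        _ ≤ ∏ _x ∈ s, (1 - ε) := by
            refine Finset.prod_le_prod' fun x hx => ?_
            rw [prob_compl_eq_one_sub (hCx x)]
            exact tsub_le_tsub_left (hB x (hs hx).1) 1
        _ = (1 - ε) ^ n := by rw [Finset.prod_const, hsn]
    exact le_antisymm (ge_of_tendsto' (ENNReal.tendsto_pow_atTop_nhds_zero_of_lt_one hε1) hle)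
      zero_le
  filter_upwards [ae_all_iff.2 key] with u hu
  rw [Set.encard_eq_top_iff]
  intro hf
  have hf' : {x : m.1 | ((x : X), u x) ∈ C}.Finite := by
    refine Set.Finite.subset (hf.preimage (mark_injective m u).injOn) fun x hx => ?_
    exact ⟨mem_mark m u x, hx⟩
  obtain ⟨x, hx, hxC⟩ := hu hf'.toFinset
  exact hx (hf'.mem_toFinset.2 hxC)

end Mark

end Config

/-! ### Versions of the carré du champ in one mark -/

section Version

variable {X Y : Type*} [MeasurableSpace X] [MeasurableSingletonClass X]
  [MeasurableSpace Y] [MeasurableSingletonClass Y] {μ : Measure Y} [IsProbabilityMeasure μ]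
  {d : Set (Lp ℝ 2 μ)} {γ : Lp ℝ 2 μ → Lp ℝ 2 μ → Lp ℝ 1 μ}

theorem IsLocalForm.hasCdc_const (hd : IsLocalForm μ d γ) {f : Y → ℝ} {c : ℝ}
    (hf : ∃ a ∈ d, a =ᵐ[μ] f) (hc : f =ᵐ[μ] fun _ => c) : HasCdc d γ f f fun _ => 0 := by
  obtain ⟨a, ha, haf⟩ := hf
  refine ⟨a, ha, a, ha, haf, haf, ?_⟩
  rw [hd.cdc_const ha (haf.trans hc)]
  exact Lp.coeFn_zero ℝ 1 μ

open Classical in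
/-- A version of `γ[ε⁺F]` for which the integral in the lent particle formula is measurable. -/
theorem IsLocalForm.exists_cdc_version (hd : IsLocalForm μ d γ) {F : Config (X × Y) → ℝ}
    (hF : Measurable F) :
    ∃ K : Config (X × Y) → X × Y → ℝ, (∀ ϖ z, 0 ≤ K ϖ z) ∧
      (Measurable fun ϖ => ∫⁻ z, ENNReal.ofReal (epsMinus K ϖ z) ∂ϖ.toMeasure) ∧
      (∀ (m : Config X) (x : m.1), Measurable fun u => epsMinus K (m.mark u) (x, u x)) ∧
      ∀ (m : Config X) (x : m.1),
        (∀ᵐ u ∂marksLaw μ m.1, ∃ a ∈ d, a =ᵐ[μ] fun v => F (m.mark (Function.update u x v))) →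
        ∀ᵐ u ∂marksLaw μ m.1, HasCdc d γ (fun v => F (m.mark (Function.update u x v)))
          (fun v => F (m.mark (Function.update u x v)))
          (fun v => epsMinus K (m.mark (Function.update u x v)) (x, v)) := by
  obtain ⟨C, hC, φ, hφ, rfl⟩ := Config.exists_eq_comp_countMap hF
  have hadd : Measurable fun q : (ℕ → ℕ∞) × (ℕ → ℕ∞) => q.1 + q.2 :=
    measurable_pi_iff.2 fun j => Measurable.comp (g := fun q : ℕ∞ × ℕ∞ => q.1 + q.2) .of_discrete
      (Measurable.prodMk (f := fun q : (ℕ → ℕ∞) × (ℕ → ℕ∞) => q.1 j) (g := fun q => q.2 j)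
        ((measurable_pi_apply j).comp measurable_fst)
        ((measurable_pi_apply j).comp measurable_snd))
  have hsub : Measurable fun q : (ℕ → ℕ∞) × (ℕ → ℕ∞) => q.1 - q.2 :=
    measurable_pi_iff.2 fun j => Measurable.comp (g := fun q : ℕ∞ × ℕ∞ => q.1 - q.2) .of_discrete
      (Measurable.prodMk (f := fun q : (ℕ → ℕ∞) × (ℕ → ℕ∞) => q.1 j) (g := fun q => q.2 j)
        ((measurable_pi_apply j).comp measurable_fst)
        ((measurable_pi_apply j).comp measurable_snd))
  -- ε⁺F(ϖ, (x, v)) with the countings of ϖ and the point x as parameters, for (x, v) not in ϖ.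
  let f : (ℕ → ℕ∞) × X → Y → ℝ := fun s v => φ (s.1 + Config.pointCount C (s.2, v))
  have hf : Measurable (Function.uncurry f) := by
    refine hφ.comp (hadd.comp ((measurable_fst.comp measurable_fst).prodMk
      ((Config.measurable_pointCount hC).comp
        ((measurable_snd.comp measurable_fst).prodMk measurable_snd))))
  obtain ⟨h, hh, hh0, hcdc⟩ := hd.exists_measurable_cdc hf
  -- `i` codes a pair (j, n): these are the points whose mark falls in `C j` with probability at
  -- least 1/(n + 1).
  let B : ℕ → Set X := fun i => {x | ((i.unpair.2 : ℝ≥0∞) + 1)⁻¹ ≤ μ {v | (x, v) ∈ C i.unpair.1}}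
  have hBm : ∀ j n y, y ∈ B (Nat.pair j n) ↔
      ((n : ℝ≥0∞) + 1)⁻¹ ≤ μ {v | (y, v) ∈ C j} := by
    intro j n y
    simp [B]
  have hB : ∀ i, MeasurableSet (B i) := fun i =>
    measurableSet_le measurable_const (measurable_measure_prodMk_left (hC _))
  let A : ℕ → Set (X × Y) := fun i => B i ×ˢ Set.univ
  have hA : ∀ i, MeasurableSet (A i) := fun i => (hB i).prod MeasurableSet.univ
  -- The value 0 elsewhere is forced, not a convention: at such points F will turn out to be almost
  -- surely constant in the mark.
  let K : Config (X × Y) → X × Y → ℝ := fun ϖ z =>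
    if Config.InFiniteSet A ϖ z then h (Config.countMap C ϖ, z.1) z.2 else 0
  have hrem : ∀ ϖ z, Config.InFiniteSet A (ϖ.remove z) z ↔ Config.InFiniteSet A ϖ z := fun ϖ z =>
    exists_congr fun i => and_congr_right fun _ => Config.encard_remove_ne_top
  have hKe : ∀ ϖ z, epsMinus K ϖ z = if Config.InFiniteSet A ϖ z then
      h (Config.countMap C (ϖ.remove z), z.1) z.2 else 0 := by
    intro ϖ z
    change (if Config.InFiniteSet A (ϖ.remove z) z then
      h (Config.countMap C (ϖ.remove z), z.1) z.2 else 0) = _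
    simp only [hrem]
  have hfin : ∀ (m : Config X) (u : m.1 → Y) (x : X) (v : Y),
      Config.InFiniteSet A (m.mark u) (x, v) ↔ Config.InFiniteSet B m x := by
    intro m u x v
    refine exists_congr fun i => ?_
    rw [Config.encard_mark_prod_univ]
    simp [A]
  refine ⟨K, fun ϖ z => ?_, ?_, fun m x => ?_, fun m x hx => ?_⟩
  · simp only [K]
    split_ifs
    exacts [hh0 _ _, le_rfl]
  · let k : Config (X × Y) × (X × Y) → ℝ≥0∞ := fun q =>
      ENNReal.ofReal (h (Config.countMap C q.1 - Config.pointCount C q.2, q.2.1) q.2.2)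
    have hk : Measurable k := by
      refine (hh.comp (Measurable.prodMk (Measurable.prodMk (hsub.comp (Measurable.prodMk
        ((Config.measurable_countMap hC).comp measurable_fst)
        ((Config.measurable_pointCount hC).comp measurable_snd)))
        (measurable_fst.comp measurable_snd)) (measurable_snd.comp measurable_snd))).ennreal_ofReal
    convert Config.measurable_lintegral_inFiniteSet hA hk using 2 with ϖ
    rw [Config.lintegral_toMeasure, Config.lintegral_toMeasure]
    refine tsum_congr fun z => ?_
    rw [hKe]
    split_ifs with hz
    · rw [Config.countMap_remove C z.2]
    · exact ENNReal.ofReal_zero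
  · simp_rw [hKe, hfin]
    split_ifs with hz
    · have h1 : ∀ u : m.1 → Y, Config.countMap C ((m.mark u).remove (x, u x)) =
          Config.countMap C (m.mark u) - Config.pointCount C (x, u x) := fun u =>
        Config.countMap_remove C (Config.mem_mark m u x)
      simp_rw [h1]
      have h2 : Measurable fun u : m.1 → Y => ((x : X), u x) :=
        measurable_const.prodMk (measurable_pi_apply x)
      exact hh.comp (Measurable.prodMk (Measurable.prodMk (hsub.comp (Measurable.prodMk
        ((Config.measurable_countMap hC).comp (Config.measurable_mark m))
        ((Config.measurable_pointCount hC).comp h2))) measurable_const) (measurable_pi_apply x))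
    · exact measurable_const
  · have hfu : ∀ (u : m.1 → Y) (v : Y), (φ ∘ Config.countMap C) (m.mark (Function.update u x v)) =
        f (Config.countMap C ((m.mark u).remove (x, u x)), x) v := by
      intro u v
      change φ _ = φ _
      rw [← Config.add_remove_mark m u x v,
        Config.countMap_add C (Config.notMem_remove_mark m u x v)]
    have hKu : ∀ (u : m.1 → Y) (v : Y), epsMinus K (m.mark (Function.update u x v)) (x, v) =
        if Config.InFiniteSet B m x then
          h (Config.countMap C ((m.mark u).remove (x, u x)), x) v else 0 := by
      intro u v
      rw [hKe, Config.remove_mark_update]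
      simp only [hfin]
    simp_rw [hKu]
    by_cases hz : Config.InFiniteSet B m x
    · simp_rw [if_pos hz]
      filter_upwards [hx] with u hu
      simp_rw [hfu] at hu ⊢
      exact hcdc _ hu
    · simp_rw [if_neg hz]
      -- Every `B i` containing x has infinitely many points of m. If the mark of x hits `C j` with
      -- positive probability, some `B (Nat.pair j n)` contains x, and Borel–Cantelli gives
      -- infinitely many marked points in `C j`. That counting stays infinite when the point above x
      -- is removed or put back. The remaining sets `C j` are almost surely missed by the new mark,
      -- so no counting changes.
      have htop : ∀ j, μ {v | ((x : X), v) ∈ C j} ≠ 0 →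
          ∀ᵐ u ∂marksLaw μ m.1, ((m.mark u).1 ∩ C j).encard = ⊤ := by
        intro j hj
        obtain ⟨n, hn⟩ := ENNReal.exists_inv_nat_lt hj
        have hxB : (x : X) ∈ B (Nat.pair j n) := by
          rw [hBm]
          exact (ENNReal.inv_le_inv.2 le_self_add).trans hn.le
        refine Config.ae_encard_mark_eq_top (hC j) (B := B (Nat.pair j n))
          (ε := ((n : ℝ≥0∞) + 1)⁻¹) ?_ (fun y hy => ?_) ?_
        · exact ENNReal.inv_ne_zero.2 (ENNReal.add_ne_top.2 ⟨ENNReal.natCast_ne_top n,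
            ENNReal.one_ne_top⟩)
        · exact (hBm j n y).1 hy
        · by_contra hne
          exact hz ⟨_, hxB, hne⟩
      have htop' : ∀ᵐ u ∂marksLaw μ m.1, ∀ j, μ {v | ((x : X), v) ∈ C j} ≠ 0 →
          ((m.mark u).1 ∩ C j).encard = ⊤ := by
        refine ae_all_iff.2 fun j => ?_
        by_cases hj : μ {v | ((x : X), v) ∈ C j} = 0
        · exact ae_of_all _ fun u h => absurd hj h
        · filter_upwards [htop j hj] with u hu _ using hu
      have hnull : ∀ᵐ v ∂μ, ∀ j, μ {v | ((x : X), v) ∈ C j} = 0 → ((x : X), v) ∉ C j := by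
        refine ae_all_iff.2 fun j => ?_
        by_cases hj : μ {v | ((x : X), v) ∈ C j} = 0
        · have : ∀ᵐ v ∂μ, ((x : X), v) ∉ C j := by
            rw [ae_iff]
            simpa using hj
          filter_upwards [this] with v hv _ using hv
        · exact ae_of_all _ fun v h => absurd h hj
      filter_upwards [hx, htop'] with u hu hu'
      refine hd.hasCdc_const hu (c := φ (Config.countMap C ((m.mark u).remove (x, u x)))) ?_
      filter_upwards [hnull] with v hv
      rw [hfu]
      change φ _ = φ _
      congr 1
      ext1 j
      change Config.countMap C ((m.mark u).remove (x, u x)) j + Config.pointCount C (x, v) j = _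
      by_cases hj : μ {v | ((x : X), v) ∈ C j} = 0
      · have : Config.pointCount C ((x : X), v) j = 0 := Set.indicator_of_notMem (hv j hj) _
        rw [this, add_zero]
      · have : Config.countMap C ((m.mark u).remove (x, u x)) j = ⊤ := by
          by_contra hne
          exact Config.encard_remove_ne_top.1 hne (hu' j hj)
        rw [this, top_add]

end Version

/-! ### The carré du champ at the level of functions -/

section FunctionLevel

variable {Y : Type*} [MeasurableSpace Y] {μ : Measure Y}
  {d : Set (Lp ℝ 2 μ)} {γ : Lp ℝ 2 μ → Lp ℝ 2 μ → Lp ℝ 1 μ}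

theorem HasCdc.unique {f g h h' : Y → ℝ} (h1 : HasCdc d γ f g h) (h2 : HasCdc d γ f g h') :
    h =ᵐ[μ] h' := by
  obtain ⟨a, -, b, -, haf, hbg, hab⟩ := h1
  obtain ⟨a', -, b', -, haf', hbg', hab'⟩ := h2
  have ea : a = a' := Lp.ext (haf.trans haf'.symm)
  have eb : b = b' := Lp.ext (hbg.trans hbg'.symm)
  subst ea eb
  exact hab.symm.trans hab'

theorem HasCdc.congr {f f' g g' h h' : Y → ℝ} (h1 : HasCdc d γ f g h) (hf : f =ᵐ[μ] f')
    (hg : g =ᵐ[μ] g') (hh : h =ᵐ[μ] h') : HasCdc d γ f' g' h' := by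
  obtain ⟨a, ha, b, hb, haf, hbg, hab⟩ := h1
  exact ⟨a, ha, b, hb, haf.trans hf, hbg.trans hg, hab.trans hh⟩

theorem HasCdc.mem_left {f g h : Y → ℝ} (h1 : HasCdc d γ f g h) : ∃ a ∈ d, a =ᵐ[μ] f := by
  obtain ⟨a, ha, b, -, haf, -, -⟩ := h1
  exact ⟨a, ha, haf⟩

theorem HasCdc.mem_right {f g h : Y → ℝ} (h1 : HasCdc d γ f g h) : ∃ a ∈ d, a =ᵐ[μ] g := by
  obtain ⟨a, -, b, hb, -, hbg, -⟩ := h1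
  exact ⟨b, hb, hbg⟩

namespace IsLocalForm

theorem hasCdc_symm (hd : IsLocalForm μ d γ) {f g h : Y → ℝ} (h1 : HasCdc d γ f g h) : HasCdc d γ g f h := by
  obtain ⟨a, ha, b, hb, haf, hbg, hab⟩ := h1
  exact ⟨b, hb, a, ha, hbg, haf, by rwa [hd.cdc_symm b hb a ha]⟩

theorem hasCdc_add (hd : IsLocalForm μ d γ) {f f' g h h' : Y → ℝ} (h1 : HasCdc d γ f g h) (h2 : HasCdc d γ f' g h') :
    HasCdc d γ (fun v => f v + f' v) g (fun v => h v + h' v) := by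
  obtain ⟨a, ha, b, hb, haf, hbg, hab⟩ := h1
  obtain ⟨a', ha', b', hb', haf', hbg', hab'⟩ := h2
  have eb : b = b' := Lp.ext (hbg.trans hbg'.symm)
  subst eb
  refine ⟨a + a', hd.add_mem a ha a' ha', b, hb, ?_, hbg, ?_⟩
  · exact (Lp.coeFn_add a a').trans (haf.add haf')
  · rw [hd.cdc_add a ha a' ha' b hb]
    exact (Lp.coeFn_add _ _).trans (hab.add hab')

theorem hasCdc_smul (hd : IsLocalForm μ d γ) (c : ℝ) {f g h : Y → ℝ} (h1 : HasCdc d γ f g h) :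
    HasCdc d γ (fun v => c * f v) g (fun v => c * h v) := by
  obtain ⟨a, ha, b, hb, haf, hbg, hab⟩ := h1
  refine ⟨c • a, hd.smul_mem c a ha, b, hb, ?_, hbg, ?_⟩
  · exact (Lp.coeFn_smul c a).trans (haf.const_smul c)
  · rw [hd.cdc_smul c a ha b hb]
    exact (Lp.coeFn_smul c _).trans (hab.const_smul c)

theorem hasCdc_nonneg (hd : IsLocalForm μ d γ) {f h : Y → ℝ} (h1 : HasCdc d γ f f h) : 0 ≤ᵐ[μ] h := by
  obtain ⟨a, ha, b, hb, haf, hbg, hab⟩ := h1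
  have eb : a = b := Lp.ext (haf.trans hbg.symm)
  subst eb
  exact ((Lp.coeFn_nonneg _).2 (hd.cdc_nonneg a ha)).trans hab.le

theorem hasCdc_abs_le (hd : IsLocalForm μ d γ) {f g h hf hg : Y → ℝ} (h1 : HasCdc d γ f g h) (h2 : HasCdc d γ f f hf)
    (h3 : HasCdc d γ g g hg) : ∀ᵐ v ∂μ, 2 * |h v| ≤ hf v + hg v := by
  obtain ⟨a, ha, haf⟩ := h1.mem_left
  obtain ⟨b, hb, hbg⟩ := h1.mem_right
  filter_upwards [hd.abs_cdc_le ha hb,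
    h1.unique ⟨a, ha, b, hb, haf, hbg, EventuallyEq.rfl⟩,
    h2.unique ⟨a, ha, a, ha, haf, haf, EventuallyEq.rfl⟩,
    h3.unique ⟨b, hb, b, hb, hbg, hbg, EventuallyEq.rfl⟩] with v e1 e2 e3 e4
  rwa [e2, e3, e4]

theorem hasCdc_polar (hd : IsLocalForm μ d γ) {f g h hf hg : Y → ℝ} (h2 : HasCdc d γ f f hf) (h3 : HasCdc d γ g g hg)
    (h4 : HasCdc d γ (fun v => f v + g v) (fun v => f v + g v) h) :
    HasCdc d γ f g (fun v => (1 / 2) * (h v - hf v - hg v)) := by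
  obtain ⟨a, ha, haf⟩ := h2.mem_left
  obtain ⟨b, hb, hbg⟩ := h3.mem_left
  have h1 : HasCdc d γ f g (γ a b) := ⟨a, ha, b, hb, haf, hbg, EventuallyEq.rfl⟩
  have h5 := hd.hasCdc_add (hd.hasCdc_symm (hd.hasCdc_add h2 (hd.hasCdc_symm h1)))
    (hd.hasCdc_symm (hd.hasCdc_add h1 h3))
  refine h1.congr EventuallyEq.rfl EventuallyEq.rfl ?_
  filter_upwards [h4.unique h5] with v hv
  rw [hv]
  ring

theorem mem_add (hd : IsLocalForm μ d γ) {f g : Y → ℝ} (hf : ∃ a ∈ d, a =ᵐ[μ] f)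
    (hg : ∃ a ∈ d, a =ᵐ[μ] g) :
    ∃ a ∈ d, a =ᵐ[μ] fun v => f v + g v := by
  obtain ⟨a, ha, haf⟩ := hf
  obtain ⟨b, hb, hbg⟩ := hg
  exact ⟨a + b, hd.add_mem a ha b hb, (Lp.coeFn_add a b).trans (haf.add hbg)⟩

theorem mem_sub (hd : IsLocalForm μ d γ) {f g : Y → ℝ} (hf : ∃ a ∈ d, a =ᵐ[μ] f)
    (hg : ∃ a ∈ d, a =ᵐ[μ] g) :
    ∃ a ∈ d, a =ᵐ[μ] fun v => f v - g v := by
  obtain ⟨a, ha, haf⟩ := hf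
  obtain ⟨b, hb, hbg⟩ := hg
  exact ⟨a - b, hd.sub_mem ha hb, (Lp.coeFn_sub a b).trans (haf.sub hbg)⟩

theorem mem_smul (hd : IsLocalForm μ d γ) (c : ℝ) {f : Y → ℝ} (hf : ∃ a ∈ d, a =ᵐ[μ] f) :
    ∃ a ∈ d, a =ᵐ[μ] fun v => c * f v := by
  obtain ⟨a, ha, haf⟩ := hf
  exact ⟨c • a, hd.smul_mem c a ha, (Lp.coeFn_smul c a).trans (haf.const_smul c)⟩

end IsLocalForm

variable (d γ) in
open Classical in
/-- Twice the energy of a function, with value `∞` outside the domain. -/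
def fiberEnergy (f : Y → ℝ) : ℝ≥0∞ :=
  if h : ∃ a ∈ d, a =ᵐ[μ] f then ‖γ h.choose h.choose‖ₑ else ⊤

theorem fiberEnergy_eq {a : Lp ℝ 2 μ} (ha : a ∈ d) {f : Y → ℝ} (haf : a =ᵐ[μ] f) :
    fiberEnergy d γ f = ‖γ a a‖ₑ := by
  have h : ∃ a ∈ d, a =ᵐ[μ] f := ⟨a, ha, haf⟩
  have e : h.choose = a := Lp.ext (h.choose_spec.2.trans haf.symm)
  rw [fiberEnergy, dif_pos h, e]

theorem HasCdc.lintegral_eq {f h : Y → ℝ} (hd : IsLocalForm μ d γ) (h1 : HasCdc d γ f f h) :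
    ∫⁻ v, ENNReal.ofReal (h v) ∂μ = fiberEnergy d γ f := by
  obtain ⟨a, ha, haf⟩ := h1.mem_left
  rw [fiberEnergy_eq ha haf, Lp.enorm_def, eLpNorm_one_eq_lintegral_enorm]
  refine lintegral_congr_ae ?_
  filter_upwards [h1.unique ⟨a, ha, a, ha, haf, haf, EventuallyEq.rfl⟩,
    hd.hasCdc_nonneg h1] with v h2 h3
  rw [← h2, Real.enorm_of_nonneg h3]

theorem fiberEnergy_congr {f g : Y → ℝ} (hfg : f =ᵐ[μ] g) :
    fiberEnergy d γ f = fiberEnergy d γ g := by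
  by_cases h : ∃ a ∈ d, a =ᵐ[μ] f
  · obtain ⟨a, ha, haf⟩ := h
    rw [fiberEnergy_eq ha haf, fiberEnergy_eq ha (haf.trans hfg)]
  · have h' : ¬ ∃ a ∈ d, a =ᵐ[μ] g := fun ⟨a, ha, hag⟩ => h ⟨a, ha, hag.trans hfg.symm⟩
    rw [fiberEnergy, fiberEnergy, dif_neg h, dif_neg h']

theorem IsLocalForm.enorm_cdc (hd : IsLocalForm μ d γ) {a : Lp ℝ 2 μ} (ha : a ∈ d) :
    ‖γ a a‖ₑ = ENNReal.ofReal (2 * energy γ a a) := by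
  rw [hd.energy_eq ha, ← ofReal_norm]
  congr 1
  ring

theorem IsLocalForm.norm_cdc_add_le (hd : IsLocalForm μ d γ) {a b : Lp ℝ 2 μ} (ha : a ∈ d)
    (hb : b ∈ d) : ‖γ (a + b) (a + b)‖ ≤ 2 * ‖γ a a‖ + 2 * ‖γ b b‖ := by
  have hab := hd.add_mem a ha b hb
  have h1 := hd.norm_cdc_le ha hb
  have e : γ (a + b) (a + b) = γ a a + γ a b + (γ a b + γ b b) := by
    rw [hd.cdc_add a ha b hb _ hab, hd.cdc_add_right ha hb ha, hd.cdc_add_right ha hb hb,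
      hd.cdc_symm b hb a ha]
  rw [e]
  have h2 := norm_add₄_le (a := γ a a) (b := γ a b) (c := γ a b) (d := γ b b)
  have h3 : γ a a + γ a b + (γ a b + γ b b) = γ a a + γ a b + γ a b + γ b b := by abel
  rw [h3]
  linarith

/-- The value ∞ outside the domain makes the inequality hold for arbitrary functions. -/
theorem IsLocalForm.fiberEnergy_add_le (hd : IsLocalForm μ d γ) (f g : Y → ℝ) :
    fiberEnergy d γ (fun v => f v + g v) ≤ 2 * fiberEnergy d γ f + 2 * fiberEnergy d γ g := by
  by_cases hf : ∃ a ∈ d, a =ᵐ[μ] f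
  swap
  · rw [fiberEnergy, fiberEnergy, dif_neg hf]
    simp
  by_cases hg : ∃ a ∈ d, a =ᵐ[μ] g
  swap
  · rw [fiberEnergy, fiberEnergy, fiberEnergy, dif_neg hg]
    simp
  obtain ⟨a, ha, haf⟩ := hf
  obtain ⟨b, hb, hbg⟩ := hg
  rw [fiberEnergy_eq ha haf, fiberEnergy_eq hb hbg,
    fiberEnergy_eq (f := fun v => f v + g v) (hd.add_mem a ha b hb) ((Lp.coeFn_add a b).trans (haf.add hbg)), ← ofReal_norm, ← ofReal_norm, ← ofReal_norm]
  have key := ENNReal.ofReal_le_ofReal (hd.norm_cdc_add_le ha hb)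
  rwa [ENNReal.ofReal_add (by positivity) (by positivity), ENNReal.ofReal_mul zero_le_two,
    ENNReal.ofReal_mul zero_le_two, ENNReal.ofReal_ofNat] at key

theorem IsLocalForm.fiberEnergy_smul_le (hd : IsLocalForm μ d γ) (c : ℝ) {f : Y → ℝ}
    (hf : ∃ a ∈ d, a =ᵐ[μ] f) :
    fiberEnergy d γ (fun v => c * f v) = ENNReal.ofReal (c ^ 2) * fiberEnergy d γ f := by
  obtain ⟨a, ha, haf⟩ := hf
  rw [fiberEnergy_eq ha haf, fiberEnergy_eq (f := fun v => c * f v) (hd.smul_mem c a ha)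
    ((Lp.coeFn_smul c a).trans (haf.const_smul c)), hd.cdc_smul c a ha _ (hd.smul_mem c a ha),
    hd.cdc_smul_right c ha ha, enorm_smul, enorm_smul, ← mul_assoc]
  congr 1
  rw [← enorm_mul, Real.enorm_of_nonneg (mul_self_nonneg c), pow_two]

theorem IsLocalForm.fiberEnergy_contraction (hd : IsLocalForm μ d γ) {φ : ℝ → ℝ}
    (hφ : LipschitzWith 1 φ) (h0 : φ 0 = 0) {f : Y → ℝ} (hf : ∃ a ∈ d, a =ᵐ[μ] f) :
    (∃ a ∈ d, a =ᵐ[μ] fun v => φ (f v)) ∧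
      fiberEnergy d γ (fun v => φ (f v)) ≤ fiberEnergy d γ f := by
  obtain ⟨a, ha, haf⟩ := hf
  obtain ⟨h1, h2⟩ := hd.contraction φ hφ h0 a ha
  have h3 : hφ.compLp h0 a =ᵐ[μ] fun v => φ (f v) := by
    filter_upwards [hφ.coeFn_compLp h0 a, haf] with v hv hv'
    rw [hv, Function.comp_apply, hv']
  refine ⟨⟨_, h1, h3⟩, ?_⟩
  rw [fiberEnergy_eq h1 h3, fiberEnergy_eq ha haf, hd.enorm_cdc h1, hd.enorm_cdc ha]
  exact ENNReal.ofReal_le_ofReal (by linarith)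

/-- A fast Cauchy sequence for the graph norm converges, with an estimate of the energy of the
remainder. -/
theorem IsLocalForm.mem_of_tsum_lt_top (hd : IsLocalForm μ d γ) {s : ℕ → Y → ℝ} {f : Y → ℝ}
    (hs : ∀ k, ∃ a ∈ d, a =ᵐ[μ] s k)
    (hlim : ∀ᵐ v ∂μ, Tendsto (fun k => s k v) atTop (𝓝 (f v)))
    (h2 : ∑' k, 4 ^ k * ∫⁻ v, ENNReal.ofReal ((s (k + 1) v - s k v) ^ 2) ∂μ ≠ ⊤)
    (hE : ∑' k, 4 ^ k * fiberEnergy d γ (fun v => s (k + 1) v - s k v) ≠ ⊤) :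
    (∃ a ∈ d, a =ᵐ[μ] f) ∧ ∀ k, fiberEnergy d γ (fun v => f v - s k v) ≤
      ∑' j, 2 ^ (j + 1) * fiberEnergy d γ (fun v => s (k + j + 1) v - s (k + j) v) := by
  choose a ha has using hs
  let A : ℕ → FormSpace hd := fun k => hd.toFormSpace (ha k)
  have hdiff : ∀ k j, ((a k - a j : Lp ℝ 2 μ) : Y → ℝ) =ᵐ[μ] fun v => s k v - s j v := fun k j =>
    (Lp.coeFn_sub _ _).trans ((has k).sub (has j))
  have hL2 : ∀ k, ∫⁻ v, ENNReal.ofReal ((s (k + 1) v - s k v) ^ 2) ∂μ =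
      ENNReal.ofReal (‖a (k + 1) - a k‖ ^ 2) := by
    intro k
    rw [← real_inner_self_eq_norm_sq, L2.inner_def, ofReal_integral_eq_lintegral_ofReal]
    · refine lintegral_congr_ae ?_
      filter_upwards [hdiff (k + 1) k] with v hv
      rw [hv, real_inner_self_eq_norm_sq, Real.norm_eq_abs, sq_abs]
    · exact L2.integrable_inner _ _
    · exact ae_of_all _ fun v => real_inner_self_nonneg
  have hEk : ∀ k j, fiberEnergy d γ (fun v => s k v - s j v) =
      ENNReal.ofReal (2 * energy γ (a k - a j) (a k - a j)) := by
    intro k j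
    rw [fiberEnergy_eq (hd.sub_mem (ha k) (ha j)) (hdiff k j),
      hd.enorm_cdc (hd.sub_mem (ha k) (ha j))]
  -- The terms 4ᵏ‖A (k + 1) - A k‖² are bounded by the two sums, so the increments decay like 2⁻ᵏ in
  -- the graph norm.
  have hbound : ∃ C : ℝ, ∀ k, ‖A (k + 1) - A k‖ ≤ C * (1 / 2) ^ k := by
    set S := ∑' k, 4 ^ k * ∫⁻ v, ENNReal.ofReal ((s (k + 1) v - s k v) ^ 2) ∂μ
    set S' := ∑' k, 4 ^ k * fiberEnergy d γ (fun v => s (k + 1) v - s k v)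
    refine ⟨Real.sqrt (S.toReal + S'.toReal), fun k => ?_⟩
    have e4 : (4 : ℝ≥0∞) ^ k = ENNReal.ofReal (4 ^ k) := by
      rw [ENNReal.ofReal_pow (by norm_num)]
      norm_num
    have k1 : 4 ^ k * ‖a (k + 1) - a k‖ ^ 2 ≤ S.toReal := by
      have := ENNReal.le_tsum (f := fun k => 4 ^ k *
        ∫⁻ v, ENNReal.ofReal ((s (k + 1) v - s k v) ^ 2) ∂μ) k
      simp only [hL2] at this
      rw [e4, ← ENNReal.ofReal_mul (by positivity)] at this
      have h3 := ENNReal.toReal_mono (by simpa only [← hL2] using h2) this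
      rw [ENNReal.toReal_ofReal (by positivity)] at h3
      simpa only [S, hL2] using h3
    have k2 : 4 ^ k * energy γ (a (k + 1) - a k) (a (k + 1) - a k) ≤ S'.toReal := by
      have := ENNReal.le_tsum (f := fun k => 4 ^ k *
        fiberEnergy d γ (fun v => s (k + 1) v - s k v)) k
      simp only [hEk] at this
      rw [e4, ← ENNReal.ofReal_mul (by positivity)] at this
      have h3 := ENNReal.toReal_mono (by simpa only [← hEk] using hE) this
      have h4 := hd.energy_nonneg (hd.sub_mem (ha (k + 1)) (ha k))
      rw [ENNReal.toReal_ofReal (by positivity)] at h3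
      have h5 : 4 ^ k * energy γ (a (k + 1) - a k) (a (k + 1) - a k) ≤
          4 ^ k * (2 * energy γ (a (k + 1) - a k) (a (k + 1) - a k)) := by
        have : (0 : ℝ) ≤ 4 ^ k := by positivity
        nlinarith
      refine h5.trans ?_
      simpa only [S', hEk] using h3
    have k3 : 4 ^ k * ‖A (k + 1) - A k‖ ^ 2 ≤ S.toReal + S'.toReal := by
      rw [FormSpace.norm_sq, mul_add]
      exact add_le_add k1 k2
    have k4 : ‖A (k + 1) - A k‖ ^ 2 ≤ (Real.sqrt (S.toReal + S'.toReal) * (1 / 2) ^ k) ^ 2 := by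
      rw [mul_pow, Real.sq_sqrt (by positivity), ← pow_mul, mul_comm k 2, pow_mul]
      have : ((1 / 2 : ℝ) ^ 2) ^ k = (4 ^ k)⁻¹ := by
        rw [← inv_pow]
        norm_num
      rw [this, ← div_eq_mul_inv, le_div_iff₀ (by positivity)]
      linarith
    exact abs_le_of_sq_le_sq' k4 (by positivity) |>.2
  obtain ⟨C, hC⟩ := hbound
  have hcau : CauchySeq A := by
    refine cauchySeq_of_le_geometric (1 / 2) C (by norm_num) fun k => ?_
    rw [dist_comm, dist_eq_norm]
    exact hC k
  obtain ⟨g, hg⟩ := cauchySeq_tendsto_of_complete hcau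
  have hgf : g.1 =ᵐ[μ] f := by
    have h3 : Tendsto a atTop (𝓝 g.1) := ((FormSpace.incl hd).continuous.tendsto g).comp hg
    obtain ⟨ns, hns, h4⟩ := (tendstoInMeasure_of_tendsto_Lp h3).exists_seq_tendsto_ae
    filter_upwards [h4, hlim, ae_all_iff.2 has] with v h5 h6 h7
    simp only [h7] at h5
    exact tendsto_nhds_unique h5 (h6.comp hns.tendsto_atTop)
  refine ⟨⟨g.1, g.2, hgf⟩, fun k => ?_⟩
  -- Splitting off one increment at a time costs a factor 2 at each stage, whence the weights 2ʲ⁺¹.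
  have hEn : ∀ n k, fiberEnergy d γ (fun v => s (k + n) v - s k v) ≤
      ∑ j ∈ Finset.range n,
        2 ^ (j + 1) * fiberEnergy d γ (fun v => s (k + j + 1) v - s (k + j) v) := by
    intro n
    induction n with
    | zero =>
      intro k
      rw [hEk]
      have : a (k + 0) - a k = 0 := sub_self _
      rw [this, hd.energy_eq hd.zero_mem, hd.cdc_zero_left hd.zero_mem]
      simp
    | succ n ih =>
      intro k
      have e : (fun v => s (k + (n + 1)) v - s k v) =
          fun v => (s (k + 1) v - s k v) + (s (k + 1 + n) v - s (k + 1) v) := by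
        funext v
        rw [show k + (n + 1) = k + 1 + n by ring]
        ring
      rw [e, Finset.sum_range_succ']
      refine (hd.fiberEnergy_add_le _ _).trans ?_
      rw [add_comm]
      refine add_le_add ?_ (by simp)
      refine (mul_le_mul_right (ih (k + 1)) 2).trans ?_
      rw [Finset.mul_sum]
      refine Finset.sum_le_sum fun j _ => ?_
      rw [← mul_assoc, ← pow_succ', show k + 1 + j = k + (j + 1) by ring]
  have hlimE : Tendsto (fun n => fiberEnergy d γ (fun v => s (k + n) v - s k v)) atTop
      (𝓝 (fiberEnergy d γ (fun v => f v - s k v))) := by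
    have hdg : ((g.1 - a k : Lp ℝ 2 μ) : Y → ℝ) =ᵐ[μ] fun v => f v - s k v :=
      (Lp.coeFn_sub _ _).trans (hgf.sub (has k))
    rw [fiberEnergy_eq (hd.sub_mem g.2 (ha k)) hdg]
    have h3 : Tendsto (fun n => A (k + n) - A k) atTop (𝓝 (g - A k)) :=
      (hg.comp (tendsto_add_atTop_nat k |>.congr fun n => by rw [add_comm])).sub_const _
    have h4 := ((FormSpace.continuous_cdc.tendsto _).comp h3).enorm
    refine h4.congr fun n => ?_
    rw [fiberEnergy_eq (hd.sub_mem (ha (k + n)) (ha k)) (hdiff (k + n) k)]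
    rfl
  refine le_of_tendsto' hlimE fun n => (hEn n k).trans ?_
  exact ENNReal.sum_le_tsum _

end FunctionLevel

/-! ### The carré du champ in one coordinate -/

section Partial

variable {Y : Type*} [MeasurableSpace Y] {μ : Measure Y} [IsProbabilityMeasure μ]
  {d : Set (Lp ℝ 2 μ)} {γ : Lp ℝ 2 μ → Lp ℝ 2 μ → Lp ℝ 1 μ} {ι : Type*} {i : ι}
  {F F' G G' h h' H H' : (ι → Y) → ℝ}

open Classical in
theorem IsPartialCdc.unique (h1 : IsPartialCdc μ d γ i F G h)
    (h2 : IsPartialCdc μ d γ i F G h') : h =ᵐ[marksLaw μ ι] h' := by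
  refine ae_of_ae_update i (nullMeasurableSet_eq_fun h1.1.aemeasurable h2.1.aemeasurable) ?_
  filter_upwards [h1.2, h2.2] with u e1 e2
  exact e1.unique e2

theorem IsPartialCdc.congr (h1 : IsPartialCdc μ d γ i F G h) (hF : F =ᵐ[marksLaw μ ι] F')
    (hG : G =ᵐ[marksLaw μ ι] G') (hh : h =ᵐ[marksLaw μ ι] h') :
    IsPartialCdc μ d γ i F' G' h' := by
  classical
  refine ⟨h1.1.congr hh, ?_⟩
  filter_upwards [h1.2, ae_ae_update i hF, ae_ae_update i hG, ae_ae_update i hh]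
    with u e1 e2 e3 e4
  exact e1.congr e2 e3 e4

namespace IsLocalForm

theorem partialCdc_symm (hd : IsLocalForm μ d γ) (h1 : IsPartialCdc μ d γ i F G h) :
    IsPartialCdc μ d γ i G F h :=
  ⟨h1.1, h1.2.mono fun _ e => hd.hasCdc_symm e⟩

theorem partialCdc_add (hd : IsLocalForm μ d γ) (h1 : IsPartialCdc μ d γ i F G h)
    (h2 : IsPartialCdc μ d γ i F' G h') :
    IsPartialCdc μ d γ i (fun u => F u + F' u) G (fun u => h u + h' u) :=
  ⟨h1.1.add h2.1, by filter_upwards [h1.2, h2.2] with u e1 e2 using hd.hasCdc_add e1 e2⟩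

theorem partialCdc_smul (hd : IsLocalForm μ d γ) (c : ℝ) (h1 : IsPartialCdc μ d γ i F G h) :
    IsPartialCdc μ d γ i (fun u => c * F u) G (fun u => c * h u) :=
  ⟨h1.1.const_mul c, h1.2.mono fun _ e => hd.hasCdc_smul c e⟩

theorem partialCdc_nonneg (hd : IsLocalForm μ d γ) (h1 : IsPartialCdc μ d γ i F F h) :
    ∀ᵐ u ∂marksLaw μ ι, 0 ≤ h u := by
  classical
  refine ae_of_ae_update i (nullMeasurableSet_le aemeasurable_const h1.1.aemeasurable) ?_
  exact h1.2.mono fun u e => hd.hasCdc_nonneg e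

theorem partialCdc_abs_le (hd : IsLocalForm μ d γ) {hf hg : (ι → Y) → ℝ}
    (h1 : IsPartialCdc μ d γ i F G h) (h2 : IsPartialCdc μ d γ i F F hf)
    (h3 : IsPartialCdc μ d γ i G G hg) :
    ∀ᵐ u ∂marksLaw μ ι, 2 * |h u| ≤ hf u + hg u := by
  classical
  refine ae_of_ae_update i (nullMeasurableSet_le
    (h1.1.norm.aemeasurable.const_mul 2) (h2.1.aemeasurable.add h3.1.aemeasurable)) ?_
  filter_upwards [h1.2, h2.2, h3.2] with u e1 e2 e3
  exact hd.hasCdc_abs_le e1 e2 e3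

theorem partialCdc_polar (hd : IsLocalForm μ d γ) {hf hg : (ι → Y) → ℝ}
    (h2 : IsPartialCdc μ d γ i F F hf) (h3 : IsPartialCdc μ d γ i G G hg)
    (h4 : IsPartialCdc μ d γ i (fun u => F u + G u) (fun u => F u + G u) h) :
    IsPartialCdc μ d γ i F G (fun u => (1 / 2) * (h u - hf u - hg u)) := by
  refine ⟨((h4.1.sub h2.1).sub h3.1).const_mul _, ?_⟩
  filter_upwards [h2.2, h3.2, h4.2] with u e1 e2 e3
  exact hd.hasCdc_polar e1 e2 e3

open Classical in
theorem aemeasurable_fiberEnergy (hd : IsLocalForm μ d γ) (h1 : IsPartialCdc μ d γ i F F h) :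
    AEMeasurable (fun u => fiberEnergy d γ fun v => F (Function.update u i v))
      (marksLaw μ ι) := by
  have h2 : AEMeasurable (fun p : (ι → Y) × Y =>
      ENNReal.ofReal (h (Function.update p.1 i p.2))) ((marksLaw μ ι).prod μ) := by
    have h3 := measurePreserving_update (μ := μ) i
    exact (h1.1.aemeasurable.comp_quasiMeasurePreserving h3.quasiMeasurePreserving).ennreal_ofReal
  refine h2.lintegral_prod_right'.congr ?_
  filter_upwards [h1.2] with u e
  exact e.lintegral_eq hd

open Classical in
theorem lintegral_partialCdc (hd : IsLocalForm μ d γ) (h1 : IsPartialCdc μ d γ i F F h) :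
    ∫⁻ u, ENNReal.ofReal (h u) ∂marksLaw μ ι =
      ∫⁻ u, fiberEnergy d γ (fun v => F (Function.update u i v)) ∂marksLaw μ ι := by
  rw [← lintegral_update i h1.1.aemeasurable.ennreal_ofReal]
  refine lintegral_congr_ae ?_
  filter_upwards [h1.2] with u e
  exact e.lintegral_eq hd

end IsLocalForm

theorem IsSumCdc.unique [Countable ι] (h1 : IsSumCdc μ d γ F G H) (h2 : IsSumCdc μ d γ F G H') :
    H =ᵐ[marksLaw μ ι] H' := by
  obtain ⟨h, hp, hs⟩ := h1
  obtain ⟨h', hp', hs'⟩ := h2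
  filter_upwards [hs, hs', ae_all_iff.2 fun i => (hp i).unique (hp' i)] with u e1 e2 e3
  simp only [e3] at e1
  exact e1.unique e2

theorem IsSumCdc.congr (h1 : IsSumCdc μ d γ F G H) (hF : F =ᵐ[marksLaw μ ι] F')
    (hG : G =ᵐ[marksLaw μ ι] G') (hH : H =ᵐ[marksLaw μ ι] H') : IsSumCdc μ d γ F' G' H' := by
  obtain ⟨h, hp, hs⟩ := h1
  refine ⟨h, fun i => (hp i).congr hF hG EventuallyEq.rfl, ?_⟩
  filter_upwards [hs, hH] with u e1 e2
  rwa [← e2]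

namespace IsLocalForm

theorem sumCdc_symm (hd : IsLocalForm μ d γ) (h1 : IsSumCdc μ d γ F G H) :
    IsSumCdc μ d γ G F H := by
  obtain ⟨h, hp, hs⟩ := h1
  exact ⟨h, fun i => hd.partialCdc_symm (hp i), hs⟩

theorem sumCdc_add (hd : IsLocalForm μ d γ) (h1 : IsSumCdc μ d γ F G H)
    (h2 : IsSumCdc μ d γ F' G H') :
    IsSumCdc μ d γ (fun u => F u + F' u) G (fun u => H u + H' u) := by
  obtain ⟨h, hp, hs⟩ := h1
  obtain ⟨h', hp', hs'⟩ := h2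
  refine ⟨_, fun i => hd.partialCdc_add (hp i) (hp' i), ?_⟩
  filter_upwards [hs, hs'] with u e1 e2 using e1.add e2

theorem sumCdc_smul (hd : IsLocalForm μ d γ) (c : ℝ) (h1 : IsSumCdc μ d γ F G H) :
    IsSumCdc μ d γ (fun u => c * F u) G (fun u => c * H u) := by
  obtain ⟨h, hp, hs⟩ := h1
  exact ⟨_, fun i => hd.partialCdc_smul c (hp i), hs.mono fun u e => e.mul_left c⟩

theorem sumCdc_polar (hd : IsLocalForm μ d γ) {K : (ι → Y) → ℝ} (h1 : IsSumCdc μ d γ F F H)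
    (h2 : IsSumCdc μ d γ G G H')
    (h3 : IsSumCdc μ d γ (fun u => F u + G u) (fun u => F u + G u) K) :
    IsSumCdc μ d γ F G (fun u => (1 / 2) * (K u - H u - H' u)) := by
  obtain ⟨h, hp, hs⟩ := h1
  obtain ⟨h', hp', hs'⟩ := h2
  obtain ⟨k, hpk, hsk⟩ := h3
  refine ⟨_, fun i => hd.partialCdc_polar (hp i) (hp' i) (hpk i), ?_⟩
  filter_upwards [hs, hs', hsk] with u e1 e2 e3 using ((e3.sub e1).sub e2).mul_left _

theorem sumCdc_nonneg [Countable ι] (hd : IsLocalForm μ d γ) (h1 : IsSumCdc μ d γ F F H) :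
    ∀ᵐ u ∂marksLaw μ ι, 0 ≤ H u := by
  obtain ⟨h, hp, hs⟩ := h1
  filter_upwards [hs, ae_all_iff.2 fun i => hd.partialCdc_nonneg (hp i)] with u e1 e2
  exact e1.nonneg e2

theorem lintegral_ofReal_sum [Countable ι] (hd : IsLocalForm μ d γ) {h : ι → (ι → Y) → ℝ}
    (hp : ∀ i, IsPartialCdc μ d γ i F F (h i))
    (hs : ∀ᵐ u ∂marksLaw μ ι, HasSum (fun i => h i u) (H u)) :
    ∫⁻ u, ENNReal.ofReal (H u) ∂marksLaw μ ι =
      ∑' i, ∫⁻ u, ENNReal.ofReal (h i u) ∂marksLaw μ ι := by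
  rw [← lintegral_tsum fun i => (hp i).1.aemeasurable.ennreal_ofReal]
  refine lintegral_congr_ae ?_
  filter_upwards [hs, ae_all_iff.2 fun i => hd.partialCdc_nonneg (hp i)] with u e1 e2
  rw [← e1.tsum_eq, ENNReal.ofReal_tsum_of_nonneg e2 e1.summable]

open Classical in
theorem lintegral_sumCdc [Countable ι] (hd : IsLocalForm μ d γ) (h1 : IsSumCdc μ d γ F F H) :
    ∫⁻ u, ENNReal.ofReal (H u) ∂marksLaw μ ι =
      ∑' i, ∫⁻ u, fiberEnergy d γ (fun v => F (Function.update u i v)) ∂marksLaw μ ι := by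
  obtain ⟨h, hp, hs⟩ := h1
  rw [hd.lintegral_ofReal_sum hp hs]
  exact tsum_congr fun i => hd.lintegral_partialCdc (hp i)

/-- The cross terms are dominated through 2|γᵢ[F, G]| ≤ γᵢ[F] + γᵢ[G]. This licenses exchanging the
sum over the points with the integral over the marks. -/
theorem tsum_lintegral_enorm_ne_top [Countable ι] (hd : IsLocalForm μ d γ)
    {h : ι → (ι → Y) → ℝ} (hp : ∀ i, IsPartialCdc μ d γ i F G (h i))
    (h1 : IsSumCdc μ d γ F F H) (h2 : IsSumCdc μ d γ G G H')
    (hH : Integrable H (marksLaw μ ι)) (hH' : Integrable H' (marksLaw μ ι)) :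
    ∑' i, ∫⁻ u, ‖h i u‖ₑ ∂marksLaw μ ι ≠ ⊤ := by
  obtain ⟨hf, hpf, hsf⟩ := h1
  obtain ⟨hg, hpg, hsg⟩ := h2
  have e1 := hd.lintegral_ofReal_sum hpf hsf
  have e2 := hd.lintegral_ofReal_sum hpg hsg
  have h3 : ∑' i, ∫⁻ u, ‖h i u‖ₑ ∂marksLaw μ ι ≤
      ∑' i, ∫⁻ u, ENNReal.ofReal (hf i u) ∂marksLaw μ ι +
        ∑' i, ∫⁻ u, ENNReal.ofReal (hg i u) ∂marksLaw μ ι := by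
    rw [← ENNReal.tsum_add]
    refine ENNReal.tsum_le_tsum fun i => ?_
    rw [← lintegral_add_left' (hpf i).1.aemeasurable.ennreal_ofReal]
    refine lintegral_mono_ae ?_
    filter_upwards [hd.partialCdc_abs_le (hp i) (hpf i) (hpg i), hd.partialCdc_nonneg (hpf i),
      hd.partialCdc_nonneg (hpg i)] with u k1 k2 k3
    rw [← ENNReal.ofReal_add k2 k3, ← ofReal_norm]
    refine ENNReal.ofReal_le_ofReal ?_
    rw [Real.norm_eq_abs]
    linarith [abs_nonneg (h i u)]
  refine ne_top_of_le_ne_top ?_ h3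
  rw [← e1, ← e2]
  exact ENNReal.add_ne_top.2 ⟨hH.lintegral_lt_top.ne, hH'.lintegral_lt_top.ne⟩

end IsLocalForm

open Classical in
/-- The integral of a sum vanishes if each term has mean zero in the corresponding coordinate. -/
theorem integral_eq_zero_of_update [Countable ι] {φ : ι → (ι → Y) → ℝ}
    (hm : ∀ i, AEStronglyMeasurable (φ i) (marksLaw μ ι))
    (hfin : ∑' i, ∫⁻ u, ‖φ i u‖ₑ ∂marksLaw μ ι ≠ ⊤)
    (hs : ∀ᵐ u ∂marksLaw μ ι, HasSum (fun i => φ i u) (H u))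
    (h0 : ∀ i, ∀ᵐ u ∂marksLaw μ ι, ∫ v, φ i (Function.update u i v) ∂μ = 0) :
    ∫ u, H u ∂marksLaw μ ι = 0 := by
  have hint : ∀ i, Integrable (φ i) (marksLaw μ ι) := fun i =>
    ⟨hm i, (ENNReal.ne_top_of_tsum_ne_top hfin i).lt_top⟩
  have e : ∫ u, H u ∂marksLaw μ ι = ∑' i, ∫ u, φ i u ∂marksLaw μ ι := by
    rw [← integral_tsum hm hfin]
    refine integral_congr_ae ?_
    filter_upwards [hs] with u hu
    exact hu.tsum_eq.symm
  rw [e]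
  have : ∀ i, ∫ u, φ i u ∂marksLaw μ ι = 0 := fun i => by
    rw [← integral_update i (hint i)]
    exact integral_eq_zero_of_ae (h0 i)
  simp [this]

theorem prodCdc_ae_eq [Countable ι] {F G : Lp ℝ 2 (marksLaw μ ι)}
    (h1 : IsProdCdc μ d γ ι F G H) : prodCdc μ d γ ι F G =ᵐ[marksLaw μ ι] H := by
  have h : ∃ H : (ι → Y) → ℝ, IsProdCdc μ d γ ι F G H := ⟨H, h1⟩
  rw [prodCdc, dif_pos h]
  exact (Integrable.coeFn_toL1 _).trans (h.choose_spec.2.unique h1.2)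

end Partial

/-! ### The upper structure is a local form -/

section UpperForm

variable {X Y : Type*} [MeasurableSpace X] [MeasurableSingletonClass X]
  [MeasurableSpace Y] [MeasurableSingletonClass Y] {Q : Measure (Config X)}
  {μ : Measure Y} [IsProbabilityMeasure μ]
  {d : Set (Lp ℝ 2 μ)} {γ : Lp ℝ 2 μ → Lp ℝ 2 μ → Lp ℝ 1 μ}
  {F F' G G' H H' : Config (X × Y) → ℝ}

/-- The marked configuration after the mark of `x` has been changed to `v`. -/
def Config.remark (m : Config X) (u : m.1 → Y) (x : m.1) (v : Y) : Config (X × Y) :=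
  m.mark (@Function.update m.1 (fun _ => Y) (fun a b => Classical.propDecidable (a = b)) u x v)

theorem Config.mark_update (m : Config X) [h : DecidableEq m.1] (u : m.1 → Y) (x : m.1) (v : Y) :
    m.mark (Function.update u x v) = m.remark u x v := by
  rw [Config.remark, Subsingleton.elim h fun a b => Classical.propDecidable (a = b)]

theorem ae_fiber {p : Config (X × Y) → Prop} (h : ∀ᵐ ϖ ∂markedLaw Q μ, p ϖ) :
    ∀ᵐ m ∂Q, ∀ x : m.1, ∀ᵐ u ∂marksLaw μ m.1, ∀ᵐ v ∂μ, p (m.remark u x v) := by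
  filter_upwards [ae_ae_of_ae_markedLaw h] with m hm x
  classical
  exact (ae_ae_update x hm).mono fun u hu => by simpa only [Config.mark_update] using hu

theorem IsUpperCdc.unique (h1 : IsUpperCdc Q μ d γ F G H) (h2 : IsUpperCdc Q μ d γ F G H') :
    H =ᵐ[markedLaw Q μ] H' := by
  refine ae_markedLaw_of_ae_ae
    (nullMeasurableSet_eq_fun h1.1.1.aemeasurable h2.1.1.aemeasurable) ?_
  filter_upwards [h1.2, h2.2] with m e1 e2
  have : Countable m.1 := m.2.to_subtype
  exact e1.unique e2

theorem IsUpperCdc.congr (h1 : IsUpperCdc Q μ d γ F G H) (hF : F =ᵐ[markedLaw Q μ] F')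
    (hG : G =ᵐ[markedLaw Q μ] G') (hH : H =ᵐ[markedLaw Q μ] H') :
    IsUpperCdc Q μ d γ F' G' H' := by
  refine ⟨h1.1.congr hH, ?_⟩
  filter_upwards [h1.2, ae_ae_of_ae_markedLaw hF, ae_ae_of_ae_markedLaw hG,
    ae_ae_of_ae_markedLaw hH] with m e1 e2 e3 e4
  exact e1.congr e2 e3 e4

theorem upperCdc_ae_eq {F G : Lp ℝ 2 (markedLaw Q μ)} (h1 : IsUpperCdc Q μ d γ F G H) :
    upperCdc Q μ d γ F G =ᵐ[markedLaw Q μ] H := by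
  have h : ∃ H : Config (X × Y) → ℝ, IsUpperCdc Q μ d γ F G H := ⟨H, h1⟩
  rw [upperCdc, dif_pos h]
  exact (Integrable.coeFn_toL1 _).trans (h.choose_spec.unique h1)

variable (Q d γ) in
/-- For almost every configuration, and almost every value of the other marks, the function is in
the domain as a function of one mark. -/
def FiberDom (F : Config (X × Y) → ℝ) : Prop :=
  ∀ᵐ m ∂Q, ∀ x : m.1, ∀ᵐ u ∂marksLaw μ m.1,
    ∃ a ∈ d, a =ᵐ[μ] fun v => F (m.remark u x v)

variable (Q d γ) in
/-- Twice the energy of the upper structure. -/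
def upperEnergy (F : Config (X × Y) → ℝ) : ℝ≥0∞ :=
  ∫⁻ m, ∑' x : m.1, ∫⁻ u, fiberEnergy d γ (fun v => F (m.remark u x v))
    ∂marksLaw μ m.1 ∂Q

theorem FiberDom.congr (hF : FiberDom Q d F) (h : F =ᵐ[markedLaw Q μ] F') : FiberDom Q d F' := by
  filter_upwards [hF, ae_fiber h] with m h1 h2 x
  filter_upwards [h1 x, h2 x] with u ⟨a, ha, haf⟩ h4
  exact ⟨a, ha, haf.trans h4⟩

theorem upperEnergy_congr (h : F =ᵐ[markedLaw Q μ] F') :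
    upperEnergy Q d γ F = upperEnergy Q d γ F' := by
  refine lintegral_congr_ae ?_
  filter_upwards [ae_fiber h] with m h2
  refine tsum_congr fun x => lintegral_congr_ae ?_
  filter_upwards [h2 x] with u h4 using fiberEnergy_congr h4

theorem IsUpperCdc.fiberDom (h1 : IsUpperCdc Q μ d γ F F H) : FiberDom Q d F := by
  filter_upwards [h1.2] with m ⟨h, hp, hs⟩ x
  filter_upwards [(hp x).2] with u hu using hu.mem_left

namespace IsLocalForm

theorem fiberDom_add (hd : IsLocalForm μ d γ) (hF : FiberDom Q d F) (hG : FiberDom Q d G) :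
    FiberDom Q d fun ϖ => F ϖ + G ϖ := by
  filter_upwards [hF, hG] with m h1 h2 x
  filter_upwards [h1 x, h2 x] with u h3 h4 using hd.mem_add h3 h4

theorem fiberDom_sub (hd : IsLocalForm μ d γ) (hF : FiberDom Q d F) (hG : FiberDom Q d G) :
    FiberDom Q d fun ϖ => F ϖ - G ϖ := by
  filter_upwards [hF, hG] with m h1 h2 x
  filter_upwards [h1 x, h2 x] with u h3 h4 using hd.mem_sub h3 h4

/-- A measurable density for the carré du champ, with a measurable version of `γ[ε⁺F]`. -/
theorem exists_density (hd : IsLocalForm μ d γ) (hF : AEStronglyMeasurable F (markedLaw Q μ))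
    (hdom : FiberDom Q d F) :
    ∃ K : Config (X × Y) → X × Y → ℝ, (∀ ϖ z, 0 ≤ K ϖ z) ∧
      (Measurable fun ϖ => ∫⁻ z, ENNReal.ofReal (epsMinus K ϖ z) ∂ϖ.toMeasure) ∧
      ∀ᵐ m ∂Q, ∀ x : m.1, IsPartialCdc μ d γ x (fun u => F (m.mark u)) (fun u => F (m.mark u))
        (fun u => epsMinus K (m.mark u) (x, u x)) := by
  obtain ⟨F₁, hF₁, hFF⟩ := hF
  obtain ⟨K, hK0, hKm, hKx, hK⟩ := hd.exists_cdc_version (X := X) hF₁.measurable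
  refine ⟨K, hK0, hKm, ?_⟩
  filter_upwards [hdom.congr hFF, ae_ae_of_ae_markedLaw hFF] with m h1 h2 x
  have h3 : IsPartialCdc μ d γ x (fun u => F₁ (m.mark u)) (fun u => F₁ (m.mark u))
        (fun u => epsMinus K (m.mark u) (x, u x)) := by
    refine ⟨(hKx m x).aestronglyMeasurable, ?_⟩
    have h4 := hK m x (by simpa only [Config.mark_update] using h1 x)
    simp only [Config.mark_update] at h4
    filter_upwards [h4] with u hu
    simp only [Function.update_self]
    exact hu
  exact h3.congr (h2.mono fun u hu => hu.symm) (h2.mono fun u hu => hu.symm) EventuallyEq.rfl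

theorem lintegral_density (hd : IsLocalForm μ d γ) {K : Config (X × Y) → X × Y → ℝ}
    {m : Config X} (h : ∀ x : m.1, IsPartialCdc μ d γ x (fun u => F (m.mark u))
      (fun u => F (m.mark u)) (fun u => epsMinus K (m.mark u) (x, u x))) :
    ∫⁻ u, ∫⁻ z, ENNReal.ofReal (epsMinus K (m.mark u) z) ∂(m.mark u).toMeasure ∂marksLaw μ m.1 =
      ∑' x : m.1, ∫⁻ u, fiberEnergy d γ (fun v => F (m.remark u x v)) ∂marksLaw μ m.1 := by
  have : Countable m.1 := m.2.to_subtype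
  have e : ∀ u, ∫⁻ z, ENNReal.ofReal (epsMinus K (m.mark u) z) ∂(m.mark u).toMeasure =
      ∑' x : m.1, ENNReal.ofReal (epsMinus K (m.mark u) (x, u x)) := fun u => by
    rw [Config.lintegral_toMeasure,
      Config.tsum_mark m u fun z => ENNReal.ofReal (epsMinus K (m.mark u) z)]
  rw [lintegral_congr e, lintegral_tsum fun x => (h x).1.aemeasurable.ennreal_ofReal]
  exact tsum_congr fun x => hd.lintegral_partialCdc (h x)

theorem upperEnergy_eq_lintegral (hd : IsLocalForm μ d γ) {K : Config (X × Y) → X × Y → ℝ}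
    (hm : Measurable fun ϖ => ∫⁻ z, ENNReal.ofReal (epsMinus K ϖ z) ∂ϖ.toMeasure)
    (h : ∀ᵐ m ∂Q, ∀ x : m.1, IsPartialCdc μ d γ x (fun u => F (m.mark u))
      (fun u => F (m.mark u)) (fun u => epsMinus K (m.mark u) (x, u x))) :
    ∫⁻ ϖ, ∫⁻ z, ENNReal.ofReal (epsMinus K ϖ z) ∂ϖ.toMeasure ∂markedLaw Q μ =
      upperEnergy Q d γ F := by
  rw [lintegral_markedLaw hm.aemeasurable]
  refine lintegral_congr_ae ?_
  filter_upwards [h] with m hm using hd.lintegral_density hm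

theorem aemeasurable_fiber (hd : IsLocalForm μ d γ) (hF : AEStronglyMeasurable F (markedLaw Q μ))
    (hdom : FiberDom Q d F) :
    (∀ᵐ m ∂Q, ∀ x : m.1, AEMeasurable (fun u => fiberEnergy d γ fun v =>
      F (m.remark u x v)) (marksLaw μ m.1)) ∧
    AEMeasurable (fun m : Config X => ∑' x : m.1, ∫⁻ u, fiberEnergy d γ
      (fun v => F (m.remark u x v)) ∂marksLaw μ m.1) Q := by
  obtain ⟨K, hK0, hKm, hK⟩ := hd.exists_density hF hdom
  constructor
  · filter_upwards [hK] with m hm x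
    exact hd.aemeasurable_fiberEnergy (hm x)
  · refine (aemeasurable_lintegral_marks (μ := μ) hKm.aemeasurable).congr ?_
    filter_upwards [hK] with m hm
    exact hd.lintegral_density hm

/-- Membership in the domain reduces to fibrewise membership and finite total energy. The witness is
∫ ε⁻K dN for the version K whose integral is measurable in the configuration. -/
theorem exists_upperCdc (hd : IsLocalForm μ d γ) (hF : AEStronglyMeasurable F (markedLaw Q μ))
    (hdom : FiberDom Q d F) (hE : upperEnergy Q d γ F ≠ ⊤) :
    ∃ H, IsUpperCdc Q μ d γ F F H := by
  obtain ⟨K, hK0, hKm, hK⟩ := hd.exists_density hF hdom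
  rw [← hd.upperEnergy_eq_lintegral hKm hK] at hE
  refine ⟨fun ϖ => (∫⁻ z, ENNReal.ofReal (epsMinus K ϖ z) ∂ϖ.toMeasure).toReal,
    integrable_toReal_of_lintegral_ne_top hKm.aemeasurable hE, ?_⟩
  filter_upwards [hK, ae_ae_of_ae_markedLaw (ae_lt_top hKm hE)] with m hm hfin
  refine ⟨_, hm, ?_⟩
  filter_upwards [hfin] with u hu
  rw [Config.lintegral_toMeasure, Config.tsum_mark m u
    fun z => ENNReal.ofReal (epsMinus K (m.mark u) z)] at hu
  have h1 := ENNReal.hasSum_toReal hu.ne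
  simp only [ENNReal.toReal_ofReal (hK0 _ _), epsMinus] at h1
  rw [Config.lintegral_toMeasure, Config.tsum_mark m u
    fun z => ENNReal.ofReal (epsMinus K (m.mark u) z)]
  simp only [epsMinus] at h1 ⊢
  rw [ENNReal.tsum_toReal_eq fun _ => ENNReal.ofReal_ne_top]
  simpa only [ENNReal.toReal_ofReal (hK0 _ _)] using h1

theorem lintegral_upperCdc (hd : IsLocalForm μ d γ) (h : IsUpperCdc Q μ d γ F F H) :
    ∫⁻ ϖ, ENNReal.ofReal (H ϖ) ∂markedLaw Q μ = upperEnergy Q d γ F := by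
  rw [lintegral_markedLaw h.1.1.aemeasurable.ennreal_ofReal]
  refine lintegral_congr_ae ?_
  filter_upwards [h.2] with m hm
  have : Countable m.1 := m.2.to_subtype
  exact hd.lintegral_sumCdc hm

theorem upperEnergy_ne_top (hd : IsLocalForm μ d γ) (h : IsUpperCdc Q μ d γ F F H) :
    upperEnergy Q d γ F ≠ ⊤ := by
  rw [← hd.lintegral_upperCdc h]
  exact h.1.lintegral_lt_top.ne

theorem upperCdc_nonneg (hd : IsLocalForm μ d γ) (h : IsUpperCdc Q μ d γ F F H) :
    ∀ᵐ ϖ ∂markedLaw Q μ, 0 ≤ H ϖ := by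
  refine ae_markedLaw_of_ae_ae (nullMeasurableSet_le aemeasurable_const h.1.1.aemeasurable) ?_
  filter_upwards [h.2] with m hm
  have : Countable m.1 := m.2.to_subtype
  exact hd.sumCdc_nonneg hm

theorem integral_upperCdc (hd : IsLocalForm μ d γ) (h : IsUpperCdc Q μ d γ F F H) :
    ∫ ϖ, H ϖ ∂markedLaw Q μ = (upperEnergy Q d γ F).toReal := by
  rw [← hd.lintegral_upperCdc h, integral_eq_lintegral_of_nonneg_ae (hd.upperCdc_nonneg h) h.1.1]

theorem upperEnergy_add_le (hd : IsLocalForm μ d γ)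
    (hF : AEStronglyMeasurable F (markedLaw Q μ)) (hdF : FiberDom Q d F)
    (hG : AEStronglyMeasurable G (markedLaw Q μ)) (hdG : FiberDom Q d G) :
    upperEnergy Q d γ (fun ϖ => F ϖ + G ϖ) ≤
      2 * upperEnergy Q d γ F + 2 * upperEnergy Q d γ G := by
  obtain ⟨hF1, hF2⟩ := hd.aemeasurable_fiber hF hdF
  obtain ⟨hG1, hG2⟩ := hd.aemeasurable_fiber hG hdG
  rw [upperEnergy, upperEnergy, upperEnergy, ← lintegral_const_mul'' _ hF2,
    ← lintegral_const_mul'' _ hG2, ← lintegral_add_left' (hF2.const_mul 2)]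
  refine lintegral_mono_ae ?_
  filter_upwards [hF1, hG1] with m h1 h2
  rw [← ENNReal.tsum_mul_left, ← ENNReal.tsum_mul_left, ← ENNReal.tsum_add]
  refine ENNReal.tsum_le_tsum fun x => ?_
  rw [← lintegral_const_mul'' _ (h1 x), ← lintegral_const_mul'' _ (h2 x),
    ← lintegral_add_left' ((h1 x).const_mul 2)]
  exact lintegral_mono fun u => hd.fiberEnergy_add_le _ _

theorem upperEnergy_smul (hd : IsLocalForm μ d γ) (c : ℝ)
    (hF : AEStronglyMeasurable F (markedLaw Q μ)) (hdF : FiberDom Q d F) :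
    upperEnergy Q d γ (fun ϖ => c * F ϖ) = ENNReal.ofReal (c ^ 2) * upperEnergy Q d γ F := by
  obtain ⟨hF1, hF2⟩ := hd.aemeasurable_fiber hF hdF
  rw [upperEnergy, upperEnergy, ← lintegral_const_mul'' _ hF2]
  refine lintegral_congr_ae ?_
  filter_upwards [hF1, hdF] with m h1 h2
  rw [← ENNReal.tsum_mul_left]
  refine tsum_congr fun x => ?_
  rw [← lintegral_const_mul'' _ (h1 x)]
  refine lintegral_congr_ae ?_
  filter_upwards [h2 x] with u h3 using hd.fiberEnergy_smul_le c h3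

theorem fiberDom_contraction (hd : IsLocalForm μ d γ) {φ : ℝ → ℝ} (hφ : LipschitzWith 1 φ)
    (h0 : φ 0 = 0) (hF : FiberDom Q d F) : FiberDom Q d fun ϖ => φ (F ϖ) := by
  filter_upwards [hF] with m h1 x
  filter_upwards [h1 x] with u h2 using (hd.fiberEnergy_contraction hφ h0 h2).1

theorem upperEnergy_contraction (hd : IsLocalForm μ d γ) {φ : ℝ → ℝ} (hφ : LipschitzWith 1 φ)
    (h0 : φ 0 = 0) (hF : FiberDom Q d F) :
    upperEnergy Q d γ (fun ϖ => φ (F ϖ)) ≤ upperEnergy Q d γ F := by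
  refine lintegral_mono_ae ?_
  filter_upwards [hF] with m h1
  refine ENNReal.tsum_le_tsum fun x => lintegral_mono_ae ?_
  filter_upwards [h1 x] with u h2 using (hd.fiberEnergy_contraction hφ h0 h2).2

theorem upperCdc_symm (hd : IsLocalForm μ d γ) (h1 : IsUpperCdc Q μ d γ F G H) :
    IsUpperCdc Q μ d γ G F H :=
  ⟨h1.1, h1.2.mono fun _ h => hd.sumCdc_symm h⟩

theorem upperCdc_add (hd : IsLocalForm μ d γ) (h1 : IsUpperCdc Q μ d γ F G H)
    (h2 : IsUpperCdc Q μ d γ F' G H') :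
    IsUpperCdc Q μ d γ (fun ϖ => F ϖ + F' ϖ) G (fun ϖ => H ϖ + H' ϖ) :=
  ⟨h1.1.add h2.1, by filter_upwards [h1.2, h2.2] with m e1 e2 using hd.sumCdc_add e1 e2⟩

theorem upperCdc_smul (hd : IsLocalForm μ d γ) (c : ℝ) (h1 : IsUpperCdc Q μ d γ F G H) :
    IsUpperCdc Q μ d γ (fun ϖ => c * F ϖ) G (fun ϖ => c * H ϖ) :=
  ⟨h1.1.const_mul c, h1.2.mono fun _ h => hd.sumCdc_smul c h⟩

theorem exists_upperCdc_add (hd : IsLocalForm μ d γ) (hF : AEStronglyMeasurable F (markedLaw Q μ))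
    (hG : AEStronglyMeasurable G (markedLaw Q μ)) (h1 : IsUpperCdc Q μ d γ F F H)
    (h2 : IsUpperCdc Q μ d γ G G H') :
    ∃ K, IsUpperCdc Q μ d γ (fun ϖ => F ϖ + G ϖ) (fun ϖ => F ϖ + G ϖ) K := by
  refine hd.exists_upperCdc (hF.add hG) (hd.fiberDom_add h1.fiberDom h2.fiberDom) ?_
  refine ne_top_of_le_ne_top ?_ (hd.upperEnergy_add_le hF h1.fiberDom hG h2.fiberDom)
  exact ENNReal.add_ne_top.2 ⟨ENNReal.mul_ne_top (by simp) (hd.upperEnergy_ne_top h1),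
    ENNReal.mul_ne_top (by simp) (hd.upperEnergy_ne_top h2)⟩

/-- Polarisation: Γ[F, G] = ½(Γ[F + G] - Γ[F] - Γ[G]). -/
theorem exists_upperCdc_cross (hd : IsLocalForm μ d γ)
    (hF : AEStronglyMeasurable F (markedLaw Q μ))
    (hG : AEStronglyMeasurable G (markedLaw Q μ)) (h1 : IsUpperCdc Q μ d γ F F H)
    (h2 : IsUpperCdc Q μ d γ G G H') : ∃ K, IsUpperCdc Q μ d γ F G K := by
  obtain ⟨K, hK⟩ := hd.exists_upperCdc_add hF hG h1 h2
  refine ⟨_, ((hK.1.sub h1.1).sub h2.1).const_mul (1 / 2), ?_⟩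
  filter_upwards [h1.2, h2.2, hK.2] with m e1 e2 e3
  exact hd.sumCdc_polar e1 e2 e3

end IsLocalForm

end UpperForm

/-! ### The axioms of a local form for the upper structure -/

section UpperLocalForm

variable {X Y : Type*} [MeasurableSpace X] [MeasurableSingletonClass X]
  [MeasurableSpace Y] [MeasurableSingletonClass Y] {Q : Measure (Config X)}
  {μ : Measure Y} [IsProbabilityMeasure μ]
  {d : Set (Lp ℝ 2 μ)} {γ : Lp ℝ 2 μ → Lp ℝ 2 μ → Lp ℝ 1 μ}
  {F G : Lp ℝ 2 (markedLaw Q μ)}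

theorem isUpperCdc_of_mem (hF : F ∈ upperDom Q μ d γ) :
    IsUpperCdc Q μ d γ F F (upperCdc Q μ d γ F F) := by
  obtain ⟨H, hH⟩ := hF
  exact hH.congr EventuallyEq.rfl EventuallyEq.rfl (upperCdc_ae_eq hH).symm

theorem upperCdc_eq {A : Lp ℝ 1 (markedLaw Q μ)} (h : IsUpperCdc Q μ d γ F G A) :
    upperCdc Q μ d γ F G = A := Lp.ext (upperCdc_ae_eq h)

namespace IsLocalForm

theorem isUpperCdc (hd : IsLocalForm μ d γ) (hF : F ∈ upperDom Q μ d γ)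
    (hG : G ∈ upperDom Q μ d γ) : IsUpperCdc Q μ d γ F G (upperCdc Q μ d γ F G) := by
  obtain ⟨K, hK⟩ := hd.exists_upperCdc_cross (Lp.aestronglyMeasurable F)
    (Lp.aestronglyMeasurable G) (isUpperCdc_of_mem hF) (isUpperCdc_of_mem hG)
  exact hK.congr EventuallyEq.rfl EventuallyEq.rfl (upperCdc_ae_eq hK).symm

theorem mem_upperDom (hd : IsLocalForm μ d γ) (h1 : FiberDom Q d F)
    (h2 : upperEnergy Q d γ F ≠ ⊤) : F ∈ upperDom Q μ d γ :=
  hd.exists_upperCdc (Lp.aestronglyMeasurable F) h1 h2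

theorem energy_upperCdc (hd : IsLocalForm μ d γ) (hF : F ∈ upperDom Q μ d γ) :
    energy (upperCdc Q μ d γ) F F = (1 / 2) * (upperEnergy Q d γ F).toReal := by
  rw [energy, hd.integral_upperCdc (isUpperCdc_of_mem hF)]

theorem zero_mem_upperDom (hd : IsLocalForm μ d γ) : 0 ∈ upperDom Q μ d γ := by
  refine ⟨fun _ => 0, integrable_zero _ _ _, ?_⟩
  filter_upwards [ae_ae_of_ae_markedLaw (Lp.coeFn_zero ℝ 2 (markedLaw Q μ))] with m hm
  have h0 : IsSumCdc μ d γ (fun _ : m.1 → Y => 0) (fun _ => 0) (fun _ => 0) := by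
    refine ⟨fun _ _ => 0, fun x => ⟨aestronglyMeasurable_const, ae_of_all _ fun u => ?_⟩,
      ae_of_all _ fun u => hasSum_zero⟩
    exact hd.hasCdc_const ⟨0, hd.zero_mem, Lp.coeFn_zero ℝ 2 μ⟩ EventuallyEq.rfl
  refine h0.congr ?_ ?_ EventuallyEq.rfl
  · filter_upwards [hm] with u hu using hu.symm
  · filter_upwards [hm] with u hu using hu.symm

theorem add_mem_upperDom (hd : IsLocalForm μ d γ) (hF : F ∈ upperDom Q μ d γ)
    (hG : G ∈ upperDom Q μ d γ) : F + G ∈ upperDom Q μ d γ := by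
  obtain ⟨K, hK⟩ := hd.exists_upperCdc_add (Lp.aestronglyMeasurable F)
    (Lp.aestronglyMeasurable G) (isUpperCdc_of_mem hF) (isUpperCdc_of_mem hG)
  have e := (Lp.coeFn_add F G).symm
  exact ⟨K, hK.congr e e EventuallyEq.rfl⟩

theorem smul_mem_upperDom (hd : IsLocalForm μ d γ) (c : ℝ) (hF : F ∈ upperDom Q μ d γ) :
    c • F ∈ upperDom Q μ d γ := by
  have e := (Lp.coeFn_smul c F).symm
  exact ⟨_, (hd.upperCdc_smul c (hd.upperCdc_symm (hd.upperCdc_smul c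
    (isUpperCdc_of_mem hF)))).congr e e EventuallyEq.rfl⟩

theorem sub_mem_upperDom (hd : IsLocalForm μ d γ) (hF : F ∈ upperDom Q μ d γ)
    (hG : G ∈ upperDom Q μ d γ) : F - G ∈ upperDom Q μ d γ := by
  rw [sub_eq_add_neg, ← neg_one_smul ℝ]
  exact hd.add_mem_upperDom hF (hd.smul_mem_upperDom _ hG)

theorem energy_upperCdc_add_le (hd : IsLocalForm μ d γ) (hF : F ∈ upperDom Q μ d γ)
    (hG : G ∈ upperDom Q μ d γ) : energy (upperCdc Q μ d γ) (F + G) (F + G) ≤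
      2 * energy (upperCdc Q μ d γ) F F + 2 * energy (upperCdc Q μ d γ) G G := by
  rw [hd.energy_upperCdc hF, hd.energy_upperCdc hG,
    hd.energy_upperCdc (hd.add_mem_upperDom hF hG)]
  have h1 := hd.upperEnergy_ne_top (isUpperCdc_of_mem hF)
  have h2 := hd.upperEnergy_ne_top (isUpperCdc_of_mem hG)
  have h := hd.upperEnergy_add_le (Lp.aestronglyMeasurable F) (isUpperCdc_of_mem hF).fiberDom
    (Lp.aestronglyMeasurable G) (isUpperCdc_of_mem hG).fiberDom
  replace h := (upperEnergy_congr (d := d) (γ := γ) (Lp.coeFn_add F G)).trans_le h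
  have h3 := ENNReal.toReal_mono (ENNReal.add_ne_top.2
    ⟨ENNReal.mul_ne_top (by simp) h1, ENNReal.mul_ne_top (by simp) h2⟩) h
  rw [ENNReal.toReal_add (ENNReal.mul_ne_top (by simp) h1) (ENNReal.mul_ne_top (by simp) h2),
    ENNReal.toReal_mul, ENNReal.toReal_mul, ENNReal.toReal_ofNat] at h3
  linarith

theorem contraction_upperDom (hd : IsLocalForm μ d γ) {φ : ℝ → ℝ} (hφ : LipschitzWith 1 φ)
    (h0 : φ 0 = 0) (hF : F ∈ upperDom Q μ d γ) :
    hφ.compLp h0 F ∈ upperDom Q μ d γ ∧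
      energy (upperCdc Q μ d γ) (hφ.compLp h0 F) (hφ.compLp h0 F) ≤
        energy (upperCdc Q μ d γ) F F := by
  have e := hφ.coeFn_compLp h0 F
  have hdF := (isUpperCdc_of_mem hF).fiberDom
  have h1 := hd.upperEnergy_ne_top (isUpperCdc_of_mem hF)
  have h2 := hd.upperEnergy_contraction hφ h0 hdF
  have e' : upperEnergy Q d γ (hφ.compLp h0 F) = upperEnergy Q d γ fun ϖ => φ (F ϖ) :=
    upperEnergy_congr e
  have hm : hφ.compLp h0 F ∈ upperDom Q μ d γ := by
    refine hd.mem_upperDom ((hd.fiberDom_contraction hφ h0 hdF).congr e.symm) ?_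
    rw [e']
    exact ne_top_of_le_ne_top h1 h2
  refine ⟨hm, ?_⟩
  rw [hd.energy_upperCdc hm, hd.energy_upperCdc hF, e']
  have := ENNReal.toReal_mono h1 h2
  linarith

/-- An integral vanishes if it does so in each mark. -/
theorem _root_.integral_markedLaw_eq_zero {Φ : Config (X × Y) → ℝ}
    (hΦ : Integrable Φ (markedLaw Q μ))
    (h : ∀ᵐ m ∂Q, ∫ u, Φ (m.mark u) ∂marksLaw μ m.1 = 0) :
    ∫ ϖ, Φ ϖ ∂markedLaw Q μ = 0 := by
  refine le_antisymm ?_ (integral_markedLaw_nonneg hΦ (h.mono fun m hm => hm.ge))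
  have := integral_markedLaw_nonneg hΦ.neg (h.mono fun m hm => ?_)
  · simpa [integral_neg] using this
  · simp only [Pi.neg_apply]
    rw [integral_neg, hm, neg_zero]

/-- In almost every fibre, locality of the form on Y says that γ acting on the mark of x in `a` and
`b` has mean zero in that mark; `integral_eq_zero_of_update` sums over x. -/
theorem upper_local_form (hd : IsLocalForm μ d γ) (hF : F ∈ upperDom Q μ d γ) {φ ψ : ℝ → ℝ}
    (hφ : ContDiff ℝ ∞ φ) (hψ : ContDiff ℝ ∞ ψ) (hφc : HasCompactSupport φ)
    (hψc : HasCompactSupport ψ) (hdisj : Disjoint (tsupport φ) (tsupport ψ))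
    {a b : Lp ℝ 2 (markedLaw Q μ)} (ha : a ∈ upperDom Q μ d γ) (hb : b ∈ upperDom Q μ d γ)
    (haF : a =ᵐ[markedLaw Q μ] fun ϖ => φ (F ϖ) - φ 0)
    (hbF : b =ᵐ[markedLaw Q μ] fun ϖ => ψ (F ϖ) - ψ 0) :
    energy (upperCdc Q μ d γ) a b = 0 := by
  classical
  have hab := hd.isUpperCdc ha hb
  have haa := isUpperCdc_of_mem ha
  have hbb := isUpperCdc_of_mem hb
  rw [energy, integral_markedLaw_eq_zero hab.1, mul_zero]
  filter_upwards [hab.2, haa.2, hbb.2, integrable_mark haa.1, integrable_mark hbb.1,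
    (isUpperCdc_of_mem hF).fiberDom, ae_fiber haF, ae_fiber hbF]
    with m ⟨κ, hκ, hs⟩ h2 h3 h4 h5 h6 h7 h8
  have : Countable m.1 := m.2.to_subtype
  refine integral_eq_zero_of_update (fun x => (hκ x).1)
    (hd.tsum_lintegral_enorm_ne_top hκ h2 h3 h4 h5) hs fun x => ?_
  filter_upwards [(hκ x).2, h6 x, h7 x, h8 x] with u ⟨a', ha', b', hb', haa', hbb', hab'⟩
    ⟨f, hf, hfF⟩ k7 k8
  have e1 : energy γ a' b' = 0 := by
    refine hd.local_form f hf φ ψ hφ hψ hφc hψc hdisj a' ha' b' hb' ?_ ?_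
    · filter_upwards [haa', k7, hfF] with v j1 j2 j3
      rw [j1, j3, ← j2, Config.remark]
    · filter_upwards [hbb', k8, hfF] with v j1 j2 j3
      rw [j1, j3, ← j2, Config.remark]
  rw [energy, integral_congr_ae hab'] at e1
  simpa using e1

/-- The identity asserts that ½(Γ[fh, g] + Γ[gh, f] - Γ[h, fg]) - hΓ[f, g] has integral zero. This
is a sum over the points, and each term has mean zero in its own mark by the identity on Y;
boundedness of h keeps everything integrable. -/
theorem upper_carre_du_champ (hd : IsLocalForm μ d γ) {f g h fh gh fg : Lp ℝ 2 (markedLaw Q μ)}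
    (hf : f ∈ upperDom Q μ d γ) (hg : g ∈ upperDom Q μ d γ) (hh : h ∈ upperDom Q μ d γ)
    (bf : EssBounded f) (bg : EssBounded g) (bh : EssBounded h)
    (hfh : fh ∈ upperDom Q μ d γ) (hgh : gh ∈ upperDom Q μ d γ) (hfg : fg ∈ upperDom Q μ d γ)
    (efh : fh =ᵐ[markedLaw Q μ] fun ϖ => f ϖ * h ϖ)
    (egh : gh =ᵐ[markedLaw Q μ] fun ϖ => g ϖ * h ϖ)
    (efg : fg =ᵐ[markedLaw Q μ] fun ϖ => f ϖ * g ϖ) :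
    energy (upperCdc Q μ d γ) fh g + energy (upperCdc Q μ d γ) gh f -
      energy (upperCdc Q μ d γ) h fg = ∫ ϖ, h ϖ * upperCdc Q μ d γ f g ϖ ∂markedLaw Q μ := by
  classical
  obtain ⟨Cf, hCf⟩ := bf
  obtain ⟨Cg, hCg⟩ := bg
  obtain ⟨Ch, hCh⟩ := bh
  have A := hd.isUpperCdc hfh hg
  have B := hd.isUpperCdc hgh hf
  have C := hd.isUpperCdc hh hfg
  have D := hd.isUpperCdc hf hg
  have hhD : Integrable (fun ϖ => h ϖ * upperCdc Q μ d γ f g ϖ) (markedLaw Q μ) :=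
    D.1.bdd_mul (Lp.aestronglyMeasurable h) hCh
  have hABC : Integrable (fun ϖ => (1 / 2) * (upperCdc Q μ d γ fh g ϖ + upperCdc Q μ d γ gh f ϖ -
      upperCdc Q μ d γ h fg ϖ)) (markedLaw Q μ) := ((A.1.add B.1).sub C.1).const_mul _
  have hAB : Integrable (fun ϖ => upperCdc Q μ d γ fh g ϖ + upperCdc Q μ d γ gh f ϖ)
    (markedLaw Q μ) := A.1.add B.1
  have key := integral_markedLaw_eq_zero (hABC.sub hhD) ?_
  · simp only [Pi.sub_apply] at key
    rw [integral_sub hABC hhD, integral_const_mul, integral_sub hAB C.1,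
      integral_add A.1 B.1] at key
    rw [energy, energy, energy]
    linarith
  have Sf := isUpperCdc_of_mem hf
  have Sg := isUpperCdc_of_mem hg
  have Sh := isUpperCdc_of_mem hh
  have Sfh := isUpperCdc_of_mem hfh
  have Sgh := isUpperCdc_of_mem hgh
  have Sfg := isUpperCdc_of_mem hfg
  filter_upwards [A.2, B.2, C.2, D.2, Sf.2.and (integrable_mark Sf.1),
    Sg.2.and (integrable_mark Sg.1), Sh.2.and (integrable_mark Sh.1),
    Sfh.2.and (integrable_mark Sfh.1), Sgh.2.and (integrable_mark Sgh.1),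
    Sfg.2.and (integrable_mark Sfg.1), Sh.fiberDom, ae_fiber efh, ae_fiber egh, ae_fiber efg,
    ae_fiber hCf, ae_fiber hCg, ae_fiber hCh, ae_ae_of_ae_markedLaw hCh,
    aestronglyMeasurable_mark (Lp.aestronglyMeasurable h)]
    with m ⟨α, hα, sα⟩ ⟨β, hβ, sβ⟩ ⟨κ, hκ, sκ⟩ ⟨δ, hδ, sδ⟩ mf mg mh mfh mgh mfg dh k1 k2 k3 kf kg kh
      kb km
  have : Countable m.1 := m.2.to_subtype
  have tα := hd.tsum_lintegral_enorm_ne_top hα mfh.1 mg.1 mfh.2 mg.2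
  have tβ := hd.tsum_lintegral_enorm_ne_top hβ mgh.1 mf.1 mgh.2 mf.2
  have tκ := hd.tsum_lintegral_enorm_ne_top hκ mh.1 mfg.1 mh.2 mfg.2
  have tδ := hd.tsum_lintegral_enorm_ne_top hδ mf.1 mg.1 mf.2 mg.2
  refine integral_eq_zero_of_update
    (φ := fun x u => (1 / 2) * (α x u + β x u - κ x u) - h (m.mark u) * δ x u)
    (fun x => ((((hα x).1.add (hβ x).1).sub (hκ x).1).const_mul _).sub (km.mul (hδ x).1))
    ?_ ?_ fun x => ?_
  · have hle : ∀ x : m.1, ∫⁻ u, ‖(1 / 2) * (α x u + β x u - κ x u) - h (m.mark u) * δ x u‖ₑ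
        ∂marksLaw μ m.1 ≤ ∫⁻ u, ‖α x u‖ₑ ∂marksLaw μ m.1 + ∫⁻ u, ‖β x u‖ₑ ∂marksLaw μ m.1 +
          ∫⁻ u, ‖κ x u‖ₑ ∂marksLaw μ m.1 +
          ENNReal.ofReal Ch * ∫⁻ u, ‖δ x u‖ₑ ∂marksLaw μ m.1 := by
      intro x
      have s2 : AEMeasurable (fun u => ‖α x u‖ₑ + ‖β x u‖ₑ) (marksLaw μ m.1) :=
        (hα x).1.enorm.add (hβ x).1.enorm
      have s3 : AEMeasurable (fun u => ‖α x u‖ₑ + ‖β x u‖ₑ + ‖κ x u‖ₑ) (marksLaw μ m.1) :=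
        s2.add (hκ x).1.enorm
      rw [← lintegral_const_mul'' _ (hδ x).1.enorm, ← lintegral_add_left' (hα x).1.enorm,
        ← lintegral_add_left' s2, ← lintegral_add_left' s3]
      refine lintegral_mono_ae ?_
      filter_upwards [kb] with u hu
      have hC0 : 0 ≤ Ch := (abs_nonneg _).trans hu
      rw [← ofReal_norm, ← ofReal_norm, ← ofReal_norm, ← ofReal_norm, ← ofReal_norm,
        ← ENNReal.ofReal_mul hC0, ← ENNReal.ofReal_add (norm_nonneg _) (norm_nonneg _),
        ← ENNReal.ofReal_add (by positivity) (norm_nonneg _),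
        ← ENNReal.ofReal_add (by positivity) (by positivity)]
      refine ENNReal.ofReal_le_ofReal ?_
      simp only [Real.norm_eq_abs]
      have j1 : |h (m.mark u) * δ x u| ≤ Ch * |δ x u| := by
        rw [abs_mul]
        exact mul_le_mul_of_nonneg_right hu (abs_nonneg _)
      have j2 := abs_sub ((1 / 2) * (α x u + β x u - κ x u)) (h (m.mark u) * δ x u)
      have j3 : |(1 / 2) * (α x u + β x u - κ x u)| ≤ |α x u| + |β x u| + |κ x u| := by
        rw [abs_mul, abs_of_pos (by norm_num : (0 : ℝ) < 1 / 2)]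
        have := abs_sub (α x u + β x u) (κ x u)
        have := abs_add_le (α x u) (β x u)
        have := abs_nonneg (α x u + β x u - κ x u)
        linarith
      linarith
    refine ne_top_of_le_ne_top ?_ (ENNReal.tsum_le_tsum hle)
    rw [ENNReal.tsum_add, ENNReal.tsum_add, ENNReal.tsum_add, ENNReal.tsum_mul_left]
    exact ENNReal.add_ne_top.2 ⟨ENNReal.add_ne_top.2 ⟨ENNReal.add_ne_top.2 ⟨tα, tβ⟩, tκ⟩,
      ENNReal.mul_ne_top ENNReal.ofReal_ne_top tδ⟩
  · filter_upwards [sα, sβ, sκ, sδ] with u e1 e2 e3 e4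
    exact (((e1.add e2).sub e3).mul_left _).sub (e4.mul_left _)
  filter_upwards [(hα x).2, (hβ x).2, (hκ x).2, (hδ x).2, k1 x, k2 x, k3 x, kf x, kg x, kh x]
    with u ⟨a1, ha1, b1, hb1, p1, q1, r1⟩ ⟨a2, ha2, b2, hb2, p2, q2, r2⟩
    ⟨a3, ha3, b3, hb3, p3, q3, r3⟩ ⟨a4, ha4, b4, hb4, p4, q4, r4⟩ e1 e2 e3 ef eg eh
  -- The classes obtained from different cross terms represent the same fibre functions and must be
  -- identified before the identity on Y applies.
  obtain rfl : b1 = b4 := Lp.ext (q1.trans q4.symm)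
  obtain rfl : b2 = a4 := Lp.ext (q2.trans p4.symm)
  have e := hd.carre_du_champ b2 hb2 b1 hb1 a3 ha3 ?_ ?_ ?_ a1 ha1 a2 ha2 b3 hb3 ?_ ?_ ?_
  · have hb : ∀ᵐ v ∂μ, ‖a3 v‖ ≤ Ch := by
      filter_upwards [eh, p3] with v j1 j2
      rw [j2]
      exact j1
    have i1 : Integrable (fun v => a3 v * γ b2 b1 v) μ :=
      (L1.integrable_coeFn _).bdd_mul (Lp.aestronglyMeasurable a3) hb
    have i2 : Integrable (fun v => γ a1 b1 v + γ a2 b2 v) μ :=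
      (L1.integrable_coeFn _).add (L1.integrable_coeFn _)
    have i3 : Integrable (fun v => (1 / 2) * (γ a1 b1 v + γ a2 b2 v - γ a3 b3 v)) μ :=
      (i2.sub (L1.integrable_coeFn _)).const_mul _
    have hint : ∫ v, (1 / 2) * (γ a1 b1 v + γ a2 b2 v - γ a3 b3 v) - a3 v * γ b2 b1 v ∂μ = 0 := by
      rw [integral_sub i3 i1, integral_const_mul, integral_sub i2 (L1.integrable_coeFn _),
        integral_add (L1.integrable_coeFn _) (L1.integrable_coeFn _), ← e]
      simp only [energy]
      ring
    rw [← hint]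
    refine integral_congr_ae ?_
    filter_upwards [r1, r2, r3, r4, p3] with v j1 j2 j3 j4 j5
    rw [j1, j2, j3, j4, j5]
  · refine ⟨Cf, ?_⟩
    filter_upwards [ef, q2] with v j1 j2
    rw [j2]
    exact j1
  · refine ⟨Cg, ?_⟩
    filter_upwards [eg, q1] with v j1 j2
    rw [j2]
    exact j1
  · refine ⟨Ch, ?_⟩
    filter_upwards [eh, p3] with v j1 j2
    rw [j2]
    exact j1
  · filter_upwards [p1, q2, p3, e1] with v j1 j2 j3 j4
    rw [j1, j2, j3]
    exact j4
  · filter_upwards [p2, q1, p3, e2] with v j1 j2 j3 j4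
    rw [j1, j2, j3]
    exact j4
  · filter_upwards [q3, q2, q1, e3] with v j1 j2 j3 j4
    rw [j1, j2, j3]
    exact j4

/-- Superadditivity of the lower integral needs no measurability, so it applies to fibres of
functions that are only almost everywhere measurable. -/
theorem _root_.tsum_lintegral_le {α : Type*} [MeasurableSpace α] {ν : Measure α}
    (f : ℕ → α → ℝ≥0∞) : ∑' k, ∫⁻ a, f k a ∂ν ≤ ∫⁻ a, ∑' k, f k a ∂ν := by
  refine ENNReal.tsum_le_of_sum_range_le fun n => ?_
  have h : ∀ n, ∑ k ∈ Finset.range n, ∫⁻ a, f k a ∂ν ≤ ∫⁻ a, ∑ k ∈ Finset.range n, f k a ∂ν := by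
    intro n
    induction n with
    | zero => simp
    | succ n ih =>
      simp only [Finset.sum_range_succ]
      exact (add_le_add_left ih _).trans (le_lintegral_add _ _)
  exact (h n).trans (lintegral_mono fun a => ENNReal.sum_le_tsum _)

theorem _root_.ae_lintegral_remark_ne_top {W : Config (X × Y) → ℝ≥0∞}
    (hW : AEMeasurable W (markedLaw Q μ)) (hfin : ∫⁻ ϖ, W ϖ ∂markedLaw Q μ ≠ ⊤) :
    ∀ᵐ m ∂Q, ∀ x : m.1, ∀ᵐ u ∂marksLaw μ m.1, ∫⁻ v, W (m.remark u x v) ∂μ ≠ ⊤ := by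
  classical
  obtain ⟨W', hW', hWW⟩ := hW
  rw [lintegral_congr_ae hWW, lintegral_markedLaw hW'.aemeasurable] at hfin
  filter_upwards [ae_lt_top' (aemeasurable_lintegral_marks (μ := μ) hW'.aemeasurable) hfin,
    ae_fiber hWW] with m hm h1 x
  have h2 : Measurable fun u => W' (m.mark u) := hW'.comp (Config.measurable_mark m)
  have h3 := lintegral_update (μ := μ) x h2.aemeasurable
  have h4 : Measurable fun u => ∫⁻ v, W' (m.mark (Function.update u x v)) ∂μ :=
    (h2.comp (measurable_update_marks x)).lintegral_prod_right'
  rw [← h3] at hm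
  filter_upwards [ae_lt_top h4 hm.ne, h1 x] with u k1 k2
  rw [lintegral_congr_ae k2]
  simpa only [Config.mark_update] using k1.ne

theorem fiberEnergy_le (hd : IsLocalForm μ d γ) {F H : Config (X × Y) → ℝ}
    (h : IsUpperCdc Q μ d γ F F H) : ∀ᵐ m ∂Q, ∀ x : m.1, ∀ᵐ u ∂marksLaw μ m.1,
      fiberEnergy d γ (fun v => F (m.remark u x v)) ≤
        ∫⁻ v, ENNReal.ofReal (H (m.remark u x v)) ∂μ := by
  classical
  filter_upwards [h.2] with m ⟨κ, hκ, hs⟩ x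
  have : Countable m.1 := m.2.to_subtype
  have h1 : ∀ᵐ u ∂marksLaw μ m.1, κ x u ≤ H (m.mark u) := by
    filter_upwards [hs, ae_all_iff.2 fun y => hd.partialCdc_nonneg (hκ y)] with u e1 e2
    exact le_hasSum e1 x fun y _ => e2 y
  filter_upwards [(hκ x).2, ae_ae_update x h1] with u e1 e2
  refine (e1.lintegral_eq hd).symm.trans_le (lintegral_mono_ae ?_)
  filter_upwards [e2] with v hv
  rw [Config.mark_update] at hv
  refine ENNReal.ofReal_le_ofReal ?_
  convert hv

theorem _root_.lintegral_ofReal_sq {α : Type*} [MeasurableSpace α] {ν : Measure α} (a : Lp ℝ 2 ν) :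
    ∫⁻ v, ENNReal.ofReal (a v ^ 2) ∂ν = ENNReal.ofReal (‖a‖ ^ 2) := by
  rw [← real_inner_self_eq_norm_sq, L2.inner_def, ofReal_integral_eq_lintegral_ofReal]
  · refine lintegral_congr fun v => ?_
    rw [real_inner_self_eq_norm_sq, Real.norm_eq_abs, sq_abs]
  · exact L2.integrable_inner _ _
  · exact ae_of_all _ fun v => real_inner_self_nonneg

/-- With increments of size 8⁻ᵏ, the sums weighted by 4ᵏ are finite after integration, hence finite
in almost every fibre. There `mem_of_tsum_lt_top` applies, giving membership of the limit together
with a remainder estimate, which is then integrated over marks, points and m. -/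
theorem upperDom_of_fast (hd : IsLocalForm μ d γ) {t : ℕ → Lp ℝ 2 (markedLaw Q μ)}
    (ht : ∀ k, t k ∈ upperDom Q μ d γ)
    (hlim : ∀ᵐ ϖ ∂markedLaw Q μ, Tendsto (fun k => t k ϖ) atTop (𝓝 (F ϖ)))
    (h2 : ∀ k, ENNReal.ofReal (‖t (k + 1) - t k‖ ^ 2) ≤ 8⁻¹ ^ k)
    (hE : ∀ k, upperEnergy Q d γ (t (k + 1) - t k : Lp ℝ 2 (markedLaw Q μ)) ≤ 8⁻¹ ^ k) :
    FiberDom Q d F ∧ ∀ k, upperEnergy Q d γ (fun ϖ => F ϖ - t k ϖ) ≤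
      ∑' j, 2 ^ (j + 1) * 8⁻¹ ^ (k + j) := by
  have hsum : ∑' k : ℕ, (4 : ℝ≥0∞) ^ k * 8⁻¹ ^ k ≠ ⊤ := by
    have e : ∀ k : ℕ, (4 : ℝ≥0∞) ^ k * 8⁻¹ ^ k = 2⁻¹ ^ k := fun k => by
      rw [← mul_pow]
      congr 1
      rw [show (8 : ℝ≥0∞) = 4 * 2 by norm_num, ENNReal.mul_inv (by simp) (by simp), ← mul_assoc,
        ENNReal.mul_inv_cancel (by simp) (by simp), one_mul]
    simp only [e, ENNReal.tsum_geometric]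
    simp
  have hsub : ∀ k, ((t (k + 1) - t k : Lp ℝ 2 (markedLaw Q μ)) : Config (X × Y) → ℝ)
      =ᵐ[markedLaw Q μ] fun ϖ => t (k + 1) ϖ - t k ϖ := fun k => Lp.coeFn_sub _ _
  have hdiff : ∀ k, IsUpperCdc Q μ d γ (fun ϖ => t (k + 1) ϖ - t k ϖ)
      (fun ϖ => t (k + 1) ϖ - t k ϖ)
      (upperCdc Q μ d γ (t (k + 1) - t k) (t (k + 1) - t k)) := fun k =>
    (isUpperCdc_of_mem (hd.sub_mem_upperDom (ht (k + 1)) (ht k))).congr (hsub k) (hsub k)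
      EventuallyEq.rfl
  have hW1 : ∫⁻ ϖ, ∑' k, 4 ^ k * ENNReal.ofReal
      ((t (k + 1) - t k : Lp ℝ 2 (markedLaw Q μ)) ϖ ^ 2) ∂markedLaw Q μ ≠ ⊤ := by
    have hm : ∀ k, AEMeasurable (fun ϖ => ENNReal.ofReal
        ((t (k + 1) - t k : Lp ℝ 2 (markedLaw Q μ)) ϖ ^ 2)) (markedLaw Q μ) := fun k =>
      ((Lp.aestronglyMeasurable _).aemeasurable.pow_const 2).ennreal_ofReal
    rw [lintegral_tsum fun k => (hm k).const_mul _]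
    refine ne_top_of_le_ne_top hsum (ENNReal.tsum_le_tsum fun k => ?_)
    rw [lintegral_const_mul'' _ (hm k), lintegral_ofReal_sq]
    exact mul_le_mul_right (h2 k) _
  have hW2 : ∫⁻ ϖ, ∑' k, 4 ^ k * ENNReal.ofReal
      (upperCdc Q μ d γ (t (k + 1) - t k) (t (k + 1) - t k) ϖ) ∂markedLaw Q μ ≠ ⊤ := by
    have hm : ∀ k, AEMeasurable (fun ϖ => ENNReal.ofReal
        (upperCdc Q μ d γ (t (k + 1) - t k) (t (k + 1) - t k) ϖ)) (markedLaw Q μ) := fun k =>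
      (Lp.aestronglyMeasurable _).aemeasurable.ennreal_ofReal
    rw [lintegral_tsum fun k => (hm k).const_mul _]
    refine ne_top_of_le_ne_top hsum (ENNReal.tsum_le_tsum fun k => ?_)
    rw [lintegral_const_mul'' _ (hm k), hd.lintegral_upperCdc (hdiff k),
      ← upperEnergy_congr (hsub k)]
    exact mul_le_mul_right (hE k) _
  have hm1 : AEMeasurable (fun ϖ => ∑' k, 4 ^ k * ENNReal.ofReal
      ((t (k + 1) - t k : Lp ℝ 2 (markedLaw Q μ)) ϖ ^ 2)) (markedLaw Q μ) :=
    AEMeasurable.tsum fun k =>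
      ((Lp.aestronglyMeasurable _).aemeasurable.pow_const 2).ennreal_ofReal.const_mul _
  have hm2 : AEMeasurable (fun ϖ => ∑' k, 4 ^ k * ENNReal.ofReal
      (upperCdc Q μ d γ (t (k + 1) - t k) (t (k + 1) - t k) ϖ)) (markedLaw Q μ) :=
    AEMeasurable.tsum fun k =>
      (Lp.aestronglyMeasurable _).aemeasurable.ennreal_ofReal.const_mul _
  have key : ∀ᵐ m ∂Q, ∀ x : m.1, ∀ᵐ u ∂marksLaw μ m.1,
      (∃ a ∈ d, a =ᵐ[μ] fun v => F (m.remark u x v)) ∧ ∀ k,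
        fiberEnergy d γ (fun v => F (m.remark u x v) - t k (m.remark u x v)) ≤
          ∑' j, 2 ^ (j + 1) * fiberEnergy d γ (fun v => t (k + j + 1) (m.remark u x v) -
            t (k + j) (m.remark u x v)) := by
    filter_upwards [ae_lintegral_remark_ne_top hm1 hW1, ae_lintegral_remark_ne_top hm2 hW2,
      ae_fiber hlim, ae_all_iff.2 fun k => (isUpperCdc_of_mem (ht k)).fiberDom,
      ae_all_iff.2 fun k => hd.fiberEnergy_le (hdiff k), ae_all_iff.2 fun k => ae_fiber (hsub k)]
      with m k1 k2 k3 k4 k5 k6 x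
    filter_upwards [k1 x, k2 x, k3 x, ae_all_iff.2 fun k => k4 k x, ae_all_iff.2 fun k => k5 k x,
      ae_all_iff.2 fun k => k6 k x] with u j1 j2 j3 j4 j5 j6
    refine hd.mem_of_tsum_lt_top (s := fun k v => t k (m.remark u x v)) j4 j3 ?_ ?_
    · refine ne_top_of_le_ne_top j1 ((ENNReal.tsum_le_tsum fun k => ?_).trans
        (tsum_lintegral_le _))
      refine le_trans (mul_le_mul_right ?_ _) (lintegral_const_mul_le _ _)
      refine (lintegral_congr_ae ?_).le
      filter_upwards [j6 k] with v hv
      rw [hv]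
    · refine ne_top_of_le_ne_top j2 ((ENNReal.tsum_le_tsum fun k => ?_).trans
        (tsum_lintegral_le _))
      exact le_trans (mul_le_mul_right (j5 k) _) (lintegral_const_mul_le _ _)
  refine ⟨key.mono fun m hm x => (hm x).mono fun u hu => hu.1, fun k => ?_⟩
  have hdm : ∀ j, AEStronglyMeasurable (fun ϖ => t (j + 1) ϖ - t j ϖ) (markedLaw Q μ) := fun j =>
    (Lp.aestronglyMeasurable _).sub (Lp.aestronglyMeasurable _)
  have hA := fun j => hd.aemeasurable_fiber (hdm j) (hdiff j).fiberDom
  have e : ∑' j, 2 ^ (j + 1) * upperEnergy Q d γ (fun ϖ => t (k + j + 1) ϖ - t (k + j) ϖ) ≤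
      ∑' j, 2 ^ (j + 1) * 8⁻¹ ^ (k + j) := by
    refine ENNReal.tsum_le_tsum fun j => mul_le_mul_right ?_ _
    rw [← upperEnergy_congr (hsub (k + j))]
    exact hE (k + j)
  refine le_trans ?_ e
  have e2 : ∀ j, 2 ^ (j + 1) * upperEnergy Q d γ (fun ϖ => t (k + j + 1) ϖ - t (k + j) ϖ) =
      ∫⁻ m, 2 ^ (j + 1) * ∑' x : m.1, ∫⁻ u, fiberEnergy d γ (fun v =>
        t (k + j + 1) (m.remark u x v) - t (k + j) (m.remark u x v)) ∂marksLaw μ m.1 ∂Q := fun j =>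
    (lintegral_const_mul'' _ (hA (k + j)).2).symm
  simp only [e2]
  rw [← lintegral_tsum fun j => (hA (k + j)).2.const_mul _]
  refine lintegral_mono_ae ?_
  filter_upwards [key, ae_all_iff.2 fun j => (hA j).1] with m h3 h4
  simp only [← ENNReal.tsum_mul_left]
  rw [ENNReal.tsum_comm]
  refine ENNReal.tsum_le_tsum fun x => ?_
  simp only [← lintegral_const_mul'' _ (h4 (k + _) x)]
  rw [← lintegral_tsum fun j => (h4 (k + j) x).const_mul _]
  refine lintegral_mono_ae ?_
  filter_upwards [h3 x] with u hu using hu.2 k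

/-- The L² limit is identified along a subsequence that converges almost surely and has increments
of order 8⁻ᵏ both in squared norm and in energy. The energy bound is carried to the whole sequence
by the Cauchy property. -/
theorem upper_closed (hd : IsLocalForm μ d γ) {s : ℕ → Lp ℝ 2 (markedLaw Q μ)}
    (hs : ∀ n, s n ∈ upperDom Q μ d γ) (hc : CauchySeq s)
    (hE : ∀ ε > 0, ∃ n₀, ∀ p ≥ n₀, ∀ q ≥ n₀,
      energy (upperCdc Q μ d γ) (s p - s q) (s p - s q) < ε) :
    ∃ f ∈ upperDom Q μ d γ, Tendsto s atTop (𝓝 f) ∧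
      Tendsto (fun n => energy (upperCdc Q μ d γ) (s n - f) (s n - f)) atTop (𝓝 0) := by
  obtain ⟨F, hF⟩ := cauchySeq_tendsto_of_complete hc
  obtain ⟨ns, hns, hae⟩ := (tendstoInMeasure_of_tendsto_Lp hF).exists_seq_tendsto_ae
  have hev : ∀ k : ℕ, ∃ N, ∀ p ≥ N, ∀ q ≥ N, ‖s p - s q‖ ^ 2 ≤ 8⁻¹ ^ k ∧
      2 * energy (upperCdc Q μ d γ) (s p - s q) (s p - s q) ≤ 8⁻¹ ^ k := by
    intro k
    obtain ⟨n₀, hn₀⟩ := hE (8⁻¹ ^ k / 2) (by positivity)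
    obtain ⟨n₁, hn₁⟩ := Metric.cauchySeq_iff.1 hc (Real.sqrt (8⁻¹ ^ k)) (by positivity)
    refine ⟨max n₀ n₁, fun p hp q hq => ⟨?_, ?_⟩⟩
    · have h1 := hn₁ p (le_of_max_le_right hp) q (le_of_max_le_right hq)
      rw [dist_eq_norm] at h1
      have h2 := pow_le_pow_left₀ (norm_nonneg _) h1.le 2
      rwa [Real.sq_sqrt (by positivity)] at h2
    · have h1 := hn₀ p (le_of_max_le_left hp) q (le_of_max_le_left hq)
      linarith
  obtain ⟨N, hN⟩ := Classical.skolem.1 hev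
  -- A second extraction, on top of the one giving almost sure convergence, imposes the geometric
  -- rate.
  obtain ⟨φ, hφ, hφN⟩ := extraction_forall_of_eventually' (P := fun k n => N k ≤ ns n)
    fun k => eventually_atTop.1 (hns.tendsto_atTop.eventually_ge_atTop (N k))
  have hmono : ∀ k, N k ≤ ns (φ (k + 1)) := fun k =>
    (hφN k).trans (hns.monotone (hφ.monotone (Nat.le_succ k)))
  have hconv : ∀ k : ℕ, ENNReal.ofReal (8⁻¹ ^ k) = (8⁻¹ : ℝ≥0∞) ^ k := fun k => by
    rw [ENNReal.ofReal_pow (by norm_num), ENNReal.ofReal_inv_of_pos (by norm_num),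
      ENNReal.ofReal_ofNat]
  let t : ℕ → Lp ℝ 2 (markedLaw Q μ) := fun k => s (ns (φ k))
  have ht : ∀ k, t k ∈ upperDom Q μ d γ := fun k => hs _
  obtain ⟨hdom, hup⟩ := hd.upperDom_of_fast (F := F) ht
    (hae.mono fun ϖ h => h.comp hφ.tendsto_atTop)
    (fun k => by
      rw [← hconv]
      exact ENNReal.ofReal_le_ofReal (hN k _ (hmono k) _ (hφN k)).1)
    (fun k => by
      have hmem := hd.sub_mem_upperDom (ht (k + 1)) (ht k)
      have h1 := (hN k _ (hmono k) _ (hφN k)).2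
      rw [hd.energy_upperCdc hmem] at h1
      rw [← hconv, ← ENNReal.ofReal_toReal (hd.upperEnergy_ne_top (isUpperCdc_of_mem hmem))]
      exact ENNReal.ofReal_le_ofReal (by linarith))
  -- The sum equals 2 · 8⁻ᵏ ∑ (1/4)ʲ; bounding the ratio by 1/2 gives the rounder constant 4.
  have hbound : ∀ k : ℕ, ∑' j, (2 : ℝ≥0∞) ^ (j + 1) * 8⁻¹ ^ (k + j) ≤ 8⁻¹ ^ k * 4 := by
    intro k
    have e : ∀ j : ℕ, (2 : ℝ≥0∞) ^ (j + 1) * 8⁻¹ ^ (k + j) = (8⁻¹ ^ k * 2) * (2 * 8⁻¹) ^ j :=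
      fun j => by
        rw [mul_pow, pow_succ, pow_add]
        ring
    have h28 : (2 : ℝ≥0∞) * 8⁻¹ ≤ 2⁻¹ := by
      rw [← div_eq_mul_inv, ENNReal.div_le_iff (by simp) (by simp)]
      rw [show (8 : ℝ≥0∞) = 2 * 4 by norm_num, ← mul_assoc, ENNReal.inv_mul_cancel (by simp)
        (by simp)]
      norm_num
    simp only [e]
    rw [ENNReal.tsum_mul_left]
    calc 8⁻¹ ^ k * 2 * ∑' j, ((2 : ℝ≥0∞) * 8⁻¹) ^ j
        ≤ 8⁻¹ ^ k * 2 * ∑' j, (2⁻¹ : ℝ≥0∞) ^ j := by gcongr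
      _ = 8⁻¹ ^ k * 4 := by
        rw [ENNReal.tsum_geometric, ENNReal.one_sub_inv_two, inv_inv, mul_assoc]
        norm_num
  have hsubF : ∀ k, ((F - t k : Lp ℝ 2 (markedLaw Q μ)) : Config (X × Y) → ℝ)
      =ᵐ[markedLaw Q μ] fun ϖ => F ϖ - t k ϖ := fun k => Lp.coeFn_sub _ _
  have hle : ∀ k, upperEnergy Q d γ (F - t k : Lp ℝ 2 (markedLaw Q μ)) ≤ 8⁻¹ ^ k * 4 := fun k => by
    rw [upperEnergy_congr (hsubF k)]
    exact (hup k).trans (hbound k)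
  have hfin : ∀ k : ℕ, (8⁻¹ : ℝ≥0∞) ^ k * 4 ≠ ⊤ := fun k =>
    ENNReal.mul_ne_top (ENNReal.pow_ne_top (by simp)) (by simp)
  have hFt : ∀ k, F - t k ∈ upperDom Q μ d γ := fun k =>
    hd.mem_upperDom ((hd.fiberDom_sub hdom (isUpperCdc_of_mem (ht k)).fiberDom).congr
      (hsubF k).symm) (ne_top_of_le_ne_top (hfin k) (hle k))
  have hFm : F ∈ upperDom Q μ d γ := by
    have := hd.add_mem_upperDom (hFt 0) (ht 0)
    rwa [sub_add_cancel] at this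
  refine ⟨F, hFm, hF, ?_⟩
  have hnn : ∀ {G : Lp ℝ 2 (markedLaw Q μ)}, G ∈ upperDom Q μ d γ →
      0 ≤ energy (upperCdc Q μ d γ) G G := fun hG => by
    rw [hd.energy_upperCdc hG]
    positivity
  have hen : ∀ k, energy (upperCdc Q μ d γ) (t k - F) (t k - F) ≤ 8⁻¹ ^ k * 2 := by
    intro k
    have e : t k - F = (-1 : ℝ) • (F - t k) := by
      rw [neg_one_smul, neg_sub]
    have hm : t k - F ∈ upperDom Q μ d γ := hd.sub_mem_upperDom (ht k) hFm
    rw [hd.energy_upperCdc hm]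
    have e2 : upperEnergy Q d γ (t k - F : Lp ℝ 2 (markedLaw Q μ)) =
        upperEnergy Q d γ (F - t k : Lp ℝ 2 (markedLaw Q μ)) := by
      rw [e, upperEnergy_congr (Lp.coeFn_smul (-1 : ℝ) (F - t k))]
      have := hd.upperEnergy_smul (-1) (Lp.aestronglyMeasurable (F - t k))
        (isUpperCdc_of_mem (hFt k)).fiberDom
      rw [neg_one_sq, ENNReal.ofReal_one, one_mul] at this
      exact this
    rw [e2]
    have h1 := ENNReal.toReal_mono (hfin k) (hle k)
    rw [ENNReal.toReal_mul, ENNReal.toReal_pow, ENNReal.toReal_inv, ENNReal.toReal_ofNat,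
      ENNReal.toReal_ofNat] at h1
    linarith
  rw [Metric.tendsto_atTop]
  intro ε hε
  -- The energy of `s n - F` is at most twice that of `s n - t k` plus twice that of `t k - F`, each
  -- below ε/4.
  obtain ⟨n₀, hn₀⟩ := hE (ε / 4) (by positivity)
  have hsmall : ∀ᶠ k : ℕ in atTop, (8⁻¹ : ℝ) ^ k * 2 < ε / 4 := by
    have : Tendsto (fun k : ℕ => (8⁻¹ : ℝ) ^ k * 2) atTop (𝓝 (0 * 2)) :=
      (tendsto_pow_atTop_nhds_zero_of_lt_one (by norm_num) (by norm_num)).mul_const 2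
    rw [zero_mul] at this
    exact this.eventually_lt_const (by positivity)
  obtain ⟨k, hk1, hk2⟩ := (hsmall.and ((hns.tendsto_atTop.comp
    hφ.tendsto_atTop).eventually_ge_atTop n₀)).exists
  refine ⟨n₀, fun n hn => ?_⟩
  have h1 := hn₀ n hn _ hk2
  have h2 := hen k
  have h3 := hd.energy_upperCdc_add_le (hd.sub_mem_upperDom (hs n) (ht k))
    (hd.sub_mem_upperDom (ht k) hFm)
  rw [sub_add_sub_cancel] at h3
  rw [Real.dist_eq, sub_zero, abs_of_nonneg (hnn (hd.sub_mem_upperDom (hs n) hFm))]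
  simp only [Function.comp_apply, t] at h1 h2 h3
  linarith

theorem upper (hd : IsLocalForm μ d γ) :
    IsLocalForm (markedLaw Q μ) (upperDom Q μ d γ) (upperCdc Q μ d γ) where
  zero_mem := hd.zero_mem_upperDom
  add_mem _ hf _ hg := hd.add_mem_upperDom hf hg
  smul_mem c _ hf := hd.smul_mem_upperDom c hf
  cdc_symm _ hf _ hg := upperCdc_eq (hd.upperCdc_symm (hd.isUpperCdc hg hf))
  cdc_add f hf g hg h hh := by
    refine upperCdc_eq ((hd.upperCdc_add (hd.isUpperCdc hf hh) (hd.isUpperCdc hg hh)).congr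
      (Lp.coeFn_add f g).symm EventuallyEq.rfl (Lp.coeFn_add _ _).symm)
  cdc_smul c f hf g hg :=
    upperCdc_eq ((hd.upperCdc_smul c (hd.isUpperCdc hf hg)).congr
      (Lp.coeFn_smul c f).symm EventuallyEq.rfl (Lp.coeFn_smul c (upperCdc Q μ d γ f g)).symm)
  cdc_nonneg f hf := (Lp.coeFn_nonneg _).1 (hd.upperCdc_nonneg (isUpperCdc_of_mem hf))
  closed _ hs hc hE := hd.upper_closed hs hc hE
  contraction _ hφ h0 _ hf := hd.contraction_upperDom hφ h0 hf
  carre_du_champ _ hf _ hg _ hh bf bg bh _ hfh _ hgh _ hfg efh egh efg :=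
    hd.upper_carre_du_champ hf hg hh bf bg bh hfh hgh hfg efh egh efg
  local_form _ hf _ _ hφ hψ hφc hψc hdisj _ ha _ hb haF hbF :=
    hd.upper_local_form hf hφ hψ hφc hψc hdisj ha hb haF hbF

end IsLocalForm

end UpperLocalForm

/-! ### The lent particle formula -/

section LentParticle

theorem Config.aestronglyMeasurable_toMeasure {Z : Type*} [MeasurableSpace Z]
    [MeasurableSingletonClass Z] (ϖ : Config Z) (f : Z → ℝ) :
    AEStronglyMeasurable f ϖ.toMeasure := by
  have : Countable ϖ.1 := ϖ.2.to_subtype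
  rw [toMeasure, aestronglyMeasurable_sum_measure_iff]
  exact fun z => aestronglyMeasurable_dirac

theorem Config.integrable_toMeasure {Z : Type*} [MeasurableSpace Z] [MeasurableSingletonClass Z]
    {ϖ : Config Z} {f : Z → ℝ} {a : ℝ} (h : HasSum (fun z : ϖ.1 => f z) a) :
    Integrable f ϖ.toMeasure ∧ a = ∫ z, f z ∂ϖ.toMeasure := by
  have hi : Integrable f ϖ.toMeasure := by
    refine ⟨aestronglyMeasurable_toMeasure ϖ f, ?_⟩
    rw [HasFiniteIntegral, lintegral_toMeasure]
    have h1 := h.summable.norm.tsum_ofReal_lt_top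
    simpa only [ofReal_norm] using h1
  refine ⟨hi, ?_⟩
  have h2 := hasSum_integral_measure hi
  simp only [integral_dirac] at h2
  exact h.unique h2

variable {X Y : Type*} [MeasurableSpace X] [MeasurableSingletonClass X]
  [MeasurableSpace Y] [MeasurableSingletonClass Y] {Q : Measure (Config X)}
  {μ : Measure Y} [IsProbabilityMeasure μ]
  {d : Set (Lp ℝ 2 μ)} {γ : Lp ℝ 2 μ → Lp ℝ 2 μ → Lp ℝ 1 μ}

/-- Putting (x, v) back into the configuration deprived of the point above x changes the mark of x
to v, while `K` is evaluated where that mark has been forgotten. Thus γ acting on the lent particle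
is γ acting on an existing mark. -/
theorem isCdcEpsPlus_iff {F : Config (X × Y) → ℝ} {K : Config (X × Y) → X × Y → ℝ} :
    IsCdcEpsPlus Q μ d γ F K ↔
      ∀ᵐ m ∂Q, ∀ x : m.1, IsPartialCdc μ d γ x (fun u => F (m.mark u)) (fun u => F (m.mark u))
        (fun u => epsMinus K (m.mark u) (x, u x)) := by
  classical
  have e : ∀ (m : Config X) (x : m.1) (u : m.1 → Y) (v : Y),
      epsPlus F ((m.mark u).remove (x.1, u x)) (x.1, v) =
        F (m.mark (@Function.update m.1 (fun _ => Y)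
          (fun a b => Classical.propDecidable (a = b)) u x v)) := fun m x u v => by
    rw [epsPlus, Config.add_remove_mark, Config.mark_update, Config.remark]
  have e2 : ∀ (m : Config X) (x : m.1) (u : m.1 → Y) (v : Y),
      K ((m.mark u).remove (x.1, u x)) (x.1, v) =
        epsMinus K (m.mark (@Function.update m.1 (fun _ => Y)
          (fun a b => Classical.propDecidable (a = b)) u x v)) (x.1, v) := fun m x u v => by
    rw [epsMinus, Config.mark_update, ← Config.remove_mark_update m u x v, Config.mark_update]
  simp only [IsCdcEpsPlus, IsPartialCdc, e, e2, Function.update_self]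

/-- The carré du champ in one mark is unique up to null sets, so any version of γ[ε⁺F] reproduces,
almost surely and for all points at once, the terms whose sum is Γ[F]. -/
theorem hasSum_epsMinus {F : Lp ℝ 2 (markedLaw Q μ)}
    (hF : F ∈ upperDom Q μ d γ) {K : Config (X × Y) → X × Y → ℝ}
    (hK : IsCdcEpsPlus Q μ d γ F K) :
    ∀ᵐ m ∂Q, ∀ᵐ u ∂marksLaw μ m.1,
      HasSum (fun z : (m.mark u).1 => epsMinus K (m.mark u) z)
        (upperCdc Q μ d γ F F (m.mark u)) := by
  filter_upwards [isCdcEpsPlus_iff.1 hK, (isUpperCdc_of_mem hF).2] with m h1 ⟨κ, hκ, hs⟩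
  have : Countable m.1 := m.2.to_subtype
  filter_upwards [hs, ae_all_iff.2 fun x => (hκ x).unique (h1 x)] with u e1 e2
  simp only [e2] at e1
  exact ((Config.mark_injective m u).hasSum_range_iff
    (f := fun z => epsMinus K (m.mark u) z)).2 e1

/-- For the version from `exists_density` both sides are measurable up to null sets of the marked
law, so the equality for almost every m and almost all marks becomes an almost sure one.
Nonnegativity reduces integrability to a finite Lebesgue integral. -/
theorem IsLocalForm.exists_lentParticle (hd : IsLocalForm μ d γ) {F : Lp ℝ 2 (markedLaw Q μ)}
    (hF : F ∈ upperDom Q μ d γ) : ∃ K, IsCdcEpsPlus Q μ d γ F K ∧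
      ∀ᵐ ϖ ∂markedLaw Q μ, LentParticleAt (upperCdc Q μ d γ F F) K ϖ := by
  obtain ⟨K, hK0, hKm, hK⟩ := hd.exists_density (Lp.aestronglyMeasurable F)
    (isUpperCdc_of_mem hF).fiberDom
  have hK' := isCdcEpsPlus_iff.2 hK
  refine ⟨K, hK', ?_⟩
  have hG := (isUpperCdc_of_mem hF).1
  have key : ∀ᵐ ϖ ∂markedLaw Q μ, ϖ ∈ {ϖ | ∫⁻ z, ENNReal.ofReal (epsMinus K ϖ z) ∂ϖ.toMeasure =
      ENNReal.ofReal (upperCdc Q μ d γ F F ϖ)} := by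
    refine ae_markedLaw_of_ae_ae (nullMeasurableSet_eq_fun hKm.aemeasurable
      hG.1.aemeasurable.ennreal_ofReal) ?_
    filter_upwards [hasSum_epsMinus hF hK'] with m hm
    filter_upwards [hm] with u hu
    rw [Config.lintegral_toMeasure, ← hu.tsum_eq,
      ENNReal.ofReal_tsum_of_nonneg
        (f := fun z : (m.mark u).1 => epsMinus K (m.mark u) z) (fun _ => hK0 _ _) hu.summable]
  filter_upwards [key, hd.upperCdc_nonneg (isUpperCdc_of_mem hF)] with ϖ h1 h2
  have h3 : Integrable (epsMinus K ϖ) ϖ.toMeasure := by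
    refine ⟨Config.aestronglyMeasurable_toMeasure ϖ _, ?_⟩
    rw [HasFiniteIntegral]
    simp only [Real.enorm_of_nonneg (show 0 ≤ epsMinus K ϖ _ from hK0 _ _)]
    exact h1.trans_lt ENNReal.ofReal_lt_top
  refine ⟨h3, ?_⟩
  rw [integral_eq_lintegral_of_nonneg_ae (f := epsMinus K ϖ) (ae_of_all _ fun z => hK0 _ _) h3.1, h1,
    ENNReal.toReal_ofReal h2]

end LentParticle

/-! ### The energy image density property -/

section ImageDensity

theorem aemeasurable_det {Ω : Type*} [MeasurableSpace Ω] {ν : Measure Ω} {k : ℕ}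
    {M : Fin k → Fin k → Ω → ℝ} (hM : ∀ i j, AEMeasurable (M i j) ν) :
    AEMeasurable (fun t => Matrix.det (Matrix.of fun i j => M i j t)) ν := by
  simp only [Matrix.det_apply, Matrix.of_apply]
  refine Finset.aemeasurable_fun_sum _ fun σ _ => AEMeasurable.const_smul ?_ _
  exact Finset.aemeasurable_fun_prod _ fun i _ => hM _ _

theorem nullMeasurableSet_det {Ω : Type*} [MeasurableSpace Ω] {ν : Measure Ω} {k : ℕ}
    {f : Ω → Fin k → ℝ} (hf : AEMeasurable f ν) {M : Fin k → Fin k → Ω → ℝ}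
    (hM : ∀ i j, AEMeasurable (M i j) ν) {A : Set (Fin k → ℝ)} (hA : MeasurableSet A) :
    NullMeasurableSet {t | f t ∈ A → Matrix.det (Matrix.of fun i j => M i j t) ≤ 0} ν := by
  have h1 := (hf.nullMeasurableSet_preimage hA).compl.union
    (nullMeasurableSet_le (aemeasurable_det hM) (aemeasurable_const (b := (0 : ℝ))))
  convert h1 using 1
  ext t
  exact imp_iff_not_or

/-- The condition `≤ 0` is what truncation by `ENNReal.ofReal` sees: nonnegativity of the
determinant is never needed, and the condition is closed under limits. -/
theorem eid_iff {Ω : Type*} [MeasurableSpace Ω] {ν : Measure Ω} {d : Set (Lp ℝ 2 ν)}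
    {γ : Lp ℝ 2 ν → Lp ℝ 2 ν → Lp ℝ 1 ν} :
    EID ν d γ ↔ ∀ (k : ℕ) (U : Fin k → Lp ℝ 2 ν), (∀ i, U i ∈ d) →
      ∀ A : Set (Fin k → ℝ), MeasurableSet A → volume A = 0 →
        ∀ᵐ ϖ ∂ν, (fun i => U i ϖ) ∈ A →
          Matrix.det (Matrix.of fun i j => γ (U i) (U j) ϖ) ≤ 0 := by
  have hdet : ∀ (k : ℕ) (U : Fin k → Lp ℝ 2 ν), AEMeasurable (fun ϖ => ENNReal.ofReal
      (Matrix.det (Matrix.of fun i j => γ (U i) (U j) ϖ))) ν := by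
    intro k U
    refine (aemeasurable_det fun i j => ?_).ennreal_ofReal
    exact (Lp.aestronglyMeasurable _).aemeasurable
  have hU : ∀ (k : ℕ) (U : Fin k → Lp ℝ 2 ν), AEMeasurable (fun ϖ i => U i ϖ) ν := fun k U =>
    aemeasurable_pi_iff.2 fun i => (Lp.aestronglyMeasurable _).aemeasurable
  have key : ∀ (k : ℕ) (U : Fin k → Lp ℝ 2 ν) (A : Set (Fin k → ℝ)), MeasurableSet A →
      (((ν.withDensity fun ϖ => ENNReal.ofReal (Matrix.det (Matrix.of fun i j =>
        γ (U i) (U j) ϖ))).map (fun ϖ i => U i ϖ)) A = 0 ↔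
        ∀ᵐ ϖ ∂ν, (fun i => U i ϖ) ∈ A →
          Matrix.det (Matrix.of fun i j => γ (U i) (U j) ϖ) ≤ 0) := by
    intro k U A hA
    rw [Measure.map_apply_of_aemeasurable ((hU k U).mono_ac (withDensity_absolutelyContinuous _ _))
      hA, withDensity_apply_eq_zero' (hdet k U), ae_iff]
    refine iff_of_eq (congrArg (fun s => ν s = 0) (Set.ext fun ϖ => ?_))
    simp only [Set.mem_inter_iff, Set.mem_preimage, ne_eq, ENNReal.ofReal_eq_zero,
      Classical.not_imp]
    exact and_comm
  constructor
  · intro h k U hUd A hA hA0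
    exact (key k U A hA).1 (h k U hUd hA0)
  · intro h k U hUd
    exact Measure.AbsolutelyContinuous.mk fun A hA hA0 => (key k U A hA).2 (h k U hUd A hA hA0)

variable {Y : Type*} [MeasurableSpace Y] {μ : Measure Y} [IsProbabilityMeasure μ]
  {d : Set (Lp ℝ 2 μ)} {γ : Lp ℝ 2 μ → Lp ℝ 2 μ → Lp ℝ 1 μ}

section Extend

variable {ι κ : Type*} {e : κ → ι}

theorem integrable_extend (he : Function.Injective e) {f : (ι → Y) → ℝ}
    (hf : Integrable f (marksLaw μ ι)) :
    ∀ᵐ u ∂marksLaw μ ι, Integrable (fun w => f (Function.extend e w u)) (marksLaw μ κ) :=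
  ((measurePreserving_extend he).integrable_comp_of_integrable hf).prod_right_ae

theorem memLp_extend (he : Function.Injective e) {f : (ι → Y) → ℝ}
    (hf : MemLp f 2 (marksLaw μ ι)) :
    ∀ᵐ u ∂marksLaw μ ι, MemLp (fun w => f (Function.extend e w u)) 2 (marksLaw μ κ) := by
  have h1 := hf.1.comp_measurePreserving (measurePreserving_extend (μ := μ) he)
  filter_upwards [integrable_extend he hf.integrable_sq, h1.prodMk_left] with u h2 h3
  exact (memLp_two_iff_integrable_sq h3).2 h2

theorem extend_update [DecidableEq ι] [DecidableEq κ] (he : Function.Injective e) (w : κ → Y)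
    (u : ι → Y) (k : κ) (v : Y) :
    Function.extend e (Function.update w k v) u =
      Function.update (Function.extend e w u) (e k) v := by
  funext i
  by_cases hi : ∃ j, e j = i
  · obtain ⟨j, rfl⟩ := hi
    rw [he.extend_apply]
    by_cases hj : j = k
    · subst hj
      simp
    · rw [Function.update_of_ne hj, Function.update_of_ne (he.ne hj), he.extend_apply]
  · rw [Function.extend_apply' _ _ _ hi, Function.update_of_ne (fun h => hi ⟨k, h.symm⟩),
      Function.extend_apply' _ _ _ hi]

theorem IsPartialCdc.extend (he : Function.Injective e) {k : κ} {f g h : (ι → Y) → ℝ}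
    (hp : IsPartialCdc μ d γ (e k) f g h) :
    ∀ᵐ u ∂marksLaw μ ι, IsPartialCdc μ d γ k (fun w => f (Function.extend e w u))
      (fun w => g (Function.extend e w u)) (fun w => h (Function.extend e w u)) := by
  classical
  have h1 := hp.1.comp_measurePreserving (measurePreserving_extend (μ := μ) he)
  filter_upwards [h1.prodMk_left, ae_ae_extend he hp.2] with u h2 h3
  refine ⟨h2, ?_⟩
  filter_upwards [h3] with w hw
  simp only [extend_update he]
  exact hw

end Extend

/-- With the marks outside `s` frozen, each `f i` lies in the domain of the product over `s`, whose
carré du champ is the partial sum. The (EID) property of that finite product applies for almost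
every frozen value, and resampling the marks in `s` returns to the full law. -/
theorem det_nonpos_of_finset {ι : Type*}
    (hE : ∀ n : ℕ, EID (marksLaw μ (Fin n)) (prodDom μ d γ (Fin n)) (prodCdc μ d γ (Fin n)))
    {k : ℕ} {f : Fin k → (ι → Y) → ℝ} (hf : ∀ i, MemLp (f i) 2 (marksLaw μ ι))
    {κ : Fin k → Fin k → ι → (ι → Y) → ℝ}
    (hκ : ∀ i j x, IsPartialCdc μ d γ x (f i) (f j) (κ i j x))
    (hi : ∀ i j x, Integrable (κ i j x) (marksLaw μ ι))
    {A : Set (Fin k → ℝ)} (hA : MeasurableSet A) (hA0 : volume A = 0) (s : Finset ι) :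
    ∀ᵐ u ∂marksLaw μ ι, (fun i => f i u) ∈ A →
      Matrix.det (Matrix.of fun i j => ∑ x ∈ s, κ i j x u) ≤ 0 := by
  let e : Fin s.card → ι := fun l => (s.equivFin.symm l : ι)
  have he : Function.Injective e := Subtype.val_injective.comp s.equivFin.symm.injective
  have hsum : ∀ g : ι → ℝ, ∑ x ∈ s, g x = ∑ l, g (e l) := by
    intro g
    rw [← Finset.sum_coe_sort]
    exact (Equiv.sum_comp s.equivFin.symm fun x : s => g x).symm
  have hF : AEMeasurable (fun u i => f i u) (marksLaw μ ι) :=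
    aemeasurable_pi_iff.2 fun i => (hf i).1.aemeasurable
  have hS : NullMeasurableSet {u | (fun i => f i u) ∈ A →
      Matrix.det (Matrix.of fun i j => ∑ x ∈ s, κ i j x u) ≤ 0} (marksLaw μ ι) := by
    exact nullMeasurableSet_det hF (fun i j => Finset.aemeasurable_fun_sum _ fun x _ =>
      (hκ i j x).1.aemeasurable) hA
  refine ae_of_ae_extend he hS ?_
  filter_upwards [ae_all_iff.2 fun i => memLp_extend he (hf i),
    ae_all_iff.2 fun i => ae_all_iff.2 fun j => ae_all_iff.2 fun l => (hκ i j (e l)).extend he,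
    ae_all_iff.2 fun i => ae_all_iff.2 fun j => ae_all_iff.2 fun l =>
      integrable_extend he (hi i j (e l))] with u h1 h2 h3
  let V : Fin k → Lp ℝ 2 (marksLaw μ (Fin s.card)) := fun i => (h1 i).toLp
  have hV : ∀ i, V i =ᵐ[marksLaw μ (Fin s.card)] fun w => f i (Function.extend e w u) := fun i =>
    (h1 i).coeFn_toLp
  have hcdc : ∀ i j, IsProdCdc μ d γ (Fin s.card) (V i) (V j)
      (fun w => ∑ l, κ i j (e l) (Function.extend e w u)) := by
    intro i j
    refine ⟨integrable_finsetSum _ fun l _ => h3 i j l,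
      fun l w => κ i j (e l) (Function.extend e w u), fun l => ?_,
      ae_of_all _ fun w => hasSum_fintype _⟩
    exact (h2 i j l).congr (hV i).symm (hV j).symm EventuallyEq.rfl
  have key := eid_iff.1 (hE s.card) k V (fun i => ⟨_, hcdc i i⟩) A hA hA0
  filter_upwards [key, ae_all_iff.2 hV,
    ae_all_iff.2 fun i => ae_all_iff.2 fun j => prodCdc_ae_eq (hcdc i j)] with w k1 k2 k3
  intro hw
  simp only [k2, k3] at k1
  simp only [hsum]
  exact k1 hw

end ImageDensity

/-! ### Energy image density for the upper structure -/

section UpperImageDensity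

variable {X Y : Type*} [MeasurableSpace X] [MeasurableSingletonClass X]
  [MeasurableSpace Y] [MeasurableSingletonClass Y] {Q : Measure (Config X)}
  {μ : Measure Y} [IsProbabilityMeasure μ]
  {d : Set (Lp ℝ 2 μ)} {γ : Lp ℝ 2 μ → Lp ℝ 2 μ → Lp ℝ 1 μ}

theorem memLp_mark {f : Config (X × Y) → ℝ} (hf : MemLp f 2 (markedLaw Q μ)) :
    ∀ᵐ m ∂Q, MemLp (fun u => f (m.mark u)) 2 (marksLaw μ m.1) := by
  filter_upwards [aestronglyMeasurable_mark hf.1, integrable_mark hf.integrable_sq] with m h1 h2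
  exact (memLp_two_iff_integrable_sq h1).2 h2

/-- The event that U falls in the null set A does not depend on the finite set `s`, and there are
countably many `s`. As `s` increases to m, the partial matrices converge entrywise, hence so do the
determinants, and the sign condition survives. -/
theorem IsLocalForm.eid_upper (hd : IsLocalForm μ d γ)
    (hE : ∀ n : ℕ, EID (marksLaw μ (Fin n)) (prodDom μ d γ (Fin n)) (prodCdc μ d γ (Fin n))) :
    EID (markedLaw Q μ) (upperDom Q μ d γ) (upperCdc Q μ d γ) := by
  refine eid_iff.2 fun k U hU A hA hA0 => ?_
  have hS : NullMeasurableSet {ϖ | (fun i => U i ϖ) ∈ A →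
      Matrix.det (Matrix.of fun i j => upperCdc Q μ d γ (U i) (U j) ϖ) ≤ 0} (markedLaw Q μ) := by
    have hF : AEMeasurable (fun ϖ i => U i ϖ) (markedLaw Q μ) :=
      aemeasurable_pi_iff.2 fun i => (Lp.aestronglyMeasurable _).aemeasurable
    exact nullMeasurableSet_det hF (fun i j => (Lp.aestronglyMeasurable _).aemeasurable) hA
  refine ae_markedLaw_of_ae_ae hS ?_
  filter_upwards [ae_all_iff.2 fun i => memLp_mark (Lp.memLp (U i)),
    ae_all_iff.2 fun i => ae_all_iff.2 fun j => (hd.isUpperCdc (hU i) (hU j)).2,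
    ae_all_iff.2 fun i => integrable_mark (isUpperCdc_of_mem (hU i)).1] with m h1 h2 h3
  have : Countable m.1 := m.2.to_subtype
  choose κ hκ hs using h2
  have hi : ∀ i j x, Integrable (κ i j x) (marksLaw μ m.1) := fun i j x => by
    have := hd.tsum_lintegral_enorm_ne_top (hκ i j) ⟨_, hκ i i, hs i i⟩ ⟨_, hκ j j, hs j j⟩
      (h3 i) (h3 j)
    exact ⟨(hκ i j x).1, (ENNReal.ne_top_of_tsum_ne_top this x).lt_top⟩
  filter_upwards [ae_all_iff.2 fun s : Finset m.1 => det_nonpos_of_finset hE h1 hκ hi hA hA0 s,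
    ae_all_iff.2 fun i => ae_all_iff.2 fun j => hs i j] with u k1 k2 hu
  have hlim : Tendsto (fun s : Finset m.1 => Matrix.det (Matrix.of fun i j =>
      ∑ x ∈ s, κ i j x u)) atTop
      (𝓝 (Matrix.det (Matrix.of fun i j => upperCdc Q μ d γ (U i) (U j) (m.mark u)))) := by
    simp only [Matrix.det_apply, Matrix.of_apply]
    refine tendsto_finsetSum _ fun σ _ => Tendsto.const_smul ?_ _
    exact tendsto_finsetProd _ fun i _ => k2 _ _
  exact le_of_tendsto' hlim fun s => k1 s hu

end UpperImageDensity

/-! ### Density of the domain -/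

section AeClosure

variable {Ω : Type*} [MeasurableSpace Ω] {ν : Measure Ω} {d : Set (Lp ℝ 2 ν)}

/-- The class of `f` belongs to the closure of `d`. -/
def AeClosure (d : Set (Lp ℝ 2 ν)) (f : Ω → ℝ) : Prop := ∃ a ∈ closure d, a =ᵐ[ν] f

theorem AeClosure.aestronglyMeasurable {f : Ω → ℝ} (h : AeClosure d f) :
    AEStronglyMeasurable f ν := by
  obtain ⟨a, -, ha⟩ := h
  exact (Lp.aestronglyMeasurable a).congr ha

theorem AeClosure.congr {f g : Ω → ℝ} (h : AeClosure d f) (hfg : f =ᵐ[ν] g) : AeClosure d g := by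
  obtain ⟨a, had, ha⟩ := h
  exact ⟨a, had, ha.trans hfg⟩

theorem AeClosure.lim [IsFiniteMeasure ν] {f : ℕ → Ω → ℝ} {g : Ω → ℝ} {C : ℝ}
    (h : ∀ n, AeClosure d (f n)) (hb : ∀ n, ∀ᵐ t ∂ν, |f n t| ≤ C)
    (hl : ∀ᵐ t ∂ν, Tendsto (fun n => f n t) atTop (𝓝 (g t))) : AeClosure d g := by
  have hfm := fun n => (h n).aestronglyMeasurable
  have hgm : AEStronglyMeasurable g ν := aestronglyMeasurable_of_tendsto_ae atTop hfm hl
  have hgb : ∀ᵐ t ∂ν, ‖g t‖ ≤ C := by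
    filter_upwards [hl, ae_all_iff.2 hb] with t h1 h2
    exact le_of_tendsto' h1.norm h2
  have hg : MemLp g 2 ν := MemLp.of_bound hgm C hgb
  refine ⟨hg.toLp g, ?_, hg.coeFn_toLp⟩
  choose a had ha using h
  refine isClosed_closure.mem_of_tendsto (b := atTop) (f := a) ?_ (Eventually.of_forall had)
  rw [Lp.tendsto_Lp_iff_tendsto_eLpNorm']
  have h1 := tendsto_eLpNorm_sub_of_dominated (p := 2) (by simp) (by simp) hfm hgm
    (memLp_const C) hb hl
  refine h1.congr fun n => eLpNorm_congr_ae ?_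
  exact (ha n).symm.sub hg.coeFn_toLp.symm

theorem AeClosure.lim_lintegral [IsFiniteMeasure ν] {f : ℕ → Ω → ℝ} {g : Ω → ℝ} {C : ℝ}
    (h : ∀ n, AeClosure d (f n)) (hb : ∀ n, ∀ᵐ t ∂ν, |f n t| ≤ C)
    (hg : AEStronglyMeasurable g ν)
    (hl : Tendsto (fun n => ∫⁻ t, ‖f n t - g t‖ₑ ∂ν) atTop (𝓝 0)) : AeClosure d g := by
  have h1 : TendstoInMeasure ν f atTop g := by
    refine tendstoInMeasure_of_tendsto_eLpNorm (p := 1) one_ne_zero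
      (fun n => (h n).aestronglyMeasurable) hg ?_
    simp only [eLpNorm_one_eq_lintegral_enorm]
    exact hl
  obtain ⟨ns, -, hae⟩ := h1.exists_seq_tendsto_ae
  exact AeClosure.lim (fun n => h (ns n)) (fun n => hb (ns n)) hae

theorem IsLocalForm.aeClosure_add {γ : Lp ℝ 2 ν → Lp ℝ 2 ν → Lp ℝ 1 ν} (hd : IsLocalForm ν d γ)
    {f g : Ω → ℝ} (hf : AeClosure d f) (hg : AeClosure d g) : AeClosure d (f + g) := by
  obtain ⟨a, ha, haf⟩ := hf
  obtain ⟨b, hb, hbg⟩ := hg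
  exact ⟨a + b, hd.toSubmodule.topologicalClosure.add_mem ha hb,
    (Lp.coeFn_add a b).trans (haf.add hbg)⟩

theorem IsLocalForm.aeClosure_smul {γ : Lp ℝ 2 ν → Lp ℝ 2 ν → Lp ℝ 1 ν} (hd : IsLocalForm ν d γ)
    (c : ℝ) {f : Ω → ℝ} (hf : AeClosure d f) : AeClosure d (c • f) := by
  obtain ⟨a, ha, haf⟩ := hf
  exact ⟨c • a, hd.toSubmodule.topologicalClosure.smul_mem c ha,
    (Lp.coeFn_smul c a).trans (haf.const_smul c)⟩

theorem IsLocalForm.dense_of_indicator [IsFiniteMeasure ν]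
    {γ : Lp ℝ 2 ν → Lp ℝ 2 ν → Lp ℝ 1 ν} (hd : IsLocalForm ν d γ)
    (h : ∀ S : Set Ω, MeasurableSet S → AeClosure d (S.indicator 1)) : Dense d := by
  intro f
  refine Lp.induction (p := 2) (by simp) (fun f : Lp ℝ 2 ν => f ∈ closure d) ?_ ?_
    isClosed_closure f
  · intro c s hs hμs
    obtain ⟨a, ha, has⟩ := hd.aeClosure_smul c (h s hs)
    convert ha using 1
    refine Lp.ext ?_
    rw [Lp.simpleFunc.coe_indicatorConst]
    refine indicatorConstLp_coeFn.trans (EventuallyEq.trans ?_ has.symm)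
    refine ae_of_all _ fun t => ?_
    by_cases ht : t ∈ s <;> simp [ht]
  · intro f g hf hg _ hf' hg'
    exact hd.toSubmodule.topologicalClosure.add_mem hf' hg'

end AeClosure

/-! ### Truncated Laplace functionals -/

section Truncation

variable {X Y : Type*} [MeasurableSpace X] [MeasurableSingletonClass X]
  [MeasurableSpace Y] [MeasurableSingletonClass Y]

/-- The Laplace functional restricted to the points above `A`, on the event that there are at
most `M` of them. -/
def truncLaplace (A : Set X) (M : ℝ≥0∞) (s : X × Y → ℝ≥0∞) : Config (X × Y) → ℝ :=
  {ϖ | ϖ.toMeasure (A ×ˢ Set.univ) ≤ M}.indicator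
    (Config.laplace ((A ×ˢ Set.univ).indicator s))

variable {A : Set X} {M : ℝ≥0∞} {s : X × Y → ℝ≥0∞}

theorem measurable_truncLaplace (hA : MeasurableSet A) (hs : Measurable s) :
    Measurable (truncLaplace A M s) :=
  (Config.measurable_laplace (hs.indicator (hA.prod MeasurableSet.univ))).indicator
    (measurableSet_le (Config.measurable_toMeasure_apply (hA.prod MeasurableSet.univ))
      measurable_const)

theorem truncLaplace_nonneg (ϖ : Config (X × Y)) : 0 ≤ truncLaplace A M s ϖ :=
  Set.indicator_nonneg (fun _ _ => Config.laplace_nonneg _ _) _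

theorem truncLaplace_le_one (ϖ : Config (X × Y)) : truncLaplace A M s ϖ ≤ 1 :=
  Set.indicator_le' (fun _ _ => Config.laplace_le_one _ _) (fun _ _ => zero_le_one) _

theorem abs_truncLaplace_le (ϖ : Config (X × Y)) : |truncLaplace A M s ϖ| ≤ 1 := by
  rw [abs_of_nonneg (truncLaplace_nonneg ϖ)]
  exact truncLaplace_le_one ϖ

/-- The truncating event depends on m alone, so it costs no energy in the marks. -/
theorem truncLaplace_mark_of_lt (hA : MeasurableSet A) {m : Config X} (hm : M < m.toMeasure A)
    (u : m.1 → Y) : truncLaplace A M s (m.mark u) = 0 := by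
  refine Set.indicator_of_notMem ?_ _
  rw [Set.mem_ofPred_eq, Config.toMeasure_mark_prod_univ hA]
  exact hm.not_ge

theorem truncLaplace_mark (hA : MeasurableSet A) {m : Config X} (hm : m.toMeasure A ≤ M)
    {t : Finset m.1} (ht : ∀ x, x ∈ t ↔ (x : X) ∈ A) (u : m.1 → Y) :
    truncLaplace A M s (m.mark u) = ∏ x ∈ t, (expNeg (s (x, u x))).toReal := by
  rw [truncLaplace, Set.indicator_of_mem (by
    rw [Set.mem_ofPred_eq, Config.toMeasure_mark_prod_univ hA]
    exact hm), Config.laplace, Config.lintegral_toMeasure, Config.tsum_mark m u, tsum_eq_sum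
    (s := t) fun x hx => Set.indicator_of_notMem (fun h => hx ((ht x).2 h.1)) _, expNeg_sum,
    ENNReal.toReal_prod]
  refine Finset.prod_congr rfl fun x hx => ?_
  rw [Set.indicator_of_mem]
  exact ⟨(ht x).1 hx, Set.mem_univ _⟩

theorem exists_finset_points (hA : MeasurableSet A) {m : Config X} (hm : m.toMeasure A ≠ ⊤) :
    ∃ t : Finset m.1, (∀ x, x ∈ t ↔ (x : X) ∈ A) ∧ (t.card : ℝ≥0∞) = m.toMeasure A := by
  classical
  rw [Config.toMeasure_apply hA] at hm ⊢
  have hfin : (m.1 ∩ A).Finite := by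
    rw [← Set.encard_ne_top_iff]
    intro h
    rw [h] at hm
    exact hm ENat.toENNReal_top
  have h1 : {x : m.1 | (x : X) ∈ A}.Finite := by
    refine Set.Finite.of_finite_image (f := Subtype.val) (hfin.subset ?_)
      Subtype.val_injective.injOn
    rintro _ ⟨x, hx, rfl⟩
    exact ⟨x.2, hx⟩
  refine ⟨h1.toFinset, fun x => by simp, ?_⟩
  have h2 : (m.1 ∩ A).encard = (h1.toFinset.card : ℕ∞) := by
    rw [← Set.encard_coe_eq_coe_finsetCard, h1.coe_toFinset,
      ← Subtype.val_injective.encard_image]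
    congr 1
    ext x
    simp only [Set.mem_inter_iff, Set.mem_image, Set.mem_ofPred_eq, Subtype.exists,
      exists_and_right, exists_eq_right]
    exact ⟨fun h => ⟨h.1, h.2⟩, fun ⟨h3, h4⟩ => ⟨h3, h4⟩⟩
  rw [h2]
  simp

end Truncation

/-! ### Measurable approximation by functions of the domain -/

section DomainApproximation

variable {X Y : Type*} [MeasurableSpace X] [MeasurableSpace Y]
  {μ : Measure Y} [IsProbabilityMeasure μ]
  {d : Set (Lp ℝ 2 μ)} {γ : Lp ℝ 2 μ → Lp ℝ 2 μ → Lp ℝ 1 μ}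

theorem lipschitzWith_clip : LipschitzWith 1 fun r : ℝ => max 0 (min r 1) :=
  (LipschitzWith.id.min_const 1).const_max 0

theorem abs_clip_sub_le {r b : ℝ} (h0 : 0 ≤ b) (h1 : b ≤ 1) :
    |max 0 (min r 1) - b| ≤ |r - b| := by
  have h := lipschitzWith_clip.dist_le_mul r b
  simp only [min_eq_left h1, max_eq_right h0, NNReal.coe_one, one_mul, Real.dist_eq] at h
  exact h

/-- Approximation of a family of functions by functions of the domain, uniformly bounded in
energy, measurably in the parameter. -/
theorem IsLocalDirichletStructure.exists_approx (hd : IsLocalDirichletStructure μ d γ)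
    {g : X × Y → ℝ} (hg : Measurable g) (h0 : ∀ z, 0 ≤ g z) (h1 : ∀ z, g z ≤ 1) :
    ∃ f : ℕ → X × Y → ℝ, (∀ k, Measurable (f k)) ∧ (∀ k z, 0 ≤ f k z ∧ f k z ≤ 1) ∧
      (∀ k, ∃ C : ℝ≥0∞, C ≠ ⊤ ∧ ∀ x, (∃ a ∈ d, a =ᵐ[μ] fun v => f k (x, v)) ∧
        fiberEnergy d γ (fun v => f k (x, v)) ≤ C) ∧
      ∀ x, Tendsto (fun k => ∫⁻ v, ‖f k (x, v) - g (x, v)‖ₑ ∂μ) atTop (𝓝 0) := by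
  have hl := hd.toIsLocalForm
  obtain ⟨R, -, hR⟩ := exists_approx_leftInverse (FormSpace.incl hl) FormSpace.norm_incl_le
    FormSpace.incl_injective
  have hdense : DenseRange (FormSpace.incl hl) := by
    have : Set.range (FormSpace.incl hl) = d := by
      ext a
      exact ⟨fun ⟨b, hb⟩ => hb ▸ b.2, fun ha => ⟨⟨a, ha⟩, rfl⟩⟩
    rw [DenseRange, this]
    exact hd.dense
  obtain ⟨c, hc, hcg⟩ := exists_stronglyMeasurable_curve (μ := μ) (p := 2) (by simp)
    (f := fun x v => g (x, v)) hg
  have hgL : ∀ x, MemLp (fun v => g (x, v)) 2 μ := fun x =>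
    MemLp.of_bound (hg.comp measurable_prodMk_left).aestronglyMeasurable 1
      (ae_of_all _ fun v => by rw [Real.norm_of_nonneg (h0 _)]; exact h1 _)
  replace hcg := fun x => hcg x (hgL x)
  have hnorm : ∀ x, ‖c x‖ ≤ 1 := fun x => by
    have h2 := Lp.norm_le_of_ae_bound (f := c x) zero_le_one (by
      filter_upwards [hcg x] with v hv
      rw [hv, Real.norm_of_nonneg (h0 _)]
      exact h1 _)
    simpa [measureUnivNNReal] using h2
  have hcm : ∀ k, StronglyMeasurable fun x => FormSpace.incl hl (R k (c x)) := fun k =>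
    ((FormSpace.incl hl).continuous.comp (R k).continuous).comp_stronglyMeasurable hc
  choose h hh hch using fun k => exists_measurable_version (hcm k)
  -- Clipping to [0, 1] is a normal contraction: it does not increase the energy, nor the distance
  -- to `g`, which takes values in [0, 1].
  refine ⟨fun k z => max 0 (min (h k z.1 z.2) 1), fun k => ?_, fun k z => ?_, fun k => ?_,
    fun x => ?_⟩
  · exact measurable_const.max ((hh k).min measurable_const)
  · exact ⟨le_max_left _ _, max_le zero_le_one (min_le_right _ _)⟩
  -- Uniform in x because ‖c x‖ ≤ 1 and γ[f] has L¹ norm at most twice the squared graph norm of f.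
  · refine ⟨ENNReal.ofReal (2 * ‖R k‖ ^ 2), ENNReal.ofReal_ne_top, fun x => ?_⟩
    have hm : ∃ a ∈ d, a =ᵐ[μ] h k x := ⟨(R k (c x)).1, (R k (c x)).2, hch k x⟩
    obtain ⟨e1, e2⟩ := hl.fiberEnergy_contraction lipschitzWith_clip (by simp) hm
    refine ⟨e1, e2.trans ?_⟩
    rw [fiberEnergy_eq (show (R k (c x)).1 ∈ d from (R k (c x)).2) (hch k x), ← ofReal_norm]
    refine ENNReal.ofReal_le_ofReal ((FormSpace.norm_cdc_le _).trans ?_)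
    have h2 : ‖R k (c x)‖ ≤ ‖R k‖ :=
      ((R k).le_opNorm _).trans (mul_le_of_le_one_right (norm_nonneg _) (hnorm x))
    gcongr
  · have h2 := hR hdense (c x)
    rw [tendsto_iff_norm_sub_tendsto_zero] at h2
    have h3 : Tendsto (fun k => ENNReal.ofReal ‖FormSpace.incl hl (R k (c x)) - c x‖) atTop
        (𝓝 0) := by
      simpa using ENNReal.tendsto_ofReal h2
    refine tendsto_of_tendsto_of_tendsto_of_le_of_le tendsto_const_nhds h3 (fun k => zero_le)
      fun k => ?_
    have h4 : ∫⁻ v, ‖max 0 (min (h k x v) 1) - g (x, v)‖ₑ ∂μ ≤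
        eLpNorm (FormSpace.incl hl (R k (c x)) - c x : Lp ℝ 2 μ) 1 μ := by
      rw [eLpNorm_one_eq_lintegral_enorm]
      refine lintegral_mono_ae ?_
      filter_upwards [hch k x, hcg x, Lp.coeFn_sub (FormSpace.incl hl (R k (c x))) (c x)]
        with v j1 j2 j3
      rw [j3, Pi.sub_apply, j1, j2, ← ofReal_norm, ← ofReal_norm]
      exact ENNReal.ofReal_le_ofReal (abs_clip_sub_le (h0 _) (h1 _))
    refine h4.trans ((eLpNorm_le_eLpNorm_of_exponent_le (q := 2) one_le_two
      (Lp.aestronglyMeasurable _)).trans ?_)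
    rw [Lp.norm_def, ENNReal.ofReal_toReal (Lp.eLpNorm_ne_top _)]

end DomainApproximation

/-! ### Truncated functionals with factors in the domain -/

section TruncationDomain

variable {X Y : Type*} [MeasurableSpace X] [MeasurableSingletonClass X]
  [MeasurableSpace Y] [MeasurableSingletonClass Y] {Q : Measure (Config X)}
  {μ : Measure Y} [IsProbabilityMeasure μ]
  {d : Set (Lp ℝ 2 μ)} {γ : Lp ℝ 2 μ → Lp ℝ 2 μ → Lp ℝ 1 μ}
  {A : Set X} {M C : ℝ≥0∞} {s : X × Y → ℝ≥0∞}

theorem toReal_expNeg_mem (a : ℝ≥0∞) : 0 ≤ (expNeg a).toReal ∧ (expNeg a).toReal ≤ 1 :=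
  ⟨ENNReal.toReal_nonneg,
    ENNReal.toReal_le_of_le_ofReal zero_le_one (by simpa using expNeg_le_one a)⟩

theorem IsLocalForm.fiberEnergy_const (hd : IsLocalForm μ d γ) {c : ℝ}
    (hc : ∃ a ∈ d, a =ᵐ[μ] fun _ => c) : fiberEnergy d γ (fun _ => c) = 0 := by
  rw [← (hd.hasCdc_const hc EventuallyEq.rfl).lintegral_eq hd]
  simp

-- In the mark of a point of `A` the functional is a constant in [0, 1] times one factor. In any
-- other mark it is constant: its energy is zero, but membership in the domain requires 1 ∈ d. This
-- is where the alternative on constants and on `A` enters.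
open Classical in
theorem IsLocalForm.fiber_truncLaplace (hd : IsLocalForm μ d γ) (hA : MeasurableSet A)
    (hA1 : (∃ a ∈ d, a =ᵐ[μ] fun _ => (1 : ℝ)) ∨ A = Set.univ) (hM : M ≠ ⊤)
    (hs : ∀ x, (∃ a ∈ d, a =ᵐ[μ] fun v => (expNeg (s (x, v))).toReal) ∧
      fiberEnergy d γ (fun v => (expNeg (s (x, v))).toReal) ≤ C)
    (m : Config X) (x : m.1) (u : m.1 → Y) :
    (∃ a ∈ d, a =ᵐ[μ] fun v => truncLaplace A M s (m.remark u x v)) ∧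
      fiberEnergy d γ (fun v => truncLaplace A M s (m.remark u x v)) ≤
        if m.toMeasure A ≤ M ∧ (x : X) ∈ A then C else 0 := by
  classical
  have h0 : ∃ a ∈ d, a =ᵐ[μ] fun _ => (0 : ℝ) := ⟨0, hd.zero_mem, Lp.coeFn_zero ℝ 2 μ⟩
  simp only [← Config.mark_update]
  rcases lt_or_ge M (m.toMeasure A) with hm | hm
  · simp only [truncLaplace_mark_of_lt hA hm]
    refine ⟨h0, ?_⟩
    rw [hd.fiberEnergy_const h0]
    exact zero_le
  obtain ⟨t, ht, -⟩ := exists_finset_points hA (ne_top_of_le_ne_top hM hm)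
  simp only [truncLaplace_mark hA hm ht]
  by_cases hx : (x : X) ∈ A
  · rw [if_pos ⟨hm, hx⟩]
    set c : ℝ := ∏ y ∈ t.erase x, (expNeg (s (y, u y))).toReal with hc
    have e : (fun v => ∏ y ∈ t, (expNeg (s (y, Function.update u x v y))).toReal) =
        fun v => c * (expNeg (s (x, v))).toReal := by
      funext v
      rw [← Finset.prod_erase_mul _ _ ((ht x).2 hx), Function.update_self]
      congr 1
      refine Finset.prod_congr rfl fun y hy => ?_
      rw [Function.update_of_ne (Finset.ne_of_mem_erase hy)]
    rw [e]
    refine ⟨hd.mem_smul c (hs x).1, ?_⟩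
    rw [hd.fiberEnergy_smul_le c (hs x).1]
    refine le_trans (mul_le_of_le_one_left zero_le ?_) (hs x).2
    have c0 : 0 ≤ c := Finset.prod_nonneg fun y _ => (toReal_expNeg_mem _).1
    have c1 : c ≤ 1 := Finset.prod_le_one (fun y _ => (toReal_expNeg_mem _).1)
      fun y _ => (toReal_expNeg_mem _).2
    exact ENNReal.ofReal_le_one.2 (pow_le_one₀ c0 c1)
  · have hone : ∃ a ∈ d, a =ᵐ[μ] fun _ => (1 : ℝ) := by
      rcases hA1 with h | h
      · exact h
      · exact absurd (h ▸ Set.mem_univ _) hx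
    have e : (fun v => ∏ y ∈ t, (expNeg (s (y, Function.update u x v y))).toReal) =
        fun _ => ∏ y ∈ t, (expNeg (s (y, u y))).toReal := by
      funext v
      refine Finset.prod_congr rfl fun y hy => ?_
      rw [Function.update_of_ne]
      rintro rfl
      exact hx ((ht y).1 hy)
    rw [e]
    have hmem : ∃ a ∈ d, a =ᵐ[μ] fun _ => ∏ y ∈ t, (expNeg (s (y, u y))).toReal := by
      simpa using hd.mem_smul (∏ y ∈ t, (expNeg (s (y, u y))).toReal) hone
    refine ⟨hmem, ?_⟩
    rw [hd.fiberEnergy_const hmem]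
    exact zero_le

-- At most `M` points contribute, each at most `C`, so the total energy is at most `M * C`.
open Classical in
theorem IsLocalForm.aeClosure_truncLaplace [IsProbabilityMeasure Q] (hd : IsLocalForm μ d γ) (hA : MeasurableSet A)
    (hA1 : (∃ a ∈ d, a =ᵐ[μ] fun _ => (1 : ℝ)) ∨ A = Set.univ) (hM : M ≠ ⊤) (hC : C ≠ ⊤)
    (hsm : Measurable s)
    (hs : ∀ x, (∃ a ∈ d, a =ᵐ[μ] fun v => (expNeg (s (x, v))).toReal) ∧
      fiberEnergy d γ (fun v => (expNeg (s (x, v))).toReal) ≤ C) :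
    AeClosure (upperDom Q μ d γ) (truncLaplace A M s) := by
  have : IsProbabilityMeasure (markedLaw Q μ) := isProbabilityMeasure_markedLaw
  have hmem : MemLp (truncLaplace A M s) 2 (markedLaw Q μ) :=
    MemLp.of_bound (measurable_truncLaplace hA hsm).aestronglyMeasurable 1
      (ae_of_all _ abs_truncLaplace_le)
  refine ⟨hmem.toLp, subset_closure (hd.mem_upperDom ?_ ?_), hmem.coeFn_toLp⟩
  · refine FiberDom.congr ?_ hmem.coeFn_toLp.symm
    exact ae_of_all _ fun m x => ae_of_all _ fun u =>
      (hd.fiber_truncLaplace hA hA1 hM hs m x u).1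
  · rw [upperEnergy_congr hmem.coeFn_toLp]
    refine ne_top_of_le_ne_top (ENNReal.mul_ne_top hM hC) ?_
    have h1 : ∀ m : Config X, ∑' x : m.1, ∫⁻ u, fiberEnergy d γ (fun v =>
        truncLaplace A M s (m.remark u x v)) ∂marksLaw μ m.1 ≤ M * C := by
      intro m
      have h2 : ∀ x : m.1, ∫⁻ u, fiberEnergy d γ (fun v =>
          truncLaplace A M s (m.remark u x v)) ∂marksLaw μ m.1 ≤
            if m.toMeasure A ≤ M ∧ (x : X) ∈ A then C else 0 := fun x => by
        refine (lintegral_mono fun u => (hd.fiber_truncLaplace hA hA1 hM hs m x u).2).trans ?_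
        rw [lintegral_const, measure_univ, mul_one]
      refine (ENNReal.tsum_le_tsum h2).trans ?_
      by_cases hm : m.toMeasure A ≤ M
      · obtain ⟨t, ht, hcard⟩ := exists_finset_points hA (ne_top_of_le_ne_top hM hm)
        rw [tsum_eq_sum (s := t) fun x hx => if_neg fun h => hx ((ht x).2 h.2)]
        refine (Finset.sum_le_card_nsmul t _ C fun x _ => ?_).trans ?_
        · split_ifs
          exacts [le_rfl, zero_le]
        · rw [nsmul_eq_mul, hcard]
          exact mul_le_mul_left hm C
      · simp [hm]
    refine (lintegral_mono h1).trans ?_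
    rw [lintegral_const, measure_univ, mul_one]

end TruncationDomain

/-! ### Laplace functionals in the closure of the domain -/

section UpperDense

variable {X Y : Type*} [MeasurableSpace X] [MeasurableSingletonClass X]
  [MeasurableSpace Y] [MeasurableSingletonClass Y] {Q : Measure (Config X)}
  [IsProbabilityMeasure Q] {μ : Measure Y} [IsProbabilityMeasure μ]
  {d : Set (Lp ℝ 2 μ)} {γ : Lp ℝ 2 μ → Lp ℝ 2 μ → Lp ℝ 1 μ}
  {A : Set X} {M : ℝ≥0∞} {s : X × Y → ℝ≥0∞}

theorem enorm_prod_sub_prod_le {ι : Type*} (t : Finset ι) (a b : ι → ℝ)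
    (ha : ∀ i, 0 ≤ a i ∧ a i ≤ 1) (hb : ∀ i, 0 ≤ b i ∧ b i ≤ 1) :
    ‖∏ i ∈ t, a i - ∏ i ∈ t, b i‖ₑ ≤ ∑ i ∈ t, ‖a i - b i‖ₑ := by
  classical
  induction t using Finset.induction_on with
  | empty => simp
  | insert i t hi ih =>
    rw [Finset.prod_insert hi, Finset.prod_insert hi, Finset.sum_insert hi]
    have e : a i * ∏ j ∈ t, a j - b i * ∏ j ∈ t, b j =
        (a i - b i) * ∏ j ∈ t, a j + b i * (∏ j ∈ t, a j - ∏ j ∈ t, b j) := by ring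
    rw [e]
    refine (enorm_add_le _ _).trans (add_le_add ?_ ?_)
    · rw [enorm_mul]
      refine mul_le_of_le_one_right zero_le ?_
      rw [Real.enorm_of_nonneg (Finset.prod_nonneg fun j _ => (ha j).1)]
      exact ENNReal.ofReal_le_one.2 (Finset.prod_le_one (fun j _ => (ha j).1) fun j _ => (ha j).2)
    · rw [enorm_mul]
      refine (mul_le_of_le_one_left zero_le ?_).trans ih
      rw [Real.enorm_of_nonneg (hb i).1]
      exact ENNReal.ofReal_le_one.2 (hb i).2

theorem lintegral_enorm_prod_sub_prod_le {ι : Type*} (t : Finset ι) {F G : ι → Y → ℝ}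
    (hF : ∀ i, Measurable (F i)) (hG : ∀ i, Measurable (G i))
    (hF1 : ∀ i v, 0 ≤ F i v ∧ F i v ≤ 1) (hG1 : ∀ i v, 0 ≤ G i v ∧ G i v ≤ 1) :
    ∫⁻ u, ‖∏ i ∈ t, F i (u i) - ∏ i ∈ t, G i (u i)‖ₑ ∂marksLaw μ ι ≤
      ∑ i ∈ t, ∫⁻ v, ‖F i v - G i v‖ₑ ∂μ := by
  have hpt : ∀ u : ι → Y, ‖∏ i ∈ t, F i (u i) - ∏ i ∈ t, G i (u i)‖ₑ ≤
      ∑ i ∈ t, ‖F i (u i) - G i (u i)‖ₑ := fun u =>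
    enorm_prod_sub_prod_le t (fun i => F i (u i)) (fun i => G i (u i)) (fun i => hF1 i (u i))
      fun i => hG1 i (u i)
  have hm : ∀ i, Measurable fun v => ‖F i v - G i v‖ₑ := fun i => ((hF i).sub (hG i)).enorm
  have hs : ∫⁻ u, ∑ i ∈ t, ‖F i (u i) - G i (u i)‖ₑ ∂marksLaw μ ι =
      ∑ i ∈ t, ∫⁻ u, ‖F i (u i) - G i (u i)‖ₑ ∂marksLaw μ ι :=
    lintegral_finsetSum _ fun i _ => (hm i).comp (measurable_pi_apply i)
  refine (lintegral_mono hpt).trans (hs.le.trans (Finset.sum_le_sum fun i _ => le_of_eq ?_))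
  exact (measurePreserving_eval_infinitePi (fun _ : ι => μ) i).lintegral_comp (hm i)

namespace IsLocalDirichletStructure

/-- The factors exp(-s) are approximated by domain functions `f k`, written as exp(-σ k). Given m,
only finitely many factors occur, and the L¹ distance of the products is at most the sum of the
distances of the factors; dominated convergence in m concludes. -/
theorem aeClosure_truncLaplace (hd : IsLocalDirichletStructure μ d γ) (hA : MeasurableSet A)
    (hA1 : (∃ a ∈ d, a =ᵐ[μ] fun _ => (1 : ℝ)) ∨ A = Set.univ) (hM : M ≠ ⊤)
    (hs : Measurable s) : AeClosure (upperDom Q μ d γ) (truncLaplace A M s) := by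
  have : IsProbabilityMeasure (markedLaw Q μ) := isProbabilityMeasure_markedLaw
  let g : X × Y → ℝ := fun z => (expNeg (s z)).toReal
  have hg : Measurable g := (measurable_expNeg.comp hs).ennreal_toReal
  obtain ⟨f, hf, hf01, hfd, hlim⟩ := hd.exists_approx hg (fun z => (toReal_expNeg_mem _).1)
    (fun z => (toReal_expNeg_mem _).2)
  let σ : ℕ → X × Y → ℝ≥0∞ := fun k z => logNeg (ENNReal.ofReal (f k z))
  have hσ : ∀ k z, (expNeg (σ k z)).toReal = f k z := fun k z => by
    rw [expNeg_logNeg (ENNReal.ofReal_le_one.2 (hf01 k z).2), ENNReal.toReal_ofReal (hf01 k z).1]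
  have hσm : ∀ k, Measurable (σ k) := fun k => measurable_logNeg.comp (hf k).ennreal_ofReal
  refine AeClosure.lim_lintegral (f := fun k => truncLaplace A M (σ k)) (C := 1) (fun k => ?_)
    (fun k => ae_of_all _ abs_truncLaplace_le)
    (measurable_truncLaplace hA hs).aestronglyMeasurable ?_
  · obtain ⟨C, hC, hfC⟩ := hfd k
    refine hd.toIsLocalForm.aeClosure_truncLaplace hA hA1 hM hC (hσm k) fun x => ?_
    simpa only [hσ] using hfC x
  have hm : ∀ k, Measurable fun ϖ => ‖truncLaplace A M (σ k) ϖ - truncLaplace A M s ϖ‖ₑ := fun k =>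
    ((measurable_truncLaplace hA (hσm k)).sub (measurable_truncLaplace hA hs)).enorm
  simp only [lintegral_markedLaw (hm _).aemeasurable]
  have h0 : ∫⁻ _ : Config X, (0 : ℝ≥0∞) ∂Q = 0 := lintegral_zero
  rw [← h0]
  refine tendsto_lintegral_of_dominated_convergence' (fun _ => 1)
    (fun k => aemeasurable_lintegral_marks (hm k).aemeasurable) (fun k => ?_) (by simp) ?_
  · refine ae_of_all _ fun m => ?_
    have hle : ∀ u : m.1 → Y,
        ‖truncLaplace A M (σ k) (m.mark u) - truncLaplace A M s (m.mark u)‖ₑ ≤ 1 := fun u => by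
      rw [← ofReal_norm]
      refine ENNReal.ofReal_le_one.2 (abs_le.2 ⟨?_, ?_⟩)
      · linarith [truncLaplace_nonneg (A := A) (M := M) (s := σ k) (m.mark u),
          truncLaplace_le_one (A := A) (M := M) (s := s) (m.mark u)]
      · linarith [truncLaplace_nonneg (A := A) (M := M) (s := s) (m.mark u),
          truncLaplace_le_one (A := A) (M := M) (s := σ k) (m.mark u)]
    refine (lintegral_mono hle).trans ?_
    rw [lintegral_const, measure_univ, mul_one]
  · refine ae_of_all _ fun m => ?_
    rcases lt_or_ge M (m.toMeasure A) with hmA | hmA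
    · simp [truncLaplace_mark_of_lt hA hmA]
    obtain ⟨t, ht, -⟩ := exists_finset_points hA (ne_top_of_le_ne_top hM hmA)
    simp only [truncLaplace_mark hA hmA ht, hσ]
    have hb : ∀ k, ∫⁻ u, ‖∏ x ∈ t, f k (x, u x) - ∏ x ∈ t, (expNeg (s (x, u x))).toReal‖ₑ
        ∂marksLaw μ m.1 ≤ ∑ x ∈ t, ∫⁻ v, ‖f k (x, v) - g (x, v)‖ₑ ∂μ := by
      intro k
      exact lintegral_enorm_prod_sub_prod_le t (F := fun x v => f k (x, v))
        (G := fun x v => g (x, v)) (fun x => (hf k).comp measurable_prodMk_left)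
        (fun x => hg.comp measurable_prodMk_left) (fun x v => hf01 k (x, v))
        fun x v => toReal_expNeg_mem (s (x, v))
    refine tendsto_of_tendsto_of_tendsto_of_le_of_le tendsto_const_nhds ?_ (fun k => zero_le) hb
    have := tendsto_finsetSum t fun (x : m.1) _ => hlim x
    simpa using this

theorem aeClosure_truncLaplace_lt_top (hd : IsLocalDirichletStructure μ d γ) (hA : MeasurableSet A)
    (hA1 : (∃ a ∈ d, a =ᵐ[μ] fun _ => (1 : ℝ)) ∨ A = Set.univ) (hs : Measurable s) :
    AeClosure (upperDom Q μ d γ) ({ϖ | ϖ.toMeasure (A ×ˢ Set.univ) ≠ ⊤}.indicator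
      (Config.laplace ((A ×ˢ Set.univ).indicator s))) := by
  have : IsProbabilityMeasure (markedLaw Q μ) := isProbabilityMeasure_markedLaw
  refine AeClosure.lim (f := fun n : ℕ => truncLaplace A n s) (C := 1)
    (fun n => hd.aeClosure_truncLaplace hA hA1 (by simp) hs)
    (fun n => ae_of_all _ abs_truncLaplace_le) (ae_of_all _ fun ϖ => ?_)
  by_cases h : ϖ.toMeasure (A ×ˢ Set.univ) = ⊤
  · rw [Set.indicator_of_notMem (by simpa using h)]
    refine tendsto_const_nhds.congr fun n => ?_
    rw [truncLaplace, Set.indicator_of_notMem]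
    simp [h]
  · rw [Set.indicator_of_mem (by simpa using h)]
    refine tendsto_const_nhds.congr' ?_
    obtain ⟨n, hn⟩ := ENNReal.exists_nat_gt h
    filter_upwards [eventually_ge_atTop n] with k hk
    rw [truncLaplace, Set.indicator_of_mem]
    exact hn.le.trans (by exact_mod_cast hk)

theorem aeClosure_laplace_of_finite (hd : IsLocalDirichletStructure μ d γ)
    (hfin : ∀ᵐ m ∂Q, m.1.Finite) (hs : Measurable s) :
    AeClosure (upperDom Q μ d γ) (Config.laplace s) := by
  refine (hd.aeClosure_truncLaplace_lt_top (Q := Q) (A := Set.univ) MeasurableSet.univ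
    (Or.inr rfl) hs).congr ?_
  have hm : Measurable ({ϖ : Config (X × Y) | ϖ.toMeasure (Set.univ ×ˢ Set.univ) ≠ ⊤}.indicator
      (Config.laplace ((Set.univ ×ˢ Set.univ).indicator s))) :=
    (Config.measurable_laplace (hs.indicator (MeasurableSet.univ.prod MeasurableSet.univ))).indicator
      (Config.measurable_toMeasure_apply (MeasurableSet.univ.prod MeasurableSet.univ)
        (measurableSet_singleton ⊤).compl)
  refine ae_markedLaw_of_ae_ae (nullMeasurableSet_eq_fun hm.aemeasurable
    (Config.measurable_laplace hs).aemeasurable) ?_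
  filter_upwards [hfin] with m hmf
  refine ae_of_all _ fun u => ?_
  change _ = Config.laplace s (m.mark u)
  rw [Set.indicator_of_mem, Set.univ_prod_univ, Set.indicator_univ]
  rw [Set.mem_ofPred_eq, Config.toMeasure_mark_prod_univ MeasurableSet.univ,
    Config.toMeasure_apply MeasurableSet.univ, Set.inter_univ]
  rw [← Set.encard_ne_top_iff] at hmf
  simpa using hmf

/-- The conditional expectation of the functional is exp(-∞) = 0. -/
theorem _root_.laplace_eq_zero_ae (hs : Measurable s) {ε : ℝ≥0∞} (hε : ε ≠ 0) {m : Config X}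
    (hm : m.toMeasure {x | ε ≤ logNeg (∫⁻ v, expNeg (s (x, v)) ∂μ)} = ⊤) :
    ∀ᵐ u ∂marksLaw μ m.1, Config.laplace s (m.mark u) = 0 := by
  have hq : Measurable fun x : X => logNeg (∫⁻ v, expNeg (s (x, v)) ∂μ) :=
    measurable_logNeg.comp (Measurable.lintegral_prod_right' (f := fun z : X × Y => expNeg (s z))
      (measurable_expNeg.comp hs))
  have h1 := lintegral_expNeg_marks (μ := μ) m hs
  have h2 : ∫⁻ x, logNeg (∫⁻ v, expNeg (s (x, v)) ∂μ) ∂m.toMeasure = ⊤ := by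
    have h3 := mul_meas_ge_le_lintegral (μ := m.toMeasure) hq ε
    rw [hm, ENNReal.mul_top hε] at h3
    exact top_le_iff.1 h3
  rw [h2, expNeg_top] at h1
  have hmeas : Measurable fun u : m.1 → Y => expNeg (∫⁻ z, s z ∂(m.mark u).toMeasure) :=
    (measurable_expNeg.comp (Config.measurable_lintegral hs)).comp (Config.measurable_mark m)
  filter_upwards [(lintegral_eq_zero_iff hmeas).1 h1] with u hu
  rw [Config.laplace]
  have : expNeg (∫⁻ z, s z ∂(m.mark u).toMeasure) = 0 := hu
  rw [this, ENNReal.toReal_zero]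

/-- A function bounded by 1 with mean 1 is almost surely 1. -/
theorem _root_.ae_eq_zero_of_logNeg_eq_zero (hs : Measurable s) {x : X}
    (hx : logNeg (∫⁻ v, expNeg (s (x, v)) ∂μ) = 0) : ∀ᵐ v ∂μ, s (x, v) = 0 := by
  have hm : Measurable fun v => expNeg (s (x, v)) :=
    measurable_expNeg.comp (hs.comp measurable_prodMk_left)
  have h1 : ∫⁻ v, expNeg (s (x, v)) ∂μ = 1 := by
    have hle : ∫⁻ v, expNeg (s (x, v)) ∂μ ≤ 1 := by
      refine (lintegral_mono fun v => expNeg_le_one _).trans ?_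
      simp
    rw [← expNeg_logNeg hle, hx, expNeg_zero]
  have h2 : (fun v => expNeg (s (x, v))) =ᵐ[μ] fun _ => 1 := by
    refine ae_eq_of_ae_le_of_lintegral_le (ae_of_all _ fun v => expNeg_le_one _) ?_
      aemeasurable_const ?_
    · rw [h1]
      exact ENNReal.one_ne_top
    · rw [h1]
      simp
  filter_upwards [h2] with v hv
  exact expNeg_injective (hv.trans expNeg_zero.symm)

/-- Let q(x) = -log ∫ exp(-s(x, v)) dμ(v), and let A n be the set where q ≥ 1/(n + 1). If some A n
contains infinitely many points of m, the functional vanishes almost surely, as do its truncations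
from that n on. Otherwise every truncating event has full probability given m, and the points lost
in the limit have q = 0, hence almost surely s = 0. Monotone convergence then recovers the full
functional. -/
theorem aeClosure_laplace_of_one_mem (hd : IsLocalDirichletStructure μ d γ)
    (hone : ∃ a ∈ d, a =ᵐ[μ] fun _ => (1 : ℝ)) (hs : Measurable s) :
    AeClosure (upperDom Q μ d γ) (Config.laplace s) := by
  have : IsProbabilityMeasure (markedLaw Q μ) := isProbabilityMeasure_markedLaw
  let q : X → ℝ≥0∞ := fun x => logNeg (∫⁻ v, expNeg (s (x, v)) ∂μ)
  have hq : Measurable q :=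
    measurable_logNeg.comp (Measurable.lintegral_prod_right' (f := fun z : X × Y => expNeg (s z))
      (measurable_expNeg.comp hs))
  let A : ℕ → Set X := fun n => {x | ((n : ℝ≥0∞) + 1)⁻¹ ≤ q x}
  have hA : ∀ n, MeasurableSet (A n) := fun n => measurableSet_le measurable_const hq
  have hAmono : Monotone A := fun n k hnk x hx =>
    (ENNReal.inv_le_inv.2 (by gcongr)).trans (show ((n : ℝ≥0∞) + 1)⁻¹ ≤ q x from hx)
  have hAmem : ∀ x, q x ≠ 0 → ∃ n, x ∈ A n := by
    intro x hx
    obtain ⟨n, hn⟩ := ENNReal.exists_inv_nat_lt hx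
    exact ⟨n, (ENNReal.inv_le_inv.2 le_self_add).trans hn.le⟩
  let G : ℕ → Config (X × Y) → ℝ := fun n => {ϖ | ϖ.toMeasure (A n ×ˢ Set.univ) ≠ ⊤}.indicator
    (Config.laplace ((A n ×ˢ Set.univ).indicator s))
  have hG : ∀ n, Measurable (G n) := fun n =>
    (Config.measurable_laplace (hs.indicator ((hA n).prod MeasurableSet.univ))).indicator
      (Config.measurable_toMeasure_apply ((hA n).prod MeasurableSet.univ)
        (measurableSet_singleton ⊤).compl)
  refine AeClosure.lim (f := G) (C := 1)
    (fun n => hd.aeClosure_truncLaplace_lt_top (hA n) (Or.inl hone) hs)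
    (fun n => ae_of_all _ fun ϖ => ?_) ?_
  · have h0 : 0 ≤ G n ϖ := Set.indicator_nonneg (fun _ _ => Config.laplace_nonneg _ _) _
    rw [abs_of_nonneg h0]
    exact Set.indicator_le' (fun _ _ => Config.laplace_le_one _ _) (fun _ _ => zero_le_one) _
  refine ae_markedLaw_of_ae_ae
    (measurableSet_tendsto_fun hG (Config.measurable_laplace hs)).nullMeasurableSet ?_
  refine ae_of_all _ fun m => ?_
  have : Countable m.1 := m.2.to_subtype
  by_cases hfin : ∃ n, m.toMeasure (A n) = ⊤
  · obtain ⟨n, hn⟩ := hfin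
    have hε : ((n : ℝ≥0∞) + 1)⁻¹ ≠ 0 := ENNReal.inv_ne_zero.2 (by simp)
    filter_upwards [laplace_eq_zero_ae (μ := μ) hs hε hn] with u hu
    change Tendsto _ atTop (𝓝 (Config.laplace s (m.mark u)))
    rw [hu]
    refine tendsto_const_nhds.congr' ?_
    filter_upwards [eventually_ge_atTop n] with k hk
    refine (Set.indicator_of_notMem ?_ _).symm
    simp only [Set.mem_ofPred_eq, not_not]
    rw [Config.toMeasure_mark_prod_univ (hA k)]
    exact top_le_iff.1 (hn.symm.le.trans (measure_mono (hAmono hk)))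
  · have hz : ∀ x : m.1, ∀ᵐ u ∂marksLaw μ m.1, q x = 0 → s (x, u x) = 0 := fun x => by
      by_cases hx : q x = 0
      · have h1 := (measurePreserving_eval_infinitePi (fun _ : m.1 => μ)
          x).quasiMeasurePreserving.ae (ae_eq_zero_of_logNeg_eq_zero hs hx)
        filter_upwards [h1] with u hu _ using hu
      · exact ae_of_all _ fun u h => absurd h hx
    filter_upwards [ae_all_iff.2 hz] with u hu
    change Tendsto _ atTop (𝓝 (Config.laplace s (m.mark u)))
    have hGe : ∀ n, G n (m.mark u) = Config.laplace ((A n ×ˢ Set.univ).indicator s) (m.mark u) := by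
      intro n
      refine Set.indicator_of_mem ?_ _
      rw [Set.mem_ofPred_eq, Config.toMeasure_mark_prod_univ (hA n)]
      exact fun h => hfin ⟨n, h⟩
    simp only [hGe, Config.laplace]
    refine (ENNReal.tendsto_toReal (ne_top_of_le_ne_top ENNReal.one_ne_top
      (expNeg_le_one _))).comp ((continuous_expNeg.tendsto _).comp ?_)
    have hae : ∀ᵐ z ∂(m.mark u).toMeasure, q z.1 = 0 → s z = 0 := by
      have : Countable (m.mark u).1 := (m.mark u).2.to_subtype
      rw [Config.toMeasure, Measure.ae_sum_iff]
      rintro ⟨_, x, rfl⟩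
      rw [ae_dirac_eq]
      exact hu x
    refine lintegral_tendsto_of_tendsto_of_monotone
      (fun n => (hs.indicator ((hA n).prod MeasurableSet.univ)).aemeasurable)
      (ae_of_all _ fun z n k hnk => ?_) ?_
    · exact Set.indicator_le_indicator_of_subset (Set.prod_mono_left (hAmono hnk))
        (fun _ => zero_le) z
    · filter_upwards [hae] with z hz
      by_cases hqz : q z.1 = 0
      · rw [hz hqz]
        refine tendsto_const_nhds.congr fun n => ?_
        by_cases hmem : z ∈ A n ×ˢ (Set.univ : Set Y)
        · rw [Set.indicator_of_mem hmem, hz hqz]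
        · rw [Set.indicator_of_notMem hmem]
      · obtain ⟨n, hn⟩ := hAmem _ hqz
        refine tendsto_const_nhds.congr' ?_
        filter_upwards [eventually_ge_atTop n] with k hk
        exact (Set.indicator_of_mem (Set.mk_mem_prod (hAmono hk hn) (Set.mem_univ z.2)) s).symm

theorem upper_dense (hd : IsLocalDirichletStructure μ d γ)
    (h : (∃ a ∈ d, a =ᵐ[μ] fun _ => (1 : ℝ)) ∨ ∀ᵐ m ∂Q, m.1.Finite) :
    Dense (upperDom Q μ d γ) := by
  have : IsProbabilityMeasure (markedLaw Q μ) := isProbabilityMeasure_markedLaw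
  have hU := hd.toIsLocalForm.upper (Q := Q)
  refine hU.dense_of_indicator fun S hS => ?_
  refine Config.induction_laplace (p := AeClosure (upperDom Q μ d γ)) (fun s hs => ?_)
    (fun f g => hU.aeClosure_add) (fun c f => hU.aeClosure_smul c) (fun F f hF ⟨C, hC⟩ hl => ?_) hS
  · exact h.elim (fun h => hd.aeClosure_laplace_of_one_mem h hs)
      fun h => hd.aeClosure_laplace_of_finite h hs
  · exact AeClosure.lim hF (fun n => ae_of_all _ (hC n)) (ae_of_all _ hl)

end IsLocalDirichletStructure

end UpperDense

end

theorem theorem2 {X Y : Type*} [MeasurableSpace X] [MeasurableSingletonClass X]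
    [MeasurableSpace Y] [MeasurableSingletonClass Y]
    (Q : Measure (Config X)) [IsProbabilityMeasure Q]
    (μ : Measure Y) [IsProbabilityMeasure μ]
    (d : Set (Lp ℝ 2 μ)) (γ : Lp ℝ 2 μ → Lp ℝ 2 μ → Lp ℝ 1 μ)
    (hd : IsLocalDirichletStructure μ d γ) :
    -- the marked law is a probability measure
    IsProbabilityMeasure (markedLaw Q μ) ∧
    -- the upper structure is a local Dirichlet structure with carré du champ
    IsLocalForm (markedLaw Q μ) (upperDom Q μ d γ) (upperCdc Q μ d γ) ∧
    (((∃ a ∈ d, a =ᵐ[μ] fun _ => (1 : ℝ)) ∨ ∀ᵐ m ∂Q, m.1.Finite) →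
      IsLocalDirichletStructure (markedLaw Q μ) (upperDom Q μ d γ) (upperCdc Q μ d γ)) ∧
    -- the lent particle formula
    (∀ F ∈ upperDom Q μ d γ,
      (∃ K, IsCdcEpsPlus Q μ d γ F K ∧
        ∀ᵐ ϖ ∂(markedLaw Q μ), LentParticleAt (upperCdc Q μ d γ F F) K ϖ) ∧
      ∀ K, IsCdcEpsPlus Q μ d γ F K →
        ∀ᵐ m ∂Q, ∀ᵐ u ∂(marksLaw μ m.1),
          LentParticleAt (upperCdc Q μ d γ F F) K (m.mark u)) ∧
    -- the energy image density property
    ((∀ n : ℕ, EID (marksLaw μ (Fin n)) (prodDom μ d γ (Fin n)) (prodCdc μ d γ (Fin n))) →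
      EID (markedLaw Q μ) (upperDom Q μ d γ) (upperCdc Q μ d γ)) := by
  have hl := hd.toIsLocalForm
  refine ⟨isProbabilityMeasure_markedLaw, hl.upper,
    fun h => { hl.upper with dense := hd.upper_dense h },
    fun F hF => ⟨hl.exists_lentParticle hF, fun K hK => ?_⟩, hl.eid_upper⟩
  filter_upwards [hasSum_epsMinus hF hK] with m hm
  filter_upwards [hm] with u hu using Config.integrable_toMeasure hu
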